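/- Let $X$ be a smooth complex surface, $p\in X$, let $r\ge 2$, and let $D_1,\dots,D_r$ be smooth germs of curves at $p$ such that any two distinct ones $D_i, D_j$ have the same contact order (local intersection multiplicity at $p$) $t\ge 1$. Let $m_1,\dots,m_r\ge 2$ be integers and $\Delta=\sum_{k=1}^r\bigl(1-\frac1{m_k}\bigr)D_k$. Say that a pair $(U,\sum_k b_kD_k)$, with $U$ a smooth surface, is klt if $0<b_k<1$ for all $k$ and if for every log resolution $f:Y\to U$, writing $$K_Y+\tilde\Delta=f^*\bigl(K_U+\textstyle\sum_k b_kD_k\bigr)+\sum_i a_iE_i$$ with $\tilde\Delta$ the strict transform and $E_i$ the exceptional prime divisors, one has $a_i>-1$ for all $i$; the germ $(X,\Delta)$ at $p$ is klt if its sufficiently small open representatives are klt. Then the germ $(X,\Delta)$ is klt at $p$ if and only if $$\sum_{k=1}^r\Bigl(1-\frac1{m_k}\Bigr)<1+\frac1t .$$ If moreover $m_1\le m_2\le\dots\le m_r$, then $(X,\Delta)$ is klt at $p$ if and only if $(t,r,m_1,\dots,m_r)$ is one of the following: - $t=1$, $r=2$, and $(m_1,m_2)$ arbitrary; - $t=1$,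 $r=3$, and $(m_1,m_2,m_3)=(2,2,m_3)$ with $m_3\ge2$ arbitrary, or $(2,3,m_3)$ with $3\le m_3\le5$; - $t=2$, $r=2$, and $(m_1,m_2)=(2,m_2)$ with $m_2\ge2$ arbitrary, or $(3,m_2)$ with $3\le m_2\le5$; - $t=3$, $r=2$, and $(m_1,m_2)=(2,m_2)$ with $2\le m_2\le5$; - $t\in\{4,5\}$, $r=2$, and $(m_1,m_2)\in\{(2,2),(2,3)\}$; - $t\ge6$, $r=2$, and $(m_1,m_2)=(2,2)$. -/

import Mathlib

open scoped Manifold ContDiff Topology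

universe u

namespace SurfacePair

section

variable {X : Type u} [TopologicalSpace X] [ChartedSpace (ℂ × ℂ) X]

/-- `h` is a holomorphic function germ at the point `q` of a complex surface. -/
def HolomorphicAt (h : X → ℂ) (q : X) : Prop :=
  ContMDiffAt 𝓘(ℂ, ℂ × ℂ) 𝓘(ℂ, ℂ) ω h q

/-- `h` is a regular equation of `C` at `q`: `h` is holomorphic at `q`, vanishes at `q` with
nonzero differential, and `C` coincides with `{h = 0}` near `q`. -/
def IsRegularEquation (C : Set X) (q : X) (h : X → ℂ) : Prop :=
  HolomorphicAt h q ∧ h q = 0 ∧ mfderiv 𝓘(ℂ, ℂ × ℂ) 𝓘(ℂ, ℂ) h q ≠ 0 ∧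
    ∀ᶠ x in 𝓝 q, x ∈ C ↔ h x = 0

/-- The germ of `C` at `q` is a smooth (irreducible) germ of curve passing through `q`. -/
def IsSmoothCurveAt (C : Set X) (q : X) : Prop :=
  ∃ h, IsRegularEquation C q h

/-- `γ` is a regular holomorphic parametrisation of a smooth curve germ `C` at `q`. -/
def IsRegularParam (C : Set X) (q : X) (γ : ℂ → X) : Prop :=
  ContMDiffAt 𝓘(ℂ, ℂ) 𝓘(ℂ, ℂ × ℂ) ω γ 0 ∧ γ 0 = q ∧
    mfderiv 𝓘(ℂ, ℂ) 𝓘(ℂ, ℂ × ℂ) γ 0 ≠ 0 ∧ ∀ᶠ s in 𝓝 (0 : ℂ), γ s ∈ C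

/-- The smooth curve germs `C`, `C'` at `q` have contact order (local intersection
multiplicity) `t`: an equation of `C`, restricted to `C'`, vanishes at `q` to order exactly `t`.
Transversal germs have contact order `1`; `y = 0` and `y = x ^ t` have contact order `t`. -/
def HasContactOrder (C C' : Set X) (q : X) (t : ℕ) : Prop :=
  ∃ h γ, IsRegularEquation C q h ∧ IsRegularParam C' q γ ∧
    analyticOrderAt (fun s => h (γ s)) 0 = (t : ℕ∞)

/-- `h` is a local equation at `q` of the (reduced) hypersurface `D`: it generates the ideal of
holomorphic germs at `q` that vanish on `D`. (When `q` is not in the closed set `D` this says that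
`h` is a unit.) -/
def IsLocalEquation (D : Set X) (q : X) (h : X → ℂ) : Prop :=
  HolomorphicAt h q ∧ (∀ᶠ x in 𝓝 q, x ∈ D → h x = 0) ∧
    ∀ g : X → ℂ, HolomorphicAt g q → (∀ᶠ x in 𝓝 q, x ∈ D → g x = 0) →
      ∃ k : X → ℂ, HolomorphicAt k q ∧ ∀ᶠ x in 𝓝 q, g x = h x * k x

/-- The function germ `g` at the point `y` of the smooth curve `E` vanishes along `E` to order
exactly `n`: `g = z ^ n * u` near `y`, where `z` is a local equation of `E` and `u` is holomorphic
and does not vanish identically on `E` near `y`. -/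
def HasOrderAlong (E : Set X) (y : X) (g : X → ℂ) (n : ℕ) : Prop :=
  ∃ z u : X → ℂ, IsLocalEquation E y z ∧ HolomorphicAt u y ∧
    (∀ᶠ x in 𝓝 y, g x = z x ^ n * u x) ∧ ¬ ∀ᶠ x in 𝓝 y, x ∈ E → u x = 0

/-- `A` is a closed analytic subset: locally, on the whole surface, the common zero set of
finitely many holomorphic functions. -/
def IsAnalyticSubset (A : Set X) : Prop :=
  ∀ q : X, ∃ (n : ℕ) (g : Fin n → X → ℂ), (∀ i, HolomorphicAt (g i) q) ∧
    ∀ᶠ x in 𝓝 q, x ∈ A ↔ ∀ i, g i x = 0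

/-- `S` is a simple normal crossing divisor: it is the union of a locally finite family of
distinct connected closed curves such that, near every point, the curves of the family passing
through this point are distinct coordinate axes of a suitable holomorphic coordinate system `z`
centred at this point. -/
def IsSNC (S : Set X) : Prop :=
  ∃ (ι : Type u) (C : ι → Set X), Function.Injective C ∧ LocallyFinite C ∧
    (∀ i, IsClosed (C i) ∧ IsConnected (C i)) ∧ S = ⋃ i, C i ∧
    ∀ y : X, ∃ (z : X → ℂ × ℂ) (e : ι → Fin 2),
      IsLocalDiffeomorphAt 𝓘(ℂ, ℂ × ℂ) 𝓘(ℂ, ℂ × ℂ) ω z y ∧ z y = 0 ∧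
      Set.InjOn e {i | y ∈ C i} ∧
      ∀ i, y ∈ C i → ∀ᶠ x in 𝓝 y, x ∈ C i ↔ ![(z x).1, (z x).2] (e i) = 0

end

section

variable {X : Type u} [TopologicalSpace X] [ChartedSpace (ℂ × ℂ) X]
variable {Y : Type u} [TopologicalSpace Y] [ChartedSpace (ℂ × ℂ) Y]

/-- The exceptional locus of `f`: the points at which `f` is not a local isomorphism. -/
def excLocus (f : Y → X) : Set Y :=
  {y | ¬ IsLocalDiffeomorphAt 𝓘(ℂ, ℂ × ℂ) 𝓘(ℂ, ℂ × ℂ) ω f y}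

/-- `f : Y → X` is a proper bimeromorphic holomorphic map: it is an isomorphism from
the complement of `f⁻¹(A)` onto the complement of `A`, where `A` is a nowhere dense analytic
subset of `X` with nowhere dense preimage. -/
def IsModification (f : Y → X) : Prop :=
  ContMDiff 𝓘(ℂ, ℂ × ℂ) 𝓘(ℂ, ℂ × ℂ) ω f ∧ IsProperMap f ∧
    ∃ A : Set X, IsAnalyticSubset A ∧ Dense Aᶜ ∧ Dense (f ⁻¹' Aᶜ) ∧
      Set.BijOn f (f ⁻¹' Aᶜ) Aᶜ ∧ Disjoint (excLocus f) (f ⁻¹' Aᶜ)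

/-- `f : Y → X` (with `Y` smooth) is a log resolution of the pair with boundary components `D`:
`f` is a modification and `Exc(f) ∪ f⁻¹(⋃ D k)` is a simple normal crossing divisor. -/
def IsLogResolution {ι : Type*} (D : ι → Set X) (f : Y → X) : Prop :=
  IsModification f ∧ IsSNC (excLocus f ∪ f ⁻¹' ⋃ k, D k)

/-- `E` is an exceptional prime divisor of a log resolution `f`. The components of the simple
normal crossing divisor `Exc(f)` are exactly the closed connected smooth curves inside it. -/
def IsExceptionalDivisor (f : Y → X) (E : Set Y) : Prop :=
  IsClosed E ∧ IsConnected E ∧ E ⊆ excLocus f ∧ ∀ y ∈ E, IsSmoothCurveAt E y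

/-- The Jacobian determinant of `f` near `y₀`, in the preferred charts at `y₀` and `f y₀`. Its
divisor near `y₀` is the relative canonical divisor `K_Y - f^* K_X`. -/
noncomputable def jacobian (f : Y → X) (y₀ : Y) : Y → ℂ := fun y =>
  (fderiv ℂ (writtenInExtChartAt 𝓘(ℂ, ℂ × ℂ) 𝓘(ℂ, ℂ × ℂ) y₀ f)
    (extChartAt 𝓘(ℂ, ℂ × ℂ) y₀ y)).det

/-- `a` is the coefficient `a_E` of the exceptional divisor `E` in
`K_Y + Δ' = f^* (K_X + Δ) + ∑ a_E E`, where `Δ = ∑ b k • D k` and `Δ'` is the strict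
transform of `Δ`. As `E` is not a component of `Δ'`, this coefficient is
`ord_E (K_Y - f^* K_X) - ∑ b k * ord_E (f^* D k)`. These orders are computed at a
point `y` of `E`; they do not depend on it. -/
def HasDiscrepancy {ι : Type*} [Fintype ι] (D : ι → Set X) (b : ι → ℝ) (f : Y → X)
    (E : Set Y) (a : ℝ) : Prop :=
  ∃ y ∈ E, ∃ (j : ℕ) (h : ι → X → ℂ) (n : ι → ℕ),
    HasOrderAlong E y (jacobian f y) j ∧
    (∀ k, IsLocalEquation (D k) (f y) (h k)) ∧
    (∀ k, HasOrderAlong E y (fun x => h k (f x)) (n k)) ∧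
    a = (j : ℝ) - ∑ k, b k * (n k : ℝ)

end

/-- The pair `(X, ∑ b k • D k)` on the smooth complex surface `X` is klt: the coefficients lie in
`(0, 1)` and all the discrepancies of all its log resolutions are `> -1`. -/
def IsKlt (X : Type u) [TopologicalSpace X] [ChartedSpace (ℂ × ℂ) X]
    {ι : Type*} [Fintype ι] (D : ι → Set X) (b : ι → ℝ) : Prop :=
  (∀ k, 0 < b k ∧ b k < 1) ∧
    ∀ (Y : Type u) [TopologicalSpace Y] [T2Space Y] [ChartedSpace (ℂ × ℂ) Y]
      [IsManifold 𝓘(ℂ, ℂ × ℂ) ω Y] (f : Y → X), IsLogResolution D f →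
      ∀ (E : Set Y) (a : ℝ), IsExceptionalDivisor f E → HasDiscrepancy D b f E a → -1 < a

/-- The germ at `p` of the pair `(X, ∑ b k • D k)` is klt: all its sufficiently small open
representatives are klt pairs. -/
def IsKltGerm {X : Type u} [TopologicalSpace X] [ChartedSpace (ℂ × ℂ) X]
    (p : X) {ι : Type*} [Fintype ι] (D : ι → Set X) (b : ι → ℝ) : Prop :=
  ∃ V ∈ 𝓝 p, ∀ U : TopologicalSpace.Opens X, p ∈ U → (U : Set X) ⊆ V →
    IsKlt U (fun k => ((↑) : U → X) ⁻¹' D k) b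

end SurfacePair

/-!
Write `b k = 1 - 1 / m k`. Both parts follow from the criterion `isKltGerm_iff_sum_lt`: the germ is
klt if and only if `∑ b k < 1 + 1 / t`. The list is then elementary arithmetic: all `b k` are at
least `1 / 2`, so at most three curves occur, and the inequality becomes `1 < 1 / a + 1 / b + 1 / c`
for three integers, which are `m 0, m 1, t` for two curves and `m 0, m 1, m 2` for three
transversal ones (`sum_lt_iff_of_monotone`).

Both directions of the criterion use coordinates `(x, y)` on a small bidisc in which the curves
are the graphs `y = x ^ t * u k x`, where the functions `u k` have pairwise distinct values at every
point (`exists_isNormalForm`): a generic linear function serves as `x` and the equation of one of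
the curves as `y`, so that the contact orders are the vanishing orders of differences of functions
of `x`.

*Sufficiency.* Let `f` be a log resolution of an open subset of the bidisc and `E` an exceptional
divisor. Let `a`, `n k` and `j` be the orders along `E` of `x`, of the equation
`h k = y - x ^ t * u k x` and of the Jacobian determinant of `f`. Since `(x, h k)` is a coordinate
system and `dx / x ∧ dh / h` has at most a simple pole along `E`, one has `a + n k ≤ j + 1`
(`add_le_jacobian_order`). The differences `h i - h k` are `x ^ t` times a unit, so at most one of
the numbers `n k` exceeds `t * a`, and if one does, all the others equal `t * a`. These relations
and the inequality for `∑ b k` imply that the discrepancy `j - ∑ b k * n k` is greater than `-1`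
(`neg_one_lt_of_orders`). No factorisation of `f` into blow-ups is needed.

*Necessity.* It suffices to exhibit one divisor. Blowing up the origin and then `t - 1` times the
point of the last exceptional curve on the strict transform of `y = 0` separates the curves; the
last exceptional curve has discrepancy `t - t * ∑ b k`, and this exceeds `-1` exactly when
`∑ b k < 1 + 1 / t` (`Tower.hasDiscrepancy_excCurve`). The iterated blow-up is constructed at once
(`Tower`), as the set of the points `(q, w)` of the product of the surface with a product of
projective lines that satisfy the relations `w 0 = y` and `w k = x * w (k + 1)`, the latter in
homogeneous form; thus `w k` stands for `y / x ^ k`. These conditions are closed, so that the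
projection is proper, and `t + 1` monomial charts cover the set. The exceptional curves and the
graphs `w t = u k x` are coordinate axes in suitable coordinates near every point
(`Tower.isLogResolution_proj`).
-/

namespace SurfacePair

/-! ### Division of holomorphic functions by a coordinate -/

/-- The projection of `ℂ²` onto the line `{v.1 = 0}`. -/
noncomputable def projSnd : (ℂ × ℂ) →L[ℂ] (ℂ × ℂ) :=
  (0 : (ℂ × ℂ) →L[ℂ] ℂ).prod (ContinuousLinearMap.snd ℂ ℂ ℂ)

lemma projSnd_apply (v : ℂ × ℂ) : projSnd v = (0, v.2) := rfl

lemma norm_projSnd_le : ‖projSnd‖ ≤ 1 := by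
  refine ContinuousLinearMap.opNorm_le_bound _ zero_le_one fun v => ?_
  rw [projSnd_apply, Prod.norm_def, one_mul]
  simpa using norm_snd_le v

/-- The power series of the quotient of `∑ (p n) vⁿ - ∑ (p n) (projSnd v)ⁿ` by `v.1`: the
difference of the terms of degree `n + 1` is expanded as a telescoping sum, in which the `i`-th
summand has `v - projSnd v = v.1 • (1, 0)` in the `i`-th slot. -/
noncomputable def divFst (p : FormalMultilinearSeries ℂ (ℂ × ℂ) ℂ) :
    FormalMultilinearSeries ℂ (ℂ × ℂ) ℂ := fun n =>
  ∑ i : Fin (n + 1), ((p (n + 1)).curryMid i ((1 : ℂ), (0 : ℂ))).compContinuousLinearMap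
    (fun j : Fin n => if j.castSucc < i then projSnd else ContinuousLinearMap.id ℂ (ℂ × ℂ))

lemma divFst_apply (p : FormalMultilinearSeries ℂ (ℂ × ℂ) ℂ) (n : ℕ) (v : ℂ × ℂ) :
    v.1 * divFst p n (fun _ => v) =
      p (n + 1) (fun _ => v) - p (n + 1) (fun _ => projSnd v) := by
  set c : ℕ → Fin (n + 1) → ℂ × ℂ := fun i j => if (j : ℕ) < i then projSnd v else v with hc
  have h0 : c 0 = fun _ => v := by funext j; simp [hc]
  have h1 : c (n + 1) = fun _ => projSnd v := by funext j; simp only [hc, if_pos j.is_lt]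
  rw [← h0, ← h1, ← Finset.sum_range_sub' (fun i => p (n + 1) (c i)), ← Fin.sum_univ_eq_sum_range
    (fun i => p (n + 1) (c i) - p (n + 1) (c (i + 1)))]
  simp only [divFst, sum_apply, Finset.mul_sum,
    ContinuousMultilinearMap.compContinuousLinearMap_apply,
    ContinuousMultilinearMap.curryMid_apply]
  refine Finset.sum_congr rfl fun i _ => ?_
  have e1 : c i = Function.update (c i) i v := by
    funext j
    by_cases hj : j = i
    · subst hj; simp [hc]
    · simp [Function.update_of_ne hj]
  have e2 : c (i + 1) = Function.update (c i) i (projSnd v) := by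
    funext j
    by_cases hj : j = i
    · subst hj; simp [hc]
    · have : (j : ℕ) ≠ i := fun h => hj (Fin.ext h)
      simp only [Function.update_of_ne hj, hc]
      congr 1
      simp only [eq_iff_iff]
      omega
  have e3 : v - projSnd v = v.1 • ((1 : ℂ), (0 : ℂ)) := by
    ext <;> simp [projSnd_apply]
  conv_rhs => rw [e2]
  conv_rhs => enter [1]; rw [e1]
  rw [← ContinuousMultilinearMap.map_update_sub, e3, ContinuousMultilinearMap.map_update_smul,
    smul_eq_mul]
  congr 2
  symm
  rw [Fin.eq_insertNth_iff]
  refine ⟨by simp, ?_⟩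
  funext j
  simp only [Fin.removeNth, Function.update_of_ne (Fin.succAbove_ne i j), hc]
  rcases lt_or_ge j.castSucc i with h | h
  · have h' : (j : ℕ) < i := h
    rw [Fin.succAbove_of_castSucc_lt _ _ h]
    simp [h, h']
  · have h' : ¬ ((j : ℕ) + 1 < i) := by
      have : (i : ℕ) ≤ j := h
      omega
    rw [Fin.succAbove_of_le_castSucc _ _ h]
    simp [not_lt.2 h, h']

lemma norm_divFst_le (p : FormalMultilinearSeries ℂ (ℂ × ℂ) ℂ) (n : ℕ) :
    ‖divFst p n‖ ≤ (n + 1) * ‖p (n + 1)‖ := by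
  rw [divFst]
  refine (norm_sum_le _ _).trans ?_
  have : ∀ i ∈ (Finset.univ : Finset (Fin (n + 1))),
      ‖((p (n + 1)).curryMid i ((1 : ℂ), (0 : ℂ))).compContinuousLinearMap
        (fun j : Fin n => if j.castSucc < i then projSnd
          else ContinuousLinearMap.id ℂ (ℂ × ℂ))‖ ≤ ‖p (n + 1)‖ := by
    intro i _
    refine (ContinuousMultilinearMap.norm_compContinuousLinearMap_le _ _).trans ?_
    have h1 : ‖(p (n + 1)).curryMid i ((1 : ℂ), (0 : ℂ))‖ ≤ ‖p (n + 1)‖ := by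
      refine (ContinuousLinearMap.le_opNorm _ _).trans ?_
      rw [ContinuousMultilinearMap.norm_curryMid, Prod.norm_def]
      simp
    have h2 : ∏ j : Fin n, ‖(if j.castSucc < i then projSnd
          else ContinuousLinearMap.id ℂ (ℂ × ℂ))‖ ≤ 1 := by
      refine Finset.prod_le_one (fun _ _ => norm_nonneg _) fun j _ => ?_
      split_ifs
      · exact norm_projSnd_le
      · exact ContinuousLinearMap.norm_id_le
    calc _ ≤ ‖p (n + 1)‖ * 1 := mul_le_mul h1 h2
            (Finset.prod_nonneg fun _ _ => norm_nonneg _) (norm_nonneg _)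
      _ = _ := mul_one _
  refine (Finset.sum_le_sum this).trans ?_
  simp

lemma radius_divFst_pos {p : FormalMultilinearSeries ℂ (ℂ × ℂ) ℂ} (hp : 0 < p.radius) :
    0 < (divFst p).radius := by
  obtain ⟨a, ha0, ha⟩ := ENNReal.lt_iff_exists_nnreal_btwn.1 hp
  have ha0' : 0 < a := by exact_mod_cast ha0
  obtain ⟨C, hC, h⟩ := p.norm_mul_pow_le_of_lt_radius ha
  have hb : ∀ n, ‖divFst p n‖ * ((a / 2 : NNReal) : ℝ) ^ n ≤ 2 * C / a := by
    intro n
    have h1 := h (n + 1)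
    have h2 : ((n : ℝ) + 1) ≤ 2 ^ (n + 1) := by
      exact_mod_cast (Nat.lt_two_pow_self (n := n + 1)).le
    have ha' : (0 : ℝ) < a := ha0'
    push_cast
    rw [div_pow, le_div_iff₀ ha']
    calc ‖divFst p n‖ * (a ^ n / 2 ^ n) * a
        ≤ ((n + 1) * ‖p (n + 1)‖) * (a ^ n / 2 ^ n) * a := by
          gcongr
          exact norm_divFst_le p n
      _ = (‖p (n + 1)‖ * a ^ (n + 1)) * ((n + 1) / 2 ^ n) := by ring
      _ ≤ C * 2 := by
          refine mul_le_mul h1 ?_ (by positivity) hC.le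
          rw [div_le_iff₀ (by positivity)]
          linarith [pow_succ (2 : ℝ) n]
      _ = 2 * C := by ring
  have := FormalMultilinearSeries.le_radius_of_bound _ _ hb
  refine lt_of_lt_of_le ?_ this
  have : 0 < a / 2 := by positivity
  exact_mod_cast this

/-- A holomorphic function that vanishes on the line `{v.1 = 0}` is divisible by `v.1`. -/
lemma exists_eq_fst_mul {g : ℂ × ℂ → ℂ} {v₀ : ℂ × ℂ} (hv₀ : v₀.1 = 0) (hg : AnalyticAt ℂ g v₀)
    (h0 : ∀ᶠ v in 𝓝 v₀, v.1 = 0 → g v = 0) :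
    ∃ k : ℂ × ℂ → ℂ, AnalyticAt ℂ k v₀ ∧ ∀ᶠ v in 𝓝 v₀, g v = v.1 * k v := by
  obtain ⟨p, hp⟩ := hg
  have hrad := radius_divFst_pos hp.radius_pos
  have hk := (divFst p).hasFPowerSeriesOnBall hrad
  refine ⟨fun v => (divFst p).sum (v - v₀), ?_, ?_⟩
  · have := hk.comp_sub v₀
    rw [zero_add] at this
    exact this.analyticAt
  have hP : Filter.Tendsto (fun v : ℂ × ℂ => v₀ + projSnd (v - v₀)) (𝓝 v₀) (𝓝 v₀) := by
    have : Continuous (fun v : ℂ × ℂ => v₀ + projSnd (v - v₀)) := by fun_prop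
    simpa using this.tendsto v₀
  have hsub : Filter.Tendsto (fun v : ℂ × ℂ => v - v₀) (𝓝 v₀) (𝓝 0) := by
    have : Continuous (fun v : ℂ × ℂ => v - v₀) := by fun_prop
    simpa using this.tendsto v₀
  have hPs : Filter.Tendsto (fun v : ℂ × ℂ => projSnd (v - v₀)) (𝓝 v₀) (𝓝 0) := by
    have : Continuous (fun v : ℂ × ℂ => projSnd (v - v₀)) := by fun_prop
    simpa using this.tendsto v₀
  have hp' := hp.eventually_hasSum
  filter_upwards [hsub.eventually hp', hPs.eventually hp', hP.eventually h0,
    hsub.eventually (Metric.eball_mem_nhds (0 : ℂ × ℂ) hrad)] with v e1 e2 e3 e4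
  have e3' := e3 (by simp [projSnd_apply, hv₀])
  have e5 := hk.hasSum e4
  rw [zero_add] at e5
  rw [e3'] at e2
  have e6 := e1.sub e2
  rw [← hasSum_nat_add_iff' 1] at e6
  have e7 := e5.mul_left (v - v₀).1
  simp only [divFst_apply] at e7
  have e8 : (p 0) (fun _ => v - v₀) = (p 0) (fun _ => projSnd (v - v₀)) :=
    congrArg (p 0) (Subsingleton.elim _ _)
  simp only [Finset.range_one, Finset.sum_singleton, e8, sub_self, sub_zero] at e6
  have := e7.unique e6
  rw [Prod.fst_sub, hv₀, sub_zero, add_sub_cancel] at this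
  exact this.symm

/-! ### Holomorphic charts -/

lemma det_eq (L : (ℂ × ℂ) →L[ℂ] (ℂ × ℂ)) :
    L.det = (L (1, 0)).1 * (L (0, 1)).2 - (L (0, 1)).1 * (L (1, 0)).2 := by
  rw [ContinuousLinearMap.det, ← LinearMap.det_toMatrix (Module.Basis.finTwoProd ℂ),
    Matrix.det_fin_two]
  simp [LinearMap.toMatrix_apply]

lemma analyticAt_det_fderiv {G : ℂ × ℂ → ℂ × ℂ} {v₀ : ℂ × ℂ} (hG : AnalyticAt ℂ G v₀) :
    AnalyticAt ℂ (fun v => (fderiv ℂ G v).det) v₀ := by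
  have h : ∀ w : ℂ × ℂ, AnalyticAt ℂ (fun v => fderiv ℂ G v w) v₀ := fun w =>
    ((ContinuousLinearMap.apply ℂ (ℂ × ℂ) w).analyticAt _).comp hG.fderiv
  have h1 : ∀ w : ℂ × ℂ, AnalyticAt ℂ (fun v => (fderiv ℂ G v w).1) v₀ := fun w =>
    analyticAt_fst.comp (h w)
  have h2 : ∀ w : ℂ × ℂ, AnalyticAt ℂ (fun v => (fderiv ℂ G v w).2) v₀ := fun w =>
    analyticAt_snd.comp (h w)
  simp only [det_eq]
  exact ((h1 _).mul (h2 _)).sub ((h1 _).mul (h2 _))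

lemma det_fderiv_prodMk {a b : ℂ × ℂ → ℂ} {v : ℂ × ℂ} (ha : DifferentiableAt ℂ a v)
    (hb : DifferentiableAt ℂ b v) :
    (fderiv ℂ (fun v => (a v, b v)) v).det =
      fderiv ℂ a v (1, 0) * fderiv ℂ b v (0, 1) - fderiv ℂ a v (0, 1) * fderiv ℂ b v (1, 0) := by
  rw [det_eq, ha.fderiv_prodMk hb]
  rfl

lemma det_fderiv_comp {G F : ℂ × ℂ → ℂ × ℂ} {v : ℂ × ℂ} (hG : DifferentiableAt ℂ G (F v))
    (hF : DifferentiableAt ℂ F v) :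
    (fderiv ℂ (G ∘ F) v).det = (fderiv ℂ G (F v)).det * (fderiv ℂ F v).det := by
  rw [fderiv_comp v hG hF]
  exact LinearMap.det_comp _ _

/-- The holomorphic inverse function theorem. -/
lemma exists_openPartialHomeomorph {G : ℂ × ℂ → ℂ × ℂ} {v₀ : ℂ × ℂ} (hG : AnalyticAt ℂ G v₀)
    (hdet : (fderiv ℂ G v₀).det ≠ 0) :
    ∃ e : OpenPartialHomeomorph (ℂ × ℂ) (ℂ × ℂ), v₀ ∈ e.source ∧ (∀ v, e v = G v) ∧
      AnalyticOnNhd ℂ e e.source ∧ AnalyticOnNhd ℂ e.symm e.target := by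
  set f' := (fderiv ℂ G v₀).toContinuousLinearEquivOfDetNeZero hdet with hf'
  have hd : HasFDerivAt G (f' : (ℂ × ℂ) →L[ℂ] (ℂ × ℂ)) v₀ := hG.differentiableAt.hasFDerivAt
  have hc : ContDiffAt ℂ ω G v₀ := hG.contDiffAt
  have hω : (ω : WithTop ℕ∞) ≠ 0 := by simp
  set e := hc.toOpenPartialHomeomorph G hd hω with he
  have hv : v₀ ∈ e.source := hc.mem_toOpenPartialHomeomorph_source hd hω
  have hs : AnalyticAt ℂ e.symm (G v₀) := (hc.to_localInverse hd hω).analyticAt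
  have hS : IsOpen {v | AnalyticAt ℂ G v} := isOpen_analyticAt ℂ G
  have hT : IsOpen {v | AnalyticAt ℂ e.symm v} := isOpen_analyticAt ℂ e.symm
  set W := {v | AnalyticAt ℂ G v} ∩ (e.source ∩ e ⁻¹' {v | AnalyticAt ℂ e.symm v}) with hW
  have hWo : IsOpen W := hS.inter (e.isOpen_inter_preimage hT)
  refine ⟨e.restrOpen W hWo, ⟨hv, hG, hv, hs⟩, fun _ => rfl, ?_, ?_⟩
  · rintro v ⟨_, hv, _⟩
    exact hv
  · rintro w hw
    have h1 := (e.restrOpen W hWo).map_target hw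
    obtain ⟨_, _, _, h2⟩ := h1
    have : (e.restrOpen W hWo) ((e.restrOpen W hWo).symm w) = w :=
      (e.restrOpen W hWo).right_inv hw
    have h3 : e (e.symm w) = w := this
    have h4 : AnalyticAt ℂ e.symm (e (e.symm w)) := h2
    rw [h3] at h4
    exact h4

section

variable {X : Type u} [TopologicalSpace X] [ChartedSpace (ℂ × ℂ) X]

lemma holomorphicAt_iff_analyticAt {h : ℂ × ℂ → ℂ} {v : ℂ × ℂ} :
    HolomorphicAt h v ↔ AnalyticAt ℂ h v := by
  rw [HolomorphicAt, contMDiffAt_iff_contDiffAt]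
  exact ⟨fun h => h.analyticAt, fun h => h.contDiffAt⟩

/-- `Φ` is a biholomorphic map from an open subset of the surface onto an open subset of `ℂ²`. -/
def IsHolChart (Φ : OpenPartialHomeomorph X (ℂ × ℂ)) : Prop :=
  ContMDiffOn 𝓘(ℂ, ℂ × ℂ) 𝓘(ℂ, ℂ × ℂ) ω Φ Φ.source ∧
    ContMDiffOn 𝓘(ℂ, ℂ × ℂ) 𝓘(ℂ, ℂ × ℂ) ω Φ.symm Φ.target

lemma isHolChart_chartAt [IsManifold 𝓘(ℂ, ℂ × ℂ) ω X] (q : X) :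
    IsHolChart (chartAt (ℂ × ℂ) q) :=
  ⟨contMDiffOn_chart, contMDiffOn_chart_symm⟩

namespace IsHolChart

variable {Φ Ψ : OpenPartialHomeomorph X (ℂ × ℂ)} {q : X}

lemma contMDiffAt (hΦ : IsHolChart Φ) (hq : q ∈ Φ.source) :
    ContMDiffAt 𝓘(ℂ, ℂ × ℂ) 𝓘(ℂ, ℂ × ℂ) ω Φ q :=
  hΦ.1.contMDiffAt (Φ.open_source.mem_nhds hq)

lemma contMDiffAt_symm (hΦ : IsHolChart Φ) {v : ℂ × ℂ} (hv : v ∈ Φ.target) :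
    ContMDiffAt 𝓘(ℂ, ℂ × ℂ) 𝓘(ℂ, ℂ × ℂ) ω Φ.symm v :=
  hΦ.2.contMDiffAt (Φ.open_target.mem_nhds hv)

lemma isLocalDiffeomorphAt (hΦ : IsHolChart Φ) (hq : q ∈ Φ.source) :
    IsLocalDiffeomorphAt 𝓘(ℂ, ℂ × ℂ) 𝓘(ℂ, ℂ × ℂ) ω Φ q :=
  ⟨⟨Φ.toPartialEquiv, Φ.open_source, Φ.open_target, hΦ.1, hΦ.2⟩, hq, fun _ _ => rfl⟩

lemma trans (hΦ : IsHolChart Φ) {e : OpenPartialHomeomorph (ℂ × ℂ) (ℂ × ℂ)}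
    (he : AnalyticOnNhd ℂ e e.source) (he' : AnalyticOnNhd ℂ e.symm e.target) :
    IsHolChart (Φ.trans e) := by
  constructor
  · intro x hx
    rw [OpenPartialHomeomorph.trans_source] at hx
    have h1 : ContMDiffAt 𝓘(ℂ, ℂ × ℂ) 𝓘(ℂ, ℂ × ℂ) ω e (Φ x) :=
      (he _ hx.2).contDiffAt.contMDiffAt
    exact (h1.comp x (hΦ.contMDiffAt hx.1)).contMDiffWithinAt
  · intro v hv
    rw [OpenPartialHomeomorph.trans_target] at hv
    have h1 : ContMDiffAt 𝓘(ℂ, ℂ × ℂ) 𝓘(ℂ, ℂ × ℂ) ω e.symm v :=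
      (he' _ hv.1).contDiffAt.contMDiffAt
    exact ((hΦ.contMDiffAt_symm hv.2).comp v h1).contMDiffWithinAt

lemma restrOpen (hΦ : IsHolChart Φ) {s : Set X} (hs : IsOpen s) :
    IsHolChart (Φ.restrOpen s hs) := by
  refine ⟨hΦ.1.mono Set.inter_subset_left, hΦ.2.mono ?_⟩
  intro v hv
  exact hv.1

lemma tendsto_symm (_ : IsHolChart Φ) (hq : q ∈ Φ.source) :
    Filter.Tendsto Φ.symm (𝓝 (Φ q)) (𝓝 q) := by
  simpa [Φ.left_inv hq] using (Φ.continuousAt_symm (Φ.map_source hq)).tendsto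

lemma tendsto (_ : IsHolChart Φ) (hq : q ∈ Φ.source) :
    Filter.Tendsto Φ (𝓝 q) (𝓝 (Φ q)) := (Φ.continuousAt hq).tendsto

lemma eventually_symm_iff (_ : IsHolChart Φ) (hq : q ∈ Φ.source) {P : X → Prop} :
    (∀ᶠ v in 𝓝 (Φ q), P (Φ.symm v)) ↔ ∀ᶠ x in 𝓝 q, P x := by
  rw [← Φ.symm_map_nhds_eq hq, Filter.eventually_map]

lemma holomorphicAt_iff (hΦ : IsHolChart Φ) (hq : q ∈ Φ.source) {h : X → ℂ} :
    HolomorphicAt h q ↔ AnalyticAt ℂ (h ∘ Φ.symm) (Φ q) := by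
  rw [← holomorphicAt_iff_analyticAt]
  constructor
  · intro hh
    refine ContMDiffAt.comp (Φ q) ?_ (hΦ.contMDiffAt_symm (Φ.map_source hq))
    rw [Φ.left_inv hq]
    exact hh
  · intro hh
    refine (ContMDiffAt.comp q hh (hΦ.contMDiffAt hq)).congr_of_eventuallyEq ?_
    filter_upwards [Φ.open_source.mem_nhds hq] with x hx
    simp [Φ.left_inv hx]

lemma holomorphicAt_comp (hΦ : IsHolChart Φ) (hq : q ∈ Φ.source) {k : ℂ × ℂ → ℂ}
    (hk : AnalyticAt ℂ k (Φ q)) : HolomorphicAt (k ∘ Φ) q :=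
  ContMDiffAt.comp q (holomorphicAt_iff_analyticAt.2 hk) (hΦ.contMDiffAt hq)

/-- The coordinate change between two holomorphic charts is holomorphic. -/
lemma analyticAt_comp_symm (hΦ : IsHolChart Φ) (hΨ : IsHolChart Ψ) (hq : q ∈ Φ.source)
    (hq' : q ∈ Ψ.source) : AnalyticAt ℂ (Ψ ∘ Φ.symm) (Φ q) := by
  refine ContDiffAt.analyticAt (contMDiffAt_iff_contDiffAt.1 ?_)
  refine ContMDiffAt.comp (Φ q) ?_ (hΦ.contMDiffAt_symm (Φ.map_source hq))
  rw [Φ.left_inv hq]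
  exact hΨ.contMDiffAt hq'

lemma det_fderiv_comp_symm_ne_zero (hΦ : IsHolChart Φ) (hΨ : IsHolChart Ψ) (hq : q ∈ Φ.source)
    (hq' : q ∈ Ψ.source) : (fderiv ℂ (Ψ ∘ Φ.symm) (Φ q)).det ≠ 0 := by
  have h1 := hΦ.analyticAt_comp_symm hΨ hq hq'
  have h2 := hΨ.analyticAt_comp_symm hΦ hq' hq
  have h3 : (Φ ∘ Ψ.symm) ∘ (Ψ ∘ Φ.symm) =ᶠ[𝓝 (Φ q)] id := by
    have : ∀ᶠ x in 𝓝 q, x ∈ Φ.source ∧ x ∈ Ψ.source :=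
      (Φ.open_source.inter Ψ.open_source).mem_nhds ⟨hq, hq'⟩
    filter_upwards [(hΦ.tendsto_symm hq).eventually this,
      Φ.open_target.mem_nhds (Φ.map_source hq)] with v hv hv'
    simp [Ψ.left_inv hv.2, Φ.right_inv hv']
  have e : (Ψ ∘ Φ.symm) (Φ q) = Ψ q := by simp [Φ.left_inv hq]
  have h4 := h3.fderiv_eq (𝕜 := ℂ)
  have h5 := det_fderiv_comp (G := Φ ∘ Ψ.symm) (F := Ψ ∘ Φ.symm) (v := Φ q)
    (by rw [e]; exact h2.differentiableAt) h1.differentiableAt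
  rw [h4, fderiv_id] at h5
  intro h0
  rw [h0, mul_zero, det_eq] at h5
  simp at h5

/-- A chart in which `D` is the line `{v.1 = 0}` provides a local equation of `D`. -/
lemma isLocalEquation_fst (hΦ : IsHolChart Φ) (hq : q ∈ Φ.source) {D : Set X}
    (h0 : (Φ q).1 = 0) (hD : ∀ᶠ x in 𝓝 q, x ∈ D ↔ (Φ x).1 = 0) :
    IsLocalEquation D q (fun x => (Φ x).1) := by
  refine ⟨hΦ.holomorphicAt_comp hq analyticAt_fst, hD.mono fun x hx => hx.1, ?_⟩
  intro g hg hgD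
  have h1 : ∀ᶠ v in 𝓝 (Φ q), v.1 = 0 → (g ∘ Φ.symm) v = 0 := by
    have := (hΦ.tendsto_symm hq).eventually (hgD.and hD)
    filter_upwards [this, Φ.open_target.mem_nhds (Φ.map_source hq)] with v hv hv' hv0
    exact hv.1 (hv.2.2 (by rw [Φ.right_inv hv', hv0]))
  obtain ⟨k, hk, hgk⟩ := exists_eq_fst_mul h0 ((hΦ.holomorphicAt_iff hq).1 hg) h1
  refine ⟨k ∘ Φ, hΦ.holomorphicAt_comp hq hk, ?_⟩
  filter_upwards [(hΦ.tendsto hq).eventually hgk, Φ.open_source.mem_nhds hq] with x hx hx'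
  simpa [Φ.left_inv hx'] using hx

end IsHolChart

/-- Two holomorphic functions with independent differentials are local coordinates. -/
lemma exists_isHolChart {Ψ : OpenPartialHomeomorph X (ℂ × ℂ)}
    (hΨ : IsHolChart Ψ) {q : X} (hq : q ∈ Ψ.source) {G : ℂ × ℂ → ℂ × ℂ}
    (hG : AnalyticAt ℂ G (Ψ q)) (hdet : (fderiv ℂ G (Ψ q)).det ≠ 0) :
    ∃ Φ : OpenPartialHomeomorph X (ℂ × ℂ), IsHolChart Φ ∧ q ∈ Φ.source ∧ Φ.source ⊆ Ψ.source ∧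
      ∀ x, Φ x = G (Ψ x) := by
  obtain ⟨e, he, heG, h1, h2⟩ := exists_openPartialHomeomorph hG hdet
  refine ⟨Ψ.trans e, hΨ.trans h1 h2, ?_, ?_, fun x => ?_⟩
  · rw [OpenPartialHomeomorph.trans_source]
    exact ⟨hq, he⟩
  · rw [OpenPartialHomeomorph.trans_source]
    exact Set.inter_subset_left
  · simp [heG]

lemma mfderiv_eq_fderiv_chartAt [IsManifold 𝓘(ℂ, ℂ × ℂ) ω X] {h : X → ℂ} {q : X}
    (hh : HolomorphicAt h q) :
    mfderiv 𝓘(ℂ, ℂ × ℂ) 𝓘(ℂ, ℂ) h q =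
      fderiv ℂ (h ∘ (chartAt (ℂ × ℂ) q).symm) (chartAt (ℂ × ℂ) q q) := by
  rw [(ContMDiffAt.mdifferentiableAt hh (by simp)).mfderiv]
  simp [writtenInExtChartAt, fderivWithin_univ]
  rfl

lemma exists_mul_sub_mul_ne_zero {L : (ℂ × ℂ) →L[ℂ] ℂ} (hL : L ≠ 0) :
    ∃ ℓ : (ℂ × ℂ) →L[ℂ] ℂ, L (1, 0) * ℓ (0, 1) - L (0, 1) * ℓ (1, 0) ≠ 0 := by
  by_cases h : L (1, 0) = 0
  · refine ⟨ContinuousLinearMap.fst ℂ ℂ ℂ, ?_⟩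
    intro h'
    simp only [h, zero_mul, ContinuousLinearMap.coe_fst', mul_one, zero_sub, neg_eq_zero] at h'
    apply hL
    ext <;> simp [h, h']
  · exact ⟨ContinuousLinearMap.snd ℂ ℂ ℂ, by simpa using h⟩

/-- A regular equation can be completed to a system of local coordinates. -/
lemma IsRegularEquation.exists_isHolChart [IsManifold 𝓘(ℂ, ℂ × ℂ) ω X] {C : Set X} {q : X}
    {h : X → ℂ} (hh : IsRegularEquation C q h) :
    ∃ Φ : OpenPartialHomeomorph X (ℂ × ℂ), IsHolChart Φ ∧ q ∈ Φ.source ∧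
      (∀ x ∈ Φ.source, (Φ x).1 = h x) ∧ ∀ x ∈ Φ.source, x ∈ C ↔ h x = 0 := by
  obtain ⟨h1, h2, h3, h4⟩ := hh
  have hc := isHolChart_chartAt q
  have hq := mem_chart_source (ℂ × ℂ) q
  have ha := (hc.holomorphicAt_iff hq).1 h1
  rw [mfderiv_eq_fderiv_chartAt h1] at h3
  obtain ⟨ℓ, hℓ⟩ := exists_mul_sub_mul_ne_zero h3
  obtain ⟨Φ, hΦ, hqΦ, hs, hΦG⟩ := SurfacePair.exists_isHolChart hc hq
    (G := fun v => ((h ∘ (chartAt (ℂ × ℂ) q).symm) v, ℓ v)) (ha.prod (ℓ.analyticAt _))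
    (by
      rw [det_fderiv_prodMk ha.differentiableAt ℓ.differentiableAt, ContinuousLinearMap.fderiv]
      exact hℓ)
  obtain ⟨W, hW, hWo, hqW⟩ := mem_nhds_iff.1 h4
  refine ⟨Φ.restrOpen W hWo, hΦ.restrOpen hWo, ⟨hqΦ, hqW⟩, ?_, ?_⟩
  · rintro x ⟨hx, _⟩
    change (Φ x).1 = h x
    rw [hΦG]
    simp [(chartAt (ℂ × ℂ) q).left_inv (hs hx)]
  · rintro x ⟨_, hx⟩
    exact hW hx

lemma IsRegularEquation.isLocalEquation [IsManifold 𝓘(ℂ, ℂ × ℂ) ω X] {C : Set X} {q : X}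
    {h : X → ℂ} (hh : IsRegularEquation C q h) : IsLocalEquation C q h := by
  obtain ⟨Φ, hΦ, hq, h1, h2⟩ := hh.exists_isHolChart
  have hs := Φ.open_source.mem_nhds hq
  have h3 := hΦ.isLocalEquation_fst hq (D := C) (by rw [h1 q hq, hh.2.1]) (by
    filter_upwards [hs] with x hx
    rw [h1 x hx]
    exact h2 x hx)
  have e : ∀ᶠ x in 𝓝 q, (Φ x).1 = h x := by filter_upwards [hs] with x hx using h1 x hx
  refine ⟨hh.1, hh.2.2.2.mono fun x hx => hx.1, fun g hg hgC => ?_⟩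
  obtain ⟨k, hk, hgk⟩ := h3.2.2 g hg hgC
  refine ⟨k, hk, ?_⟩
  filter_upwards [hgk, e] with x hx hx'
  rw [hx, hx']

end

/-! ### Normal form of curve germs with equal contact orders -/

section

variable {X : Type u} [TopologicalSpace X] [ChartedSpace (ℂ × ℂ) X]

/-- Normal form of curve germs with pairwise contact order `t`: in the holomorphic chart `Φ` onto a
bidisc the curves `D k` are the graphs `y = x ^ t * u k x`, and the functions `u k` have
pairwise distinct values at every point. -/
structure IsNormalForm {ι : Type*} (D : ι → Set X) (t : ℕ) (Φ : OpenPartialHomeomorph X (ℂ × ℂ))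
    (ε δ : ℝ) (u : ι → ℂ → ℂ) : Prop where
  isHolChart : IsHolChart Φ
  eps_pos : 0 < ε
  delta_pos : 0 < δ
  target_eq : Φ.target = Metric.ball (0 : ℂ) ε ×ˢ Metric.ball (0 : ℂ) δ
  analyticOnNhd : ∀ k, AnalyticOnNhd ℂ (u k) (Metric.ball 0 ε)
  mem_ball : ∀ k, ∀ s ∈ Metric.ball (0 : ℂ) ε, s ^ t * u k s ∈ Metric.ball (0 : ℂ) δ
  ne : ∀ i j, i ≠ j → ∀ s ∈ Metric.ball (0 : ℂ) ε, u i s ≠ u j s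
  mem_iff : ∀ k, ∀ q ∈ Φ.source, q ∈ D k ↔ (Φ q).2 = (Φ q).1 ^ t * u k (Φ q).1

/-- A linear form on `ℂ²` that is independent of each of finitely many given nonzero ones. -/
lemma exists_transversal {ι : Type*} [Finite ι] {L : ι → (ℂ × ℂ) →L[ℂ] ℂ} (hL : ∀ k, L k ≠ 0) :
    ∃ ℓ : (ℂ × ℂ) →L[ℂ] ℂ, ∀ k, ℓ (1, 0) * L k (0, 1) - ℓ (0, 1) * L k (1, 0) ≠ 0 := by
  obtain ⟨c, hc⟩ := (Set.finite_range fun k => L k (0, 1) / L k (1, 0)).exists_notMem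
  refine ⟨ContinuousLinearMap.fst ℂ ℂ ℂ + c • ContinuousLinearMap.snd ℂ ℂ ℂ, fun k hk => ?_⟩
  have h1 : L k (0, 1) = c * L k (1, 0) := by simpa [sub_eq_zero] using hk
  by_cases h0 : L k (1, 0) = 0
  · rw [h0, mul_zero] at h1
    apply hL k
    ext <;> simp [h0, h1]
  · exact hc ⟨k, by simp [h1, h0]⟩

/-- The restriction of a holomorphic function germ to a parametrised curve. -/
lemma HolomorphicAt.analyticAt_comp {h : X → ℂ} {γ : ℂ → X} {s : ℂ} (hh : HolomorphicAt h (γ s))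
    (hγ : ContMDiffAt 𝓘(ℂ, ℂ) 𝓘(ℂ, ℂ × ℂ) ω γ s) : AnalyticAt ℂ (fun s => h (γ s)) s :=
  ContDiffAt.analyticAt (contMDiffAt_iff_contDiffAt.1 (ContMDiffAt.comp s hh hγ))

/-- Along a curve, a local equation has the smallest vanishing order among the functions that
vanish on the hypersurface. -/
lemma IsLocalEquation.analyticOrderAt_le {D : Set X} {q : X} {h g : X → ℂ} {γ : ℂ → X} {s : ℂ}
    (hh : IsLocalEquation D q h) (hg : HolomorphicAt g q) (hgD : ∀ᶠ x in 𝓝 q, x ∈ D → g x = 0)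
    (hγ : ContMDiffAt 𝓘(ℂ, ℂ) 𝓘(ℂ, ℂ × ℂ) ω γ s) (hq : γ s = q) :
    analyticOrderAt (fun s => h (γ s)) s ≤ analyticOrderAt (fun s => g (γ s)) s := by
  obtain ⟨k, hk, hgk⟩ := hh.2.2 g hg hgD
  subst hq
  have e : (fun s => g (γ s)) =ᶠ[𝓝 s] (fun s => h (γ s)) * fun s => k (γ s) := by
    filter_upwards [hγ.continuousAt.eventually hgk] with x hx using hx
  rw [analyticOrderAt_congr e,
    analyticOrderAt_mul (hh.1.analyticAt_comp hγ) (hk.analyticAt_comp hγ)]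
  exact le_self_add

/-- In a chart in which `C` is the graph of `g`, the first coordinate of a regular parametrisation
of `C` is a local coordinate on the parameter line. -/
lemma IsRegularParam.deriv_ne_zero {Φ : OpenPartialHomeomorph X (ℂ × ℂ)} (hΦ : IsHolChart Φ)
    {p : X} (hp : p ∈ Φ.source) {C : Set X} {γ : ℂ → X} (hγ : IsRegularParam C p γ) {g : ℂ → ℂ}
    (hg : AnalyticAt ℂ g (Φ p).1)
    (hC : ∀ᶠ x in 𝓝 p, x ∈ C → (Φ x).2 = g (Φ x).1) :
    deriv (fun s => (Φ (γ s)).1) 0 ≠ 0 := by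
  obtain ⟨h1, h2, h3, h4⟩ := hγ
  subst h2
  have hx : AnalyticAt ℂ (fun s => (Φ (γ s)).1) 0 :=
    (hΦ.holomorphicAt_comp hp analyticAt_fst).analyticAt_comp h1
  set σ := fun s => (Φ (γ s)).1 with hσ
  intro h0
  apply h3
  have hd : HasDerivAt σ 0 0 := by
    have := hx.differentiableAt.hasDerivAt
    rwa [h0] at this
  have hd2 : HasDerivAt (fun s => g (σ s)) (deriv g (σ 0) * 0) 0 :=
    (show AnalyticAt ℂ g (σ 0) from hg).differentiableAt.hasDerivAt.comp 0 hd
  have hd3 : HasFDerivAt (fun s => (σ s, g (σ s))) (0 : ℂ →L[ℂ] ℂ × ℂ) 0 := by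
    have := (hd.prodMk hd2).hasFDerivAt
    refine this.congr_fderiv ?_
    ext <;> simp
  have e1 : ∀ᶠ s in 𝓝 (0 : ℂ), γ s ∈ Φ.source ∧ (Φ (γ s)).2 = g (σ s) := by
    filter_upwards [h4, h1.continuousAt.eventually hC,
      h1.continuousAt.eventually (Φ.open_source.mem_nhds hp)] with s a b c using ⟨c, b a⟩
  have e2 : γ =ᶠ[𝓝 0] Φ.symm ∘ fun s => (σ s, g (σ s)) := by
    filter_upwards [e1] with s hs
    rw [Function.comp, ← hs.2, hσ, Prod.mk.eta, Φ.left_inv hs.1]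
  have e3 : (σ 0, g (σ 0)) = Φ (γ 0) := by rw [← e1.self_of_nhds.2]
  have hm : MDifferentiableAt 𝓘(ℂ, ℂ × ℂ) 𝓘(ℂ, ℂ × ℂ) Φ.symm (σ 0, g (σ 0)) := by
    rw [e3]
    exact (hΦ.contMDiffAt_symm (Φ.map_source hp)).mdifferentiableAt (by simp)
  have hm2 : MDifferentiableAt 𝓘(ℂ, ℂ) 𝓘(ℂ, ℂ × ℂ) (fun s => (σ s, g (σ s))) 0 :=
    hd3.differentiableAt.mdifferentiableAt
  rw [e2.mfderiv_eq, mfderiv_comp (0 : ℂ) hm hm2, mfderiv_eq_fderiv, hd3.fderiv]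
  exact ContinuousLinearMap.comp_zero _

lemma hasFDerivAt_snd_sub_comp_fst {g : ℂ → ℂ} {v : ℂ × ℂ} (hg : AnalyticAt ℂ g v.1) :
    HasFDerivAt (fun v : ℂ × ℂ => v.2 - g v.1) (ContinuousLinearMap.snd ℂ ℂ ℂ -
      (ContinuousLinearMap.toSpanSingleton ℂ (deriv g v.1)).comp
        (ContinuousLinearMap.fst ℂ ℂ ℂ)) v :=
  hasFDerivAt_snd.sub (hg.differentiableAt.hasDerivAt.hasFDerivAt.comp v hasFDerivAt_fst)

/-- Shearing a chart: if `C` is the graph of `g`, then `y - g x` is a local equation of `C`. -/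
lemma IsHolChart.isLocalEquation_graph_of_mem {Φ : OpenPartialHomeomorph X (ℂ × ℂ)}
    (hΦ : IsHolChart Φ) {q : X} (hq : q ∈ Φ.source) {C : Set X} {g : ℂ → ℂ}
    (hg : AnalyticAt ℂ g (Φ q).1)
    (hC : ∀ᶠ x in 𝓝 q, x ∈ C ↔ (Φ x).2 = g (Φ x).1) (hqC : (Φ q).2 = g (Φ q).1) :
    IsLocalEquation C q (fun x => (Φ x).2 - g (Φ x).1) := by
  have hg' : AnalyticAt ℂ (fun v : ℂ × ℂ => g v.1) (Φ q) := hg.comp analyticAt_fst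
  have ha : AnalyticAt ℂ (fun v : ℂ × ℂ => v.2 - g v.1) (Φ q) := analyticAt_snd.sub hg'
  have hf := hasFDerivAt_snd_sub_comp_fst hg
  obtain ⟨Φ', hΦ', hq', hs, he⟩ := exists_isHolChart hΦ hq
    (G := fun v => (v.2 - g v.1, v.1)) (ha.prod analyticAt_fst) (by
      rw [det_fderiv_prodMk ha.differentiableAt differentiableAt_fst, hf.fderiv, fderiv_fst]
      simp)
  have := hΦ'.isLocalEquation_fst hq' (D := C) (by rw [he]; exact sub_eq_zero.2 hqC)
    (by filter_upwards [hC] with x hx; rw [hx, he]; exact sub_eq_zero.symm)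
  simpa only [he] using this

/-- The contact order of two graphs is the vanishing order of the difference. -/
lemma HasContactOrder.analyticOrderAt_sub [IsManifold 𝓘(ℂ, ℂ × ℂ) ω X]
    {Φ : OpenPartialHomeomorph X (ℂ × ℂ)} (hΦ : IsHolChart Φ) {p : X} (hp : p ∈ Φ.source)
    (hp0 : (Φ p).1 = 0) {C C' : Set X} {g g' : ℂ → ℂ} (hg : AnalyticAt ℂ g 0)
    (hg' : AnalyticAt ℂ g' 0) (hC : ∀ᶠ x in 𝓝 p, x ∈ C ↔ (Φ x).2 = g (Φ x).1)
    (hC' : ∀ᶠ x in 𝓝 p, x ∈ C' ↔ (Φ x).2 = g' (Φ x).1) {t : ℕ} (h : HasContactOrder C C' p t) :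
    analyticOrderAt (fun s => g' s - g s) 0 = t := by
  obtain ⟨h, γ, hh, hγ, ht⟩ := h
  have hpC : p ∈ C := hh.2.2.2.self_of_nhds.2 hh.2.1
  have hl := hh.isLocalEquation
  have hl' := hΦ.isLocalEquation_graph_of_mem hp (by rwa [hp0]) hC (hC.self_of_nhds.1 hpC)
  have hd := hγ.deriv_ne_zero hΦ hp (by rwa [hp0]) (hC'.mono fun x hx => hx.1)
  have hle := le_antisymm (hl.analyticOrderAt_le hl'.1 hl'.2.1 hγ.1 hγ.2.1)
    (hl'.analyticOrderAt_le hl.1 hl.2.1 hγ.1 hγ.2.1)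
  rw [ht] at hle
  have hx : AnalyticAt ℂ (fun s => (Φ (γ s)).1) 0 := by
    have : γ 0 ∈ Φ.source := by rwa [hγ.2.1]
    exact (hΦ.holomorphicAt_comp this analyticAt_fst).analyticAt_comp hγ.1
  have e0 : (Φ (γ 0)).1 = 0 := by rw [hγ.2.1, hp0]
  have e : (fun s => (Φ (γ s)).2 - g (Φ (γ s)).1) =ᶠ[𝓝 0]
      (fun s => g' s - g s) ∘ fun s => (Φ (γ s)).1 := by
    have hc := hγ.1.continuousAt
    rw [ContinuousAt, hγ.2.1] at hc
    filter_upwards [hγ.2.2.2, hc.eventually hC'] with s h1 h2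
    simp [h2.1 h1]
  rw [analyticOrderAt_congr e, analyticOrderAt_comp_of_deriv_ne_zero hx hd] at hle
  rw [hle, e0]

/-- Smooth curve germs are simultaneously graphs in suitable coordinates, in which moreover one
prescribed germ is a coordinate axis. -/
lemma exists_graph_coordinates [IsManifold 𝓘(ℂ, ℂ × ℂ) ω X] {ι : Type*} [Finite ι] (i₀ : ι)
    {D : ι → Set X} {p : X} (hD : ∀ k, IsSmoothCurveAt (D k) p) :
    ∃ (Φ : OpenPartialHomeomorph X (ℂ × ℂ)) (g : ι → ℂ → ℂ), IsHolChart Φ ∧ p ∈ Φ.source ∧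
      Φ p = 0 ∧ (∀ k, AnalyticAt ℂ (g k) 0) ∧ (∀ᶠ s in 𝓝 0, g i₀ s = 0) ∧
      ∀ k, ∀ᶠ x in 𝓝 p, x ∈ D k ↔ (Φ x).2 = g k (Φ x).1 := by
  choose h hh using hD
  set ψ := chartAt (ℂ × ℂ) p with hψdef
  have hψ : IsHolChart ψ := isHolChart_chartAt p
  have hpψ : p ∈ ψ.source := mem_chart_source (ℂ × ℂ) p
  have hH : ∀ k, AnalyticAt ℂ (h k ∘ ψ.symm) (ψ p) := fun k => (hψ.holomorphicAt_iff hpψ).1 (hh k).1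
  obtain ⟨ℓ, hℓ⟩ := exists_transversal (L := fun k => fderiv ℂ (h k ∘ ψ.symm) (ψ p)) fun k => by
    rw [← mfderiv_eq_fderiv_chartAt (hh k).1]
    exact (hh k).2.2.1
  -- the chart with coordinates `(ℓ, h k)`
  have hex : ∀ k, ∃ Φ : OpenPartialHomeomorph X (ℂ × ℂ), IsHolChart Φ ∧ p ∈ Φ.source ∧
      Φ.source ⊆ ψ.source ∧ ∀ x, Φ x = (ℓ (ψ x) - ℓ (ψ p), (h k ∘ ψ.symm) (ψ x)) := fun k =>
    exists_isHolChart hψ hpψ (G := fun v => (ℓ v - ℓ (ψ p), (h k ∘ ψ.symm) v))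
      (((ℓ.analyticAt _).sub analyticAt_const).prod (hH k)) (by
        rw [det_fderiv_prodMk (ℓ.differentiableAt.sub_const _) (hH k).differentiableAt,
          fderiv_sub_const, ContinuousLinearMap.fderiv]
        exact hℓ k)
  choose Φ hΦ hp hs hΦG using hex
  have hΦx : ∀ k, ∀ x ∈ ψ.source, Φ k x = (ℓ (ψ x) - ℓ (ψ p), h k x) := fun k x hx => by
    rw [hΦG, Function.comp, ψ.left_inv hx]
  have hΦp : ∀ k, Φ k p = 0 := fun k => by rw [hΦx k p hpψ, (hh k).2.1, sub_self]; rfl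
  have hι : Continuous fun s : ℂ => (s, (0 : ℂ)) := by fun_prop
  refine ⟨Φ i₀, fun k s => (Φ i₀ ((Φ k).symm (s, 0))).2, hΦ i₀, hp i₀, hΦp i₀, ?_, ?_, ?_⟩
  · intro k
    have h1 := (hΦ k).analyticAt_comp_symm (hΦ i₀) (hp k) (hp i₀)
    rw [hΦp k] at h1
    exact (analyticAt_snd.comp h1).comp_of_eq (g := fun v => (Φ i₀ ((Φ k).symm v)).2)
      (f := fun s : ℂ => (s, (0 : ℂ))) (analyticAt_id.prod analyticAt_const) rfl
  · have : ∀ᶠ v in 𝓝 (Φ i₀ p), v ∈ (Φ i₀).target :=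
      (Φ i₀).open_target.mem_nhds ((Φ i₀).map_source (hp i₀))
    rw [hΦp] at this
    filter_upwards [(hι.tendsto 0).eventually this] with s h2
    rw [(Φ i₀).right_inv h2]
  · intro k
    -- the point of `D k` over the first coordinate of `x`
    have ht : Filter.Tendsto (fun x => (Φ k).symm (((Φ i₀) x).1, 0)) (𝓝 p) (𝓝 p) := by
      have h1 := (hΦ k).tendsto_symm (hp k)
      rw [hΦp] at h1
      have h2 : Filter.Tendsto (fun x => ((Φ i₀ x).1, (0 : ℂ))) (𝓝 p) (𝓝 0) := by
        have h3 := (hΦ i₀).tendsto (hp i₀)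
        rw [hΦp] at h3
        exact (hι.tendsto 0).comp ((continuous_fst.tendsto (0 : ℂ × ℂ)).comp h3)
      exact h1.comp h2
    have ht' : ∀ᶠ x in 𝓝 p, ((Φ i₀ x).1, (0 : ℂ)) ∈ (Φ k).target := by
      have h3 := (hΦ i₀).tendsto (hp i₀)
      rw [hΦp] at h3
      have h4 : ∀ᶠ v in 𝓝 (Φ k p), v ∈ (Φ k).target :=
        (Φ k).open_target.mem_nhds ((Φ k).map_source (hp k))
      rw [hΦp] at h4
      exact (((hι.tendsto 0).comp ((continuous_fst.tendsto (0 : ℂ × ℂ)).comp h3))).eventually h4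
    have hsrc : ∀ᶠ x in 𝓝 p, x ∈ (Φ i₀).source ∧ x ∈ (Φ k).source :=
      ((Φ i₀).open_source.inter (Φ k).open_source).mem_nhds ⟨hp i₀, hp k⟩
    filter_upwards [hsrc, ht', ht.eventually hsrc, (hh k).2.2.2] with x h1 h2 h3 h4
    have hxψ := hs k h1.2
    rw [h4]
    set x' := (Φ k).symm ((Φ i₀ x).1, 0) with hx'
    have e1 : Φ k x' = ((Φ i₀ x).1, 0) := (Φ k).right_inv h2
    have e2 := hΦx k x' (hs k h3.2)
    rw [e1, Prod.mk.injEq] at e2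
    have e3 := hΦx i₀ x' (hs k h3.2)
    have e4 := hΦx i₀ x hxψ
    have e5 := hΦx k x hxψ
    constructor
    · intro h0
      have : x = x' := (Φ k).injOn h1.2 h3.2 (by rw [e5, e1, e4, h0])
      rw [← this]
    · intro h0
      have h6 : Φ i₀ x' = Φ i₀ x := by
        refine Prod.ext ?_ h0.symm
        rw [e3, ← e2.1]
      have h7 : x' = x := (Φ i₀).injOn h3.1 h1.1 h6
      rw [← h7, ← e2.2]

/-- Curve germs with pairwise contact order `t` can be brought into normal form in an arbitrarily
small neighbourhood. -/
theorem exists_isNormalForm [IsManifold 𝓘(ℂ, ℂ × ℂ) ω X] {ι : Type*} [Finite ι] [Nonempty ι]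
    {D : ι → Set X} {p : X} (hD : ∀ k, IsSmoothCurveAt (D k) p) {t : ℕ} (ht : 1 ≤ t)
    (hcontact : ∀ i j, i ≠ j → HasContactOrder (D i) (D j) p t) {V : Set X} (hV : V ∈ 𝓝 p) :
    ∃ (Φ : OpenPartialHomeomorph X (ℂ × ℂ)) (ε δ : ℝ) (u : ι → ℂ → ℂ), p ∈ Φ.source ∧
      Φ.source ⊆ V ∧ Φ p = 0 ∧ IsNormalForm D t Φ ε δ u := by
  obtain ⟨i₀⟩ := ‹Nonempty ι›
  obtain ⟨Φ, g, hΦ, hp, hp0, hg, hg0, hDg⟩ := exists_graph_coordinates i₀ hD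
  have hord : ∀ i j, i ≠ j → analyticOrderAt (fun s => g j s - g i s) 0 = t := fun i j hij =>
    (hcontact i j hij).analyticOrderAt_sub hΦ hp (by rw [hp0]; rfl) (hg i) (hg j) (hDg i) (hDg j)
  have hu : ∀ k, ∃ u : ℂ → ℂ, AnalyticAt ℂ u 0 ∧ ∀ᶠ s in 𝓝 0, g k s = s ^ t * u s := by
    intro k
    by_cases hk : k = i₀
    · refine ⟨0, analyticAt_const, ?_⟩
      filter_upwards [hg0] with s hs
      simp [hk, hs]
    · obtain ⟨u, hu, -, h⟩ := (((hg k).sub (hg i₀)).analyticOrderAt_eq_natCast).1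
        (hord i₀ k (Ne.symm hk))
      refine ⟨u, hu, ?_⟩
      filter_upwards [h, hg0] with s h1 h2
      simpa [h2] using h1
  choose u hu hgu using hu
  have hne : ∀ i j, i ≠ j → u i 0 ≠ u j 0 := by
    intro i j hij
    have e : (fun s => g j s - g i s) =ᶠ[𝓝 0] (id ^ t) * fun s => u j s - u i s := by
      filter_upwards [hgu i, hgu j] with s h1 h2
      simp [h1, h2, mul_sub]
    have h1 := hord i j hij
    have h3 : AnalyticAt ℂ (fun s => u j s - u i s) 0 := (hu j).sub (hu i)
    rw [analyticOrderAt_congr e, analyticOrderAt_mul (analyticAt_id.pow t) h3,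
      analyticOrderAt_pow analyticAt_id, analyticOrderAt_id] at h1
    have h2 : analyticOrderAt (fun s => u j s - u i s) 0 = 0 := by
      have h4 : (t : ℕ∞) + analyticOrderAt (fun s => u j s - u i s) 0 = t + 0 := by
        simpa using h1
      exact (ENat.add_right_injective_of_ne_top (ENat.natCast_ne_top t)) h4
    rw [h3.analyticOrderAt_eq_zero] at h2
    exact fun h => h2 (by rw [h, sub_self])
  -- all conditions hold near the origin; choose the radii accordingly
  have hev : ∀ᶠ s in 𝓝 (0 : ℂ), (∀ k, AnalyticAt ℂ (u k) s ∧ g k s = s ^ t * u k s) ∧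
      ∀ i j, i ≠ j → u i s ≠ u j s := by
    refine Filter.Eventually.and (Filter.eventually_all.2 fun k =>
      (hu k).eventually_analyticAt.and (hgu k)) ?_
    refine Filter.eventually_all.2 fun i => Filter.eventually_all.2 fun j => ?_
    by_cases hij : i = j
    · simp [hij]
    · filter_upwards [(hu i).continuousAt.ne_iff_eventually_ne (hu j).continuousAt |>.1
        (hne i j hij)] with s hs _ using hs
  obtain ⟨ε₁, hε₁, h1⟩ := Metric.eventually_nhds_iff_ball.1 hev
  have hevX : ∀ᶠ x in 𝓝 p, x ∈ V ∧ ∀ k, x ∈ D k ↔ (Φ x).2 = g k (Φ x).1 :=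
    Filter.Eventually.and hV (Filter.eventually_all.2 hDg)
  have hev2 : ∀ᶠ v in 𝓝 (0 : ℂ × ℂ), v ∈ Φ.target ∧ Φ.symm v ∈ V ∧
      ∀ k, Φ.symm v ∈ D k ↔ (Φ (Φ.symm v)).2 = g k (Φ (Φ.symm v)).1 := by
    rw [← hp0]
    exact Filter.Eventually.and (Φ.open_target.mem_nhds (Φ.map_source hp))
      ((hΦ.tendsto_symm hp).eventually hevX)
  obtain ⟨δ, hδ, h2⟩ := Metric.eventually_nhds_iff_ball.1 hev2
  have hev3 : ∀ᶠ s in 𝓝 (0 : ℂ), ∀ k, s ^ t * u k s ∈ Metric.ball (0 : ℂ) δ := by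
    refine Filter.eventually_all.2 fun k => ?_
    have : ContinuousAt (fun s => s ^ t * u k s) 0 :=
      (continuousAt_id.pow t).mul (hu k).continuousAt
    refine this.eventually_mem (Metric.isOpen_ball.mem_nhds ?_)
    simp [zero_pow (by omega : t ≠ 0), hδ]
  obtain ⟨ε₂, hε₂, h3⟩ := Metric.eventually_nhds_iff_ball.1 hev3
  set ε := min ε₁ (min ε₂ δ) with hε
  have hεpos : 0 < ε := by positivity
  have hb1 : Metric.ball (0 : ℂ) ε ⊆ Metric.ball 0 ε₁ := Metric.ball_subset_ball (min_le_left _ _)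
  have hb2 : Metric.ball (0 : ℂ) ε ⊆ Metric.ball 0 ε₂ :=
    Metric.ball_subset_ball ((min_le_right _ _).trans (min_le_left _ _))
  have hb3 : Metric.ball (0 : ℂ) ε ⊆ Metric.ball 0 δ :=
    Metric.ball_subset_ball ((min_le_right _ _).trans (min_le_right _ _))
  set B := Metric.ball (0 : ℂ) ε ×ˢ Metric.ball (0 : ℂ) δ with hB
  have hBo : IsOpen B := Metric.isOpen_ball.prod Metric.isOpen_ball
  have hBδ : B ⊆ Metric.ball (0 : ℂ × ℂ) δ := by
    rintro v ⟨ha, hb⟩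
    rw [← Prod.mk_zero_zero, ← ball_prod_same]
    exact ⟨hb3 ha, hb⟩
  have hWo : IsOpen (Φ.source ∩ Φ ⁻¹' B) := Φ.isOpen_inter_preimage hBo
  refine ⟨Φ.restrOpen _ hWo, ε, δ, u, ⟨hp, hp, ?_⟩, ?_, hp0, hΦ.restrOpen hWo, hεpos, hδ, ?_, ?_,
    ?_, ?_, ?_⟩
  · change Φ p ∈ B
    rw [hp0]
    exact ⟨Metric.mem_ball_self hεpos, Metric.mem_ball_self hδ⟩
  · rintro x ⟨hx, _, hxB⟩
    have := (h2 (Φ x) (hBδ hxB)).2.1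
    rwa [Φ.left_inv hx] at this
  · change Φ.target ∩ Φ.symm ⁻¹' (Φ.source ∩ Φ ⁻¹' B) = B
    ext v
    constructor
    · rintro ⟨hv, _, hv2⟩
      change Φ (Φ.symm v) ∈ B at hv2
      rwa [Φ.right_inv hv] at hv2
    · intro hv
      have hvt := (h2 v (hBδ hv)).1
      refine ⟨hvt, Φ.map_target hvt, ?_⟩
      change Φ (Φ.symm v) ∈ B
      rwa [Φ.right_inv hvt]
  · exact fun k s hs => ((h1 s (hb1 hs)).1 k).1
  · exact fun k s hs => h3 s (hb2 hs) k
  · exact fun i j hij s hs => (h1 s (hb1 hs)).2 i j hij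
  · rintro k q ⟨hq, _, hqB⟩
    have := (h2 (Φ q) (hBδ hqB)).2.2 k
    rw [Φ.left_inv hq, ((h1 (Φ q).1 (hb1 hqB.1)).1 k).2] at this
    exact this

end

/-! ### Orders along a curve and discrepancies -/

lemma frequently_fst_ne_zero (v : ℂ × ℂ) : ∃ᶠ w in 𝓝 v, w.1 ≠ 0 := by
  have h1 : ∃ᶠ s in 𝓝 v.1, s ≠ 0 := by
    have hd : Dense ({0}ᶜ : Set ℂ) := dense_compl_singleton 0
    exact mem_closure_iff_frequently.1 (hd v.1)
  have h2 : Filter.Tendsto (fun s : ℂ => (s, v.2)) (𝓝 v.1) (𝓝 v) :=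
    (by fun_prop : Continuous fun s : ℂ => (s, v.2)).tendsto v.1
  exact h2.frequently h1

/-- The coordinate `v.1` is not a zero divisor. -/
lemma eventually_eq_zero_of_fst_pow_mul {g : ℂ × ℂ → ℂ} {v₀ : ℂ × ℂ} (hg : AnalyticAt ℂ g v₀)
    {n : ℕ} (h : ∀ᶠ v in 𝓝 v₀, v.1 ^ n * g v = 0) : ∀ᶠ v in 𝓝 v₀, g v = 0 := by
  filter_upwards [hg.eventually_analyticAt, h.eventually_nhds] with v hv hv'
  by_contra h0
  have h1 := hv.continuousAt.eventually_ne h0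
  obtain ⟨w, hw, hw1, hw2⟩ := ((frequently_fst_ne_zero v).and_eventually (h1.and hv')).exists
  exact (mul_ne_zero (pow_ne_zero n hw) hw1) hw2

/-- Comparison of the orders of vanishing along the line `{v.1 = 0}`. -/
lemma order_le_of_fst_pow_mul_eq {u w : ℂ × ℂ → ℂ} {v₀ : ℂ × ℂ} (hu : AnalyticAt ℂ u v₀)
    (hw : AnalyticAt ℂ w v₀) {m n : ℕ} (h : ∀ᶠ v in 𝓝 v₀, v.1 ^ m * u v = v.1 ^ n * w v)
    (hu0 : ¬ ∀ᶠ v in 𝓝 v₀, v.1 = 0 → u v = 0) : n ≤ m := by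
  by_contra! hmn
  have ha : AnalyticAt ℂ (fun v : ℂ × ℂ => v.1 ^ (n - m) * w v) v₀ :=
    (analyticAt_fst.pow _).mul hw
  have := eventually_eq_zero_of_fst_pow_mul (hu.sub ha) (n := m) (by
    filter_upwards [h] with v hv
    simp only [Pi.sub_apply, mul_sub, hv]
    rw [← mul_assoc, ← pow_add, Nat.add_sub_cancel' hmn.le, sub_self])
  apply hu0
  filter_upwards [this] with v hv hv0
  rw [Pi.sub_apply, sub_eq_zero] at hv
  rw [hv, hv0, zero_pow (by omega), zero_mul]

/-- If the components of a holomorphic map vanish along `{v.1 = 0}` to the orders at least `α` and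
`β`, then its Jacobian determinant vanishes to order at least `α + β - 1`: the form
`dx / x ∧ dy / y` has a logarithmic pole. -/
lemma sq_mul_det_fderiv {F A B : ℂ × ℂ → ℂ} {G : ℂ × ℂ → ℂ} {v₀ : ℂ × ℂ}
    (hA : AnalyticAt ℂ A v₀) (hB : AnalyticAt ℂ B v₀) {α β : ℕ}
    (hF : ∀ᶠ v in 𝓝 v₀, F v = v.1 ^ α * A v) (hG : ∀ᶠ v in 𝓝 v₀, G v = v.1 ^ β * B v) :
    ∃ W : ℂ × ℂ → ℂ, AnalyticAt ℂ W v₀ ∧ ∀ᶠ v in 𝓝 v₀,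
      v.1 ^ 2 * (fderiv ℂ (fun v => (F v, G v)) v).det = v.1 ^ (α + β + 1) * W v := by
  have happ : ∀ {C : ℂ × ℂ → ℂ} (w : ℂ × ℂ), AnalyticAt ℂ C v₀ →
      AnalyticAt ℂ (fun v => fderiv ℂ C v w) v₀ := fun w hC =>
    ((ContinuousLinearMap.apply ℂ ℂ w).analyticAt _).comp hC.fderiv
  have key : ∀ {F A : ℂ × ℂ → ℂ} {α : ℕ} {v : ℂ × ℂ}, AnalyticAt ℂ A v →
      (∀ᶠ v' in 𝓝 v, F v' = v'.1 ^ α * A v') → DifferentiableAt ℂ F v ∧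
      v.1 * fderiv ℂ F v (1, 0) = v.1 ^ α * (α * A v + v.1 * fderiv ℂ A v (1, 0)) ∧
      v.1 * fderiv ℂ F v (0, 1) = v.1 ^ α * (v.1 * fderiv ℂ A v (0, 1)) := by
    intro F A α v hA hF
    have h1 : HasFDerivAt (fun v : ℂ × ℂ => v.1 ^ α)
        ((α * v.1 ^ (α - 1)) • ContinuousLinearMap.fst ℂ ℂ ℂ) v := by
      simpa using (hasFDerivAt_fst (𝕜 := ℂ) (p := v)).pow α
    have h2 := (h1.mul hA.differentiableAt.hasFDerivAt).congr_of_eventuallyEq hF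
    refine ⟨h2.differentiableAt, ?_, ?_⟩
    · rw [h2.fderiv]
      rcases Nat.eq_zero_or_pos α with rfl | hα
      · simp
      · obtain ⟨m, rfl⟩ := Nat.exists_eq_add_of_lt hα
        simp
        ring
    · rw [h2.fderiv]
      simp
      ring
  refine ⟨fun v => (α * A v) * fderiv ℂ B v (0, 1) - fderiv ℂ A v (0, 1) * (β * B v) + v.1 *
    (fderiv ℂ A v (1, 0) * fderiv ℂ B v (0, 1) - fderiv ℂ A v (0, 1) * fderiv ℂ B v (1, 0)),
    ?_, ?_⟩
  · have hA1 := happ (1, 0) hA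
    have hA2 := happ (0, 1) hA
    have hB1 := happ (1, 0) hB
    have hB2 := happ (0, 1) hB
    exact (((analyticAt_const.mul hA).mul hB2).sub (hA2.mul (analyticAt_const.mul hB))).add
      (analyticAt_fst.mul ((hA1.mul hB2).sub (hA2.mul hB1)))
  · filter_upwards [hA.eventually_analyticAt, hB.eventually_analyticAt, hF.eventually_nhds,
      hG.eventually_nhds] with v h1 h2 h3 h4
    obtain ⟨d1, a1, a2⟩ := key h1 h3
    obtain ⟨d2, b1, b2⟩ := key h2 h4
    rw [det_fderiv_prodMk d1 d2]
    linear_combination (v.1 * fderiv ℂ G v (0, 1)) * a1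
      + (v.1 ^ α * (α * A v + v.1 * fderiv ℂ A v (1, 0))) * b2
      - (v.1 * fderiv ℂ G v (1, 0)) * a2
      - (v.1 ^ α * (v.1 * fderiv ℂ A v (0, 1))) * b1

section

variable {X : Type u} [TopologicalSpace X] [ChartedSpace (ℂ × ℂ) X]
variable {Y : Type u} [TopologicalSpace Y] [ChartedSpace (ℂ × ℂ) Y]

lemma IsHolChart.analyticAt_comp {Φ : OpenPartialHomeomorph X (ℂ × ℂ)} (hΦ : IsHolChart Φ)
    {Ψ : OpenPartialHomeomorph Y (ℂ × ℂ)} (hΨ : IsHolChart Ψ) {f : Y → X} {y : Y}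
    (hf : ContMDiffAt 𝓘(ℂ, ℂ × ℂ) 𝓘(ℂ, ℂ × ℂ) ω f y) (hfy : f y ∈ Φ.source) (hy : y ∈ Ψ.source) :
    AnalyticAt ℂ (Φ ∘ f ∘ Ψ.symm) (Ψ y) := by
  refine ContDiffAt.analyticAt (contMDiffAt_iff_contDiffAt.1 ?_)
  have h1 : ContMDiffAt 𝓘(ℂ, ℂ × ℂ) 𝓘(ℂ, ℂ × ℂ) ω (Φ ∘ f) (Ψ.symm (Ψ y)) := by
    rw [Ψ.left_inv hy]
    exact ContMDiffAt.comp y (hΦ.contMDiffAt hfy) hf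
  exact ContMDiffAt.comp (g := Φ ∘ f) (f := Ψ.symm) (Ψ y) h1 (hΨ.contMDiffAt_symm (Ψ.map_source hy))

/-- Up to a unit, the Jacobian determinant can be computed in arbitrary holomorphic charts. -/
lemma jacobian_eq [IsManifold 𝓘(ℂ, ℂ × ℂ) ω X] [IsManifold 𝓘(ℂ, ℂ × ℂ) ω Y]
    {Φ : OpenPartialHomeomorph X (ℂ × ℂ)} (hΦ : IsHolChart Φ)
    {Ψ : OpenPartialHomeomorph Y (ℂ × ℂ)} (hΨ : IsHolChart Ψ) {f : Y → X} {y : Y}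
    (hf : ContMDiffAt 𝓘(ℂ, ℂ × ℂ) 𝓘(ℂ, ℂ × ℂ) ω f y) (hfy : f y ∈ Φ.source) (hy : y ∈ Ψ.source) :
    ∃ κ : ℂ × ℂ → ℂ, AnalyticAt ℂ κ (Ψ y) ∧ κ (Ψ y) ≠ 0 ∧ ∀ᶠ v in 𝓝 (Ψ y),
      jacobian f y (Ψ.symm v) = κ v * (fderiv ℂ (Φ ∘ f ∘ Ψ.symm) v).det := by
  set φ := chartAt (ℂ × ℂ) (f y) with hφdef
  set ψ := chartAt (ℂ × ℂ) y with hψdef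
  have hφ : IsHolChart φ := isHolChart_chartAt _
  have hψ : IsHolChart ψ := isHolChart_chartAt _
  have hfyφ : f y ∈ φ.source := mem_chart_source _ _
  have hyψ : y ∈ ψ.source := mem_chart_source _ _
  have hA := hΦ.analyticAt_comp_symm hφ hfy hfyφ
  have hA0 := hΦ.det_fderiv_comp_symm_ne_zero hφ hfy hfyφ
  have hB := hψ.analyticAt_comp_symm hΨ hyψ hy
  have hB0 := hψ.det_fderiv_comp_symm_ne_zero hΨ hyψ hy
  have hT := hΨ.analyticAt_comp_symm hψ hy hyψ
  have hF := hΦ.analyticAt_comp hΨ hf hfy hy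
  set A := φ ∘ Φ.symm
  set B := Ψ ∘ ψ.symm
  set T := ψ ∘ Ψ.symm with hTdef
  set F := Φ ∘ f ∘ Ψ.symm with hFdef
  have hFy : F (Ψ y) = Φ (f y) := by simp [hFdef, Ψ.left_inv hy]
  have hTy : T (Ψ y) = ψ y := by simp [hTdef, Ψ.left_inv hy]
  have hBy : B (ψ y) = Ψ y := by simp [B, ψ.left_inv hyψ]
  rw [← hFy] at hA hA0
  rw [← hTy] at hB hB0
  refine ⟨fun v => (fderiv ℂ A (F v)).det * (fderiv ℂ B (T v)).det,
    ((analyticAt_det_fderiv hA).comp hF).mul ((analyticAt_det_fderiv hB).comp hT),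
    mul_ne_zero hA0 hB0, ?_⟩
  -- near `ψ y` the local expression of `f` in the preferred charts is `A ∘ F ∘ B`
  have hsrc : ∀ᶠ x in 𝓝 y, x ∈ ψ.source ∧ x ∈ Ψ.source ∧ f x ∈ Φ.source :=
    Filter.Eventually.and (ψ.open_source.mem_nhds hyψ)
      (Filter.Eventually.and (Ψ.open_source.mem_nhds hy)
        (hf.continuousAt.eventually (Φ.open_source.mem_nhds hfy)))
  have hcomp : ∀ᶠ w in 𝓝 (ψ y),
      writtenInExtChartAt 𝓘(ℂ, ℂ × ℂ) 𝓘(ℂ, ℂ × ℂ) y f w = (A ∘ F ∘ B) w := by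
    filter_upwards [(hψ.tendsto_symm hyψ).eventually hsrc] with w hw
    simp [writtenInExtChartAt, A, F, B, Ψ.left_inv hw.2.1, Φ.left_inv hw.2.2, ← hφdef, ← hψdef]
  have hTt : Filter.Tendsto T (𝓝 (Ψ y)) (𝓝 (ψ y)) := by
    have := hT.continuousAt.tendsto
    rwa [hTy] at this
  have hFt := hF.continuousAt.tendsto
  filter_upwards [hTt.eventually hcomp.eventually_nhds, (hΨ.tendsto_symm hy).eventually hsrc,
    hFt.eventually hA.eventually_analyticAt, hT.continuousAt.tendsto.eventually
    hB.eventually_analyticAt, hF.eventually_analyticAt, Ψ.open_target.mem_nhds (Ψ.map_source hy)]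
    with v h1 h2 h3 h4 h5 h6
  have hBT : B (T v) = v := by
    simp [B, T, ψ.left_inv h2.1, Ψ.right_inv h6]
  have e1 : jacobian f y (Ψ.symm v) = (fderiv ℂ (A ∘ F ∘ B) (T v)).det := by
    have h7 : writtenInExtChartAt 𝓘(ℂ, ℂ × ℂ) 𝓘(ℂ, ℂ × ℂ) y f =ᶠ[𝓝 (T v)] A ∘ F ∘ B := h1
    rw [← h7.fderiv_eq]
    rfl
  have dF : DifferentiableAt ℂ F (B (T v)) := by rw [hBT]; exact h5.differentiableAt
  have dA : DifferentiableAt ℂ A ((F ∘ B) (T v)) := by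
    rw [Function.comp, hBT]; exact h3.differentiableAt
  rw [e1, det_fderiv_comp dA (dF.comp _ h4.differentiableAt),
    det_fderiv_comp dF h4.differentiableAt, Function.comp, hBT]
  ring

/-- Orders along a smooth curve `E`, computed in a chart in which `E` is `{v.1 = 0}`. -/
lemma HasOrderAlong.exists_chart {E : Set Y} {y : Y} {g : Y → ℂ} {n : ℕ}
    (h : HasOrderAlong E y g n) {Ψ : OpenPartialHomeomorph Y (ℂ × ℂ)} (hΨ : IsHolChart Ψ)
    (hy : y ∈ Ψ.source) (h0 : (Ψ y).1 = 0) (hE : ∀ᶠ x in 𝓝 y, x ∈ E ↔ (Ψ x).1 = 0) :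
    ∃ u : ℂ × ℂ → ℂ, AnalyticAt ℂ u (Ψ y) ∧
      (∀ᶠ v in 𝓝 (Ψ y), g (Ψ.symm v) = v.1 ^ n * u v) ∧
      ¬ ∀ᶠ v in 𝓝 (Ψ y), v.1 = 0 → u v = 0 := by
  obtain ⟨z, u, hz, hu, hg, hu0⟩ := h
  have hl := hΨ.isLocalEquation_fst hy h0 hE
  obtain ⟨κ, hκ, h1⟩ := hl.2.2 z hz.1 hz.2.1
  obtain ⟨κ', hκ', h2⟩ := hz.2.2 _ hl.1 hl.2.1
  have aκ := (hΨ.holomorphicAt_iff hy).1 hκ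
  have aκ' := (hΨ.holomorphicAt_iff hy).1 hκ'
  have au := (hΨ.holomorphicAt_iff hy).1 hu
  have ht := hΨ.tendsto_symm hy
  have htar : ∀ᶠ v in 𝓝 (Ψ y), v ∈ Ψ.target := Ψ.open_target.mem_nhds (Ψ.map_source hy)
  have hunit : ∀ᶠ v in 𝓝 (Ψ y), 1 - κ (Ψ.symm v) * κ' (Ψ.symm v) = 0 := by
    refine eventually_eq_zero_of_fst_pow_mul (n := 1) (analyticAt_const.sub (aκ.mul aκ')) ?_
    filter_upwards [ht.eventually h1, ht.eventually h2, htar] with v e1 e2 e3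
    rw [e1, Ψ.right_inv e3] at e2
    rw [pow_one]
    linear_combination e2
  -- the two local equations of `E` differ by the unit `κ`
  refine ⟨fun v => κ (Ψ.symm v) ^ n * u (Ψ.symm v), (aκ.pow n).mul au, ?_, fun hvan => hu0 ?_⟩
  · filter_upwards [ht.eventually h1, ht.eventually hg, htar] with v e1 e2 e3
    rw [e2, e1, Ψ.right_inv e3]
    ring
  · rw [← hΨ.eventually_symm_iff hy]
    filter_upwards [hvan, hunit, htar, ht.eventually hE] with v e1 e2 e3 e4 e5
    rw [e4, Ψ.right_inv e3] at e5
    have := e1 e5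
    rcases mul_eq_zero.1 this with h | h
    · rw [eq_zero_of_pow_eq_zero h] at e2
      simp at e2
    · exact h

/-- The fundamental inequality `ord_E x + ord_E y ≤ A(E)` between the orders along `E` of two local
coordinates and the log discrepancy `A(E)` of `E`. -/
lemma add_le_jacobian_order [IsManifold 𝓘(ℂ, ℂ × ℂ) ω X] [IsManifold 𝓘(ℂ, ℂ × ℂ) ω Y]
    {Φ : OpenPartialHomeomorph X (ℂ × ℂ)} (hΦ : IsHolChart Φ)
    {Ψ : OpenPartialHomeomorph Y (ℂ × ℂ)} (hΨ : IsHolChart Ψ) {f : Y → X} {y : Y}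
    (hf : ContMDiffAt 𝓘(ℂ, ℂ × ℂ) 𝓘(ℂ, ℂ × ℂ) ω f y) (hfy : f y ∈ Φ.source) (hy : y ∈ Ψ.source)
    {j : ℕ} {u : ℂ × ℂ → ℂ} (hu : AnalyticAt ℂ u (Ψ y))
    (hJ : ∀ᶠ v in 𝓝 (Ψ y), jacobian f y (Ψ.symm v) = v.1 ^ j * u v)
    (hu0 : ¬ ∀ᶠ v in 𝓝 (Ψ y), v.1 = 0 → u v = 0) {α β : ℕ} {A B : ℂ × ℂ → ℂ}
    (hA : AnalyticAt ℂ A (Ψ y)) (hB : AnalyticAt ℂ B (Ψ y))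
    (h1 : ∀ᶠ v in 𝓝 (Ψ y), (Φ (f (Ψ.symm v))).1 = v.1 ^ α * A v)
    (h2 : ∀ᶠ v in 𝓝 (Ψ y), (Φ (f (Ψ.symm v))).2 = v.1 ^ β * B v) : α + β ≤ j + 1 := by
  obtain ⟨κ, hκ, -, hκJ⟩ := jacobian_eq hΦ hΨ hf hfy hy
  obtain ⟨W, hW, hdet⟩ := sq_mul_det_fderiv hA hB h1 h2
  have := order_le_of_fst_pow_mul_eq (m := j + 2) (n := α + β + 1) hu (hκ.mul hW) (by
    filter_upwards [hJ, hκJ, hdet] with v e1 e2 e3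
    have e4 : (fderiv ℂ (Φ ∘ f ∘ Ψ.symm) v).det = (fderiv ℂ (fun v => ((Φ (f (Ψ.symm v))).1,
      (Φ (f (Ψ.symm v))).2)) v).det := rfl
    rw [← e4] at e3
    rw [Pi.mul_apply]
    linear_combination (-v.1 ^ 2) * e1 + v.1 ^ 2 * e2 + κ v * e3) hu0
  omega

end

/-- The numerical heart of the inequality `-1 < a_E`: `a` is the order of `x`, `n k` are
the orders of the curves and `j + 1` is the log discrepancy. -/
lemma neg_one_lt_of_orders {ι : Type*} [Fintype ι] {b : ι → ℝ} (hb0 : ∀ k, 0 < b k)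
    (hb1 : ∀ k, b k < 1) {t : ℕ} (ht : 1 ≤ t) (hsum : ∑ k, b k < 1 + 1 / (t : ℝ))
    {n : ι → ℕ} {a j : ℕ} (hle : ∀ k, a + n k ≤ j + 1)
    (heq : ∀ i k, i ≠ k → t * a < n k → n i = t * a) :
    -1 < (j : ℝ) - ∑ k, b k * (n k : ℝ) := by
  classical
  have ht' : (0 : ℝ) < t := by exact_mod_cast ht
  -- either one curve has order `> t * a` and all others have order `t * a`, or all orders are at
  -- most `t * a` and the sum is estimated by the maximal one
  by_cases hcase : ∃ k, t * a < n k
  · obtain ⟨k, hk⟩ := hcase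
    have h1 : ∑ i, b i * (n i : ℝ) = b k * ((n k : ℝ) - t * a) + t * a * ∑ i, b i := by
      have h2 : ∀ i, b i * (n i : ℝ) = (if i = k then b k * ((n k : ℝ) - t * a) else 0)
          + t * a * b i := by
        intro i
        by_cases hi : i = k
        · subst hi
          simp
          ring
        · rw [if_neg hi, heq i k hi hk]
          push_cast
          ring
      rw [Finset.sum_congr rfl fun i _ => h2 i, Finset.sum_add_distrib, Finset.mul_sum]
      simp
    have hk' : (0 : ℝ) < n k - t * a := by
      have : ((t * a : ℕ) : ℝ) < n k := by exact_mod_cast hk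
      push_cast at this
      linarith
    have h3 : b k * ((n k : ℝ) - t * a) < (n k : ℝ) - t * a := by nlinarith [hb1 k]
    have h4 : (t : ℝ) * a * ∑ i, b i ≤ t * a * (1 + 1 / t) :=
      mul_le_mul_of_nonneg_left hsum.le (by positivity)
    have h5 : (t : ℝ) * a * (1 + 1 / t) = t * a + a := by field_simp
    have h6 : (a : ℝ) + n k ≤ j + 1 := by exact_mod_cast hle k
    linarith
  · push Not at hcase
    by_cases hn : ∀ k, n k = 0
    · simp only [hn, Nat.cast_zero, mul_zero, Finset.sum_const_zero, sub_zero]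
      have : (0 : ℝ) ≤ j := Nat.cast_nonneg j
      linarith
    · push Not at hn
      obtain ⟨k₁, hk₁⟩ := hn
      have : Nonempty ι := ⟨k₁⟩
      obtain ⟨k, hk⟩ := Finite.exists_max n
      have hpos : (0 : ℝ) < n k := by
        have := hk k₁
        exact_mod_cast (by omega : 0 < n k)
      have h1 : ∑ i, b i * (n i : ℝ) ≤ n k * ∑ i, b i := by
        rw [Finset.mul_sum]
        refine Finset.sum_le_sum fun i _ => ?_
        rw [mul_comm]
        exact mul_le_mul_of_nonneg_right (by exact_mod_cast hk i) (hb0 i).le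
      have h2 : (n k : ℝ) * ∑ i, b i < n k * (1 + 1 / t) := mul_lt_mul_of_pos_left hsum hpos
      have h3 : (n k : ℝ) * (1 / t) ≤ a := by
        rw [mul_one_div, div_le_iff₀ ht']
        have := hcase k
        rw [mul_comm] at this
        exact_mod_cast this
      have h6 : (a : ℝ) + n k ≤ j + 1 := by exact_mod_cast hle k
      linarith

section

variable {X : Type u} [TopologicalSpace X] [ChartedSpace (ℂ × ℂ) X]
variable {Y : Type u} [TopologicalSpace Y] [ChartedSpace (ℂ × ℂ) Y]

/-- If `C` is the graph of `g`, then `y - g x` is a local equation of `C` also at the points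
outside `C`. -/
lemma IsHolChart.isLocalEquation_graph {Φ : OpenPartialHomeomorph X (ℂ × ℂ)} (hΦ : IsHolChart Φ)
    {q : X} (hq : q ∈ Φ.source) {C : Set X} {g : ℂ → ℂ} (hg : AnalyticAt ℂ g (Φ q).1)
    (hC : ∀ᶠ x in 𝓝 q, x ∈ C ↔ (Φ x).2 = g (Φ x).1) :
    IsLocalEquation C q (fun x => (Φ x).2 - g (Φ x).1) := by
  -- outside `C` the function is a unit
  by_cases hqC : (Φ q).2 = g (Φ q).1
  · exact hΦ.isLocalEquation_graph_of_mem hq hg hC hqC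
  have ha : AnalyticAt ℂ (fun v : ℂ × ℂ => v.2 - g v.1) (Φ q) :=
    analyticAt_snd.sub (hg.comp analyticAt_fst)
  have ha' := hΦ.holomorphicAt_comp hq ha
  have hne : (Φ q).2 - g (Φ q).1 ≠ 0 := sub_ne_zero.2 hqC
  have hinv := hΦ.holomorphicAt_comp hq (ha.inv hne)
  refine ⟨ha', ?_, fun f hf _ => ⟨fun x => f x * ((Φ x).2 - g (Φ x).1)⁻¹, ?_, ?_⟩⟩
  · filter_upwards [hC] with x hx hxC using sub_eq_zero.2 (hx.1 hxC)
  · rw [hΦ.holomorphicAt_iff hq] at hf hinv ⊢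
    exact hf.mul hinv
  · have : ∀ᶠ x in 𝓝 q, (Φ x).2 - g (Φ x).1 ≠ 0 :=
      (ha'.continuousAt (x := q)).eventually_ne hne
    filter_upwards [this] with x hx
    field_simp

/-- Local equations of the same hypersurface have the same order along `E`. -/
lemma exists_order_of_isLocalEquation {D : Set X} {f : Y → X} {y : Y}
    (hf : ContMDiffAt 𝓘(ℂ, ℂ × ℂ) 𝓘(ℂ, ℂ × ℂ) ω f y) {h h' : X → ℂ}
    (hh : IsLocalEquation D (f y) h) (hh' : IsLocalEquation D (f y) h')
    {Ψ : OpenPartialHomeomorph Y (ℂ × ℂ)} (hΨ : IsHolChart Ψ) (hy : y ∈ Ψ.source)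
    {n : ℕ} {u : ℂ × ℂ → ℂ} (hu : AnalyticAt ℂ u (Ψ y))
    (hu1 : ∀ᶠ v in 𝓝 (Ψ y), h (f (Ψ.symm v)) = v.1 ^ n * u v)
    (hu0 : ¬ ∀ᶠ v in 𝓝 (Ψ y), v.1 = 0 → u v = 0) :
    ∃ u' : ℂ × ℂ → ℂ, AnalyticAt ℂ u' (Ψ y) ∧
      (∀ᶠ v in 𝓝 (Ψ y), h' (f (Ψ.symm v)) = v.1 ^ n * u' v) ∧
      ¬ ∀ᶠ v in 𝓝 (Ψ y), v.1 = 0 → u' v = 0 := by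
  obtain ⟨κ, hκ, h1⟩ := hh.2.2 h' hh'.1 hh'.2.1
  obtain ⟨κ', hκ', h2⟩ := hh'.2.2 h hh.1 hh.2.1
  have aκ := (hΨ.holomorphicAt_iff hy).1 (ContMDiffAt.comp y hκ hf)
  have aκ' := (hΨ.holomorphicAt_iff hy).1 (ContMDiffAt.comp y hκ' hf)
  have hft : Filter.Tendsto (fun v => f (Ψ.symm v)) (𝓝 (Ψ y)) (𝓝 (f y)) :=
    hf.continuousAt.tendsto.comp (hΨ.tendsto_symm hy)
  have hu' : AnalyticAt ℂ (fun v => u v * κ (f (Ψ.symm v))) (Ψ y) := hu.mul aκ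
  refine ⟨fun v => u v * κ (f (Ψ.symm v)), hu', ?_, fun hvan => hu0 ?_⟩
  · filter_upwards [hft.eventually h1, hu1] with v e1 e2
    rw [e1, e2, mul_assoc]
  · have := eventually_eq_zero_of_fst_pow_mul (n := n) (hu.sub (hu'.mul aκ')) (by
      filter_upwards [hft.eventually h1, hft.eventually h2, hu1] with v e1 e2 e3
      rw [e1, e3] at e2
      simp only [Pi.sub_apply, Pi.mul_apply, Function.comp]
      linear_combination e2)
    filter_upwards [this, hvan] with v e1 e2 e3
    simp only [Pi.sub_apply, Pi.mul_apply, Function.comp, e2 e3, zero_mul, sub_zero] at e1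
    exact e1

/-- If near `q` the components of the boundary are graphs with pairwise contact order `t`, then
`∑ b k < 1 + 1 / t` implies that all discrepancies of divisors over `q` are `> -1`. -/
theorem neg_one_lt_of_hasDiscrepancy [IsManifold 𝓘(ℂ, ℂ × ℂ) ω X] [IsManifold 𝓘(ℂ, ℂ × ℂ) ω Y]
    {ι : Type*} [Fintype ι] {b : ι → ℝ} (hb0 : ∀ k, 0 < b k)
    (hb1 : ∀ k, b k < 1) {t : ℕ} (ht : 1 ≤ t) (hsum : ∑ k, b k < 1 + 1 / (t : ℝ))
    {Φ : OpenPartialHomeomorph X (ℂ × ℂ)} (hΦ : IsHolChart Φ) {D : ι → Set X} {u : ι → ℂ → ℂ}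
    (hu : ∀ k, ∀ q ∈ Φ.source, AnalyticAt ℂ (u k) (Φ q).1)
    (hne : ∀ i k, i ≠ k → ∀ q ∈ Φ.source, u i (Φ q).1 ≠ u k (Φ q).1)
    (hD : ∀ k, ∀ q ∈ Φ.source, q ∈ D k ↔ (Φ q).2 = (Φ q).1 ^ t * u k (Φ q).1)
    {f : Y → X} (hf : ContMDiff 𝓘(ℂ, ℂ × ℂ) 𝓘(ℂ, ℂ × ℂ) ω f) (hfs : ∀ y, f y ∈ Φ.source)
    {E : Set Y} (hE : ∀ y ∈ E, IsSmoothCurveAt E y) {d : ℝ} (hd : HasDiscrepancy D b f E d) :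
    -1 < d := by
  obtain ⟨y, hyE, j, h, n, hJ, hh, hn, rfl⟩ := hd
  obtain ⟨z, hz⟩ := hE y hyE
  obtain ⟨Ψ, hΨ, hy, hΨz, hΨE⟩ := hz.exists_isHolChart
  have h0 : (Ψ y).1 = 0 := by rw [hΨz y hy, hz.2.1]
  have hEv : ∀ᶠ x in 𝓝 y, x ∈ E ↔ (Ψ x).1 = 0 := by
    filter_upwards [Ψ.open_source.mem_nhds hy] with x hx
    rw [hΨz x hx, hΨE x hx]
  have hfy := hfs y
  set s₀ := (Φ (f y)).1 with hs₀
  have hF := hΦ.analyticAt_comp hΨ (hf y) hfy hy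
  have hF1 : AnalyticAt ℂ (fun v => (Φ (f (Ψ.symm v))).1) (Ψ y) := analyticAt_fst.comp hF
  have hF1y : (Φ (f (Ψ.symm (Ψ y)))).1 = s₀ := by rw [Ψ.left_inv hy]
  have huF : ∀ k, AnalyticAt ℂ (fun v => u k (Φ (f (Ψ.symm v))).1) (Ψ y) := fun k =>
    (hu k _ hfy).comp_of_eq hF1 hF1y
  obtain ⟨w, hw, hwJ, hw0⟩ := hJ.exists_chart hΨ hy h0 hEv
  -- the orders of the equations `y - x ^ t * u k x`
  have hg : ∀ k, AnalyticAt ℂ (fun s => s ^ t * u k s) s₀ := fun k =>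
    (analyticAt_id.pow t).mul (hu k _ hfy)
  have hk : ∀ k, ∃ c : ℂ × ℂ → ℂ, AnalyticAt ℂ c (Ψ y) ∧
      (∀ᶠ v in 𝓝 (Ψ y), (Φ (f (Ψ.symm v))).2 - (Φ (f (Ψ.symm v))).1 ^ t *
        u k (Φ (f (Ψ.symm v))).1 = v.1 ^ n k * c v) ∧
      ¬ ∀ᶠ v in 𝓝 (Ψ y), v.1 = 0 → c v = 0 := by
    intro k
    obtain ⟨c, hc, hc1, hc0⟩ := (hn k).exists_chart hΨ hy h0 hEv
    refine exists_order_of_isLocalEquation (hf y) (hh k) (hΦ.isLocalEquation_graph hfy (hg k) ?_)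
      hΨ hy hc hc1 hc0
    filter_upwards [Φ.open_source.mem_nhds hfy] with x hx using hD k x hx
  choose c hc hck hc0 using hk
  -- `x` and `y - x ^ t * u k x` are coordinates, so the orders are bounded by the Jacobian
  have hbound : ∀ k (a : ℕ) (A : ℂ × ℂ → ℂ), AnalyticAt ℂ A (Ψ y) →
      (∀ᶠ v in 𝓝 (Ψ y), (Φ (f (Ψ.symm v))).1 = v.1 ^ a * A v) → a + n k ≤ j + 1 := by
    intro k a A hA hxA
    have hg' : AnalyticAt ℂ (fun v : ℂ × ℂ => v.1 ^ t * u k v.1) (Φ (f y)) :=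
      (hg k).comp analyticAt_fst
    have ha : AnalyticAt ℂ (fun v : ℂ × ℂ => v.2 - v.1 ^ t * u k v.1) (Φ (f y)) :=
      analyticAt_snd.sub hg'
    obtain ⟨Φ', hΦ', hq', -, he⟩ := exists_isHolChart hΦ hfy
      (G := fun v => (v.1, v.2 - v.1 ^ t * u k v.1)) (analyticAt_fst.prod ha) (by
        have hf := hasFDerivAt_snd_sub_comp_fst (v := Φ (f y)) (hg k)
        rw [det_fderiv_prodMk differentiableAt_fst ha.differentiableAt, hf.fderiv, fderiv_fst]
        simp)
    exact add_le_jacobian_order hΦ' hΨ (hf y) hq' hy hw hwJ hw0 hA (hc k)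
      (by simpa only [he] using hxA) (by simpa only [he] using hck k)
  rcases isEmpty_or_nonempty ι with hι | ⟨⟨k₀⟩⟩
  · have : (0 : ℝ) ≤ j := Nat.cast_nonneg j
    simp only [Finset.univ_eq_empty, Finset.sum_empty, sub_zero]
    linarith
  -- the order `a` of `x` along `E`
  obtain ⟨a, A, hA, hxA, hA0⟩ : ∃ (a : ℕ) (A : ℂ × ℂ → ℂ), AnalyticAt ℂ A (Ψ y) ∧
      (∀ᶠ v in 𝓝 (Ψ y), (Φ (f (Ψ.symm v))).1 = v.1 ^ a * A v) ∧
      ¬ ∀ᶠ v in 𝓝 (Ψ y), v.1 = 0 → A v = 0 := by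
    -- otherwise `x` would be divisible by arbitrarily high powers of the equation of `E`
    by_contra! hcon
    have hall : ∀ a : ℕ, ∃ A : ℂ × ℂ → ℂ, AnalyticAt ℂ A (Ψ y) ∧
        ∀ᶠ v in 𝓝 (Ψ y), (Φ (f (Ψ.symm v))).1 = v.1 ^ a * A v := by
      intro a
      induction a with
      | zero => exact ⟨_, hF1, by simp⟩
      | succ a ih =>
        obtain ⟨A, hA, hxA⟩ := ih
        obtain ⟨A', hA', h1⟩ := exists_eq_fst_mul h0 hA (hcon a A hA hxA)
        refine ⟨A', hA', ?_⟩
        filter_upwards [hxA, h1] with v e1 e2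
        rw [e1, e2, pow_succ, mul_assoc]
    obtain ⟨A, hA, hxA⟩ := hall (j + 2)
    have := hbound k₀ (j + 2) A hA hxA
    omega
  refine neg_one_lt_of_orders hb0 hb1 ht hsum (fun k => hbound k a A hA hxA) ?_
  intro i k hik hka
  -- `(y - x ^ t * u i x) - (y - x ^ t * u k x) = x ^ t * (u k x - u i x)`, the last factor a unit
  have hU : AnalyticAt ℂ (fun v => A v ^ t *
      (u k (Φ (f (Ψ.symm v))).1 - u i (Φ (f (Ψ.symm v))).1)) (Ψ y) :=
    (hA.pow t).mul ((huF k).sub (huF i))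
  have hU0 : ¬ ∀ᶠ v in 𝓝 (Ψ y), v.1 = 0 → A v ^ t *
      (u k (Φ (f (Ψ.symm v))).1 - u i (Φ (f (Ψ.symm v))).1) = 0 := by
    intro hv
    apply hA0
    have h1 : ∀ᶠ v in 𝓝 (Ψ y), u k (Φ (f (Ψ.symm v))).1 - u i (Φ (f (Ψ.symm v))).1 ≠ 0 := by
      refine ((huF k).sub (huF i)).continuousAt.eventually_ne ?_
      simp only [Pi.sub_apply, Ψ.left_inv hy]
      exact sub_ne_zero.2 (hne k i (Ne.symm hik) _ hfy)
    filter_upwards [hv, h1] with v e1 e2 e3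
    exact eq_zero_of_pow_eq_zero ((mul_eq_zero.1 (e1 e3)).resolve_right e2)
  have hmain : ∀ᶠ v in 𝓝 (Ψ y), v.1 ^ n i * c i v = v.1 ^ n k * c k v + v.1 ^ (t * a) *
      (A v ^ t * (u k (Φ (f (Ψ.symm v))).1 - u i (Φ (f (Ψ.symm v))).1)) := by
    filter_upwards [hck i, hck k, hxA] with v e1 e2 e3
    rw [← e1, ← e2, mul_comm t a, pow_mul, ← mul_assoc, ← mul_pow, ← e3]
    ring
  refine le_antisymm ?_ ?_
  · by_contra! hi
    have := order_le_of_fst_pow_mul_eq (m := t * a) (n := t * a + 1) hU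
      (w := fun v => v.1 ^ (n i - (t * a + 1)) * c i v - v.1 ^ (n k - (t * a + 1)) * c k v)
      (((analyticAt_fst.pow _).mul (hc i)).sub ((analyticAt_fst.pow _).mul (hc k))) (by
        filter_upwards [hmain] with v e1
        have p1 : v.1 ^ (t * a + 1) * v.1 ^ (n i - (t * a + 1)) = v.1 ^ n i := by
          rw [← pow_add, Nat.add_sub_cancel' hi]
        have p2 : v.1 ^ (t * a + 1) * v.1 ^ (n k - (t * a + 1)) = v.1 ^ n k := by
          rw [← pow_add, Nat.add_sub_cancel' hka]
        linear_combination -e1 - c i v * p1 + c k v * p2) hU0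
    omega
  · refine order_le_of_fst_pow_mul_eq (m := n i) (n := t * a) (hc i)
      (w := fun v => v.1 ^ (n k - t * a) * c k v + A v ^ t *
        (u k (Φ (f (Ψ.symm v))).1 - u i (Φ (f (Ψ.symm v))).1)) ?_ ?_ (hc0 i)
    · exact ((analyticAt_fst.pow _).mul (hc k)).add hU
    · filter_upwards [hmain] with v e1
      rw [e1, mul_add, ← mul_assoc (v.1 ^ (t * a)) (v.1 ^ (n k - t * a)), ← pow_add,
        Nat.add_sub_cancel' hka.le]

end

/-! ### The projective line and the monomial charts of the blow-up -/

open OnePoint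

/-- The affine coordinate on the projective line `ℂ ∪ {∞}`, with value `0` at `∞`. -/
noncomputable def affCoord (w : OnePoint ℂ) : ℂ := w.elim 0 id

/-- The inverse of the affine coordinate on the projective line, with value `0` at `0`. -/
noncomputable def invCoord (w : OnePoint ℂ) : ℂ := w.elim 0 fun z => z⁻¹

/-- The point of the projective line with affine coordinate `c⁻¹`. -/
noncomputable def coeInv (c : ℂ) : OnePoint ℂ :=
  open Classical in if c = 0 then infty else ((c⁻¹ : ℂ) : OnePoint ℂ)

@[simp] lemma affCoord_coe (z : ℂ) : affCoord z = z := rfl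

@[simp] lemma invCoord_coe (z : ℂ) : invCoord z = z⁻¹ := rfl

@[simp] lemma invCoord_infty : invCoord infty = 0 := rfl

@[simp] lemma coeInv_zero : coeInv 0 = infty := by simp [coeInv]

lemma coeInv_of_ne_zero {c : ℂ} (hc : c ≠ 0) : coeInv c = ((c⁻¹ : ℂ) : OnePoint ℂ) := by
  simp [coeInv, hc]

lemma coe_affCoord {w : OnePoint ℂ} (hw : w ≠ infty) : (affCoord w : OnePoint ℂ) = w := by
  lift w to ℂ using hw
  rfl

lemma coeInv_invCoord {w : OnePoint ℂ} (hw : w ≠ (0 : ℂ)) : coeInv (invCoord w) = w := by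
  induction w using OnePoint.rec with
  | infty => simp
  | coe z =>
    have : z ≠ 0 := fun h => hw (by rw [h])
    rw [invCoord_coe, coeInv_of_ne_zero (inv_ne_zero this), inv_inv]

lemma invCoord_coeInv (c : ℂ) : invCoord (coeInv c) = c := by
  by_cases hc : c = 0
  · simp [hc]
  · simp [coeInv_of_ne_zero hc]

lemma affCoord_coeInv (c : ℂ) : affCoord (coeInv c) = c⁻¹ := by
  by_cases hc : c = 0
  · simp [hc, affCoord]
  · simp [coeInv_of_ne_zero hc]

lemma coeInv_eq_infty_iff {c : ℂ} : coeInv c = infty ↔ c = 0 := by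
  by_cases hc : c = 0
  · simp [hc]
  · simp [coeInv_of_ne_zero hc, hc]

lemma coeInv_ne_zero (c : ℂ) : coeInv c ≠ (0 : ℂ) := by
  by_cases hc : c = 0
  · simp [hc]
  · rw [coeInv_of_ne_zero hc]
    simpa using hc

lemma continuousAt_affCoord {w : OnePoint ℂ} (hw : w ≠ infty) : ContinuousAt affCoord w := by
  lift w to ℂ using hw
  rw [OnePoint.continuousAt_coe]
  exact continuousAt_id

lemma continuousAt_invCoord {w : OnePoint ℂ} (hw : w ≠ (0 : ℂ)) : ContinuousAt invCoord w := by
  induction w using OnePoint.rec with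
  | infty =>
    rw [OnePoint.continuousAt_infty']
    have : Filter.Tendsto (fun z : ℂ => z⁻¹) (Filter.coclosedCompact ℂ) (𝓝 0) := by
      rw [Filter.coclosedCompact_eq_cocompact]
      exact Filter.tendsto_inv₀_cobounded.mono_left (by rw [Metric.cobounded_eq_cocompact])
    exact this
  | coe z =>
    have : z ≠ 0 := fun h => hw (by rw [h])
    rw [OnePoint.continuousAt_coe]
    exact continuousAt_inv₀ this

lemma continuous_coeInv : Continuous coeInv := by
  rw [continuous_iff_continuousAt]
  intro c
  by_cases hc : c = 0
  · subst hc
    rw [continuousAt_iff_punctured_nhds, coeInv_zero]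
    have h1 : Filter.Tendsto (fun z : ℂ => z⁻¹) (𝓝[≠] 0) (Filter.coclosedCompact ℂ) := by
      rw [Filter.coclosedCompact_eq_cocompact, ← Metric.cobounded_eq_cocompact]
      exact Filter.tendsto_inv₀_nhdsNE_zero
    refine (OnePoint.tendsto_coe_infty.comp h1).congr' ?_
    filter_upwards [self_mem_nhdsWithin] with z hz
    exact (coeInv_of_ne_zero hz).symm
  · have : ContinuousAt (fun z : ℂ => ((z⁻¹ : ℂ) : OnePoint ℂ)) c :=
      OnePoint.continuous_coe.continuousAt.comp (continuousAt_inv₀ hc)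
    refine this.congr ?_
    filter_upwards [isOpen_ne.mem_nhds hc] with z hz
    exact (coeInv_of_ne_zero hz).symm

/-- The relation `u = x * v` between points `u`, `v` of the projective line, in its homogeneous
form `u₀ * v₁ = x * v₀ * u₁`. -/
def IsMulRel (x : ℂ) (u v : OnePoint ℂ) : Prop :=
  (v = infty ∧ (x = 0 ∨ u = infty)) ∨ (v ≠ infty ∧ u = ((x * affCoord v : ℂ) : OnePoint ℂ))

lemma isMulRel_coe (x z : ℂ) : IsMulRel x ((x * z : ℂ) : OnePoint ℂ) z :=
  Or.inr ⟨by simp, rfl⟩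

lemma isMulRel_coeInv (x c : ℂ) : IsMulRel x (coeInv c) (coeInv (c * x)) := by
  by_cases hx : x = 0
  · exact Or.inl ⟨by simp [hx], Or.inl hx⟩
  by_cases hc : c = 0
  · exact Or.inl ⟨by simp [hc], Or.inr (by simp [hc])⟩
  · refine Or.inr ⟨by simp [coeInv_eq_infty_iff, hx, hc], ?_⟩
    rw [affCoord_coeInv, coeInv_of_ne_zero hc]
    congr 1
    field_simp

lemma isMulRel_coe_coeInv (a b : ℂ) : IsMulRel (a * b) (b : OnePoint ℂ) (coeInv a) := by
  by_cases ha : a = 0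
  · exact Or.inl ⟨by simp [ha], Or.inl (by simp [ha])⟩
  · refine Or.inr ⟨by simp [coeInv_eq_infty_iff, ha], ?_⟩
    rw [affCoord_coeInv]
    congr 1
    field_simp

lemma IsMulRel.eq_coe {x z : ℂ} {u : OnePoint ℂ} (h : IsMulRel x u z) :
    u = ((x * z : ℂ) : OnePoint ℂ) := by
  rcases h with ⟨h, -⟩ | ⟨-, h⟩
  · simp at h
  · exact h

lemma IsMulRel.eq_mul {x b : ℂ} {v : OnePoint ℂ} (h : IsMulRel x b v) (hv : v ≠ (0 : ℂ)) :
    x = invCoord v * b := by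
  rcases h with ⟨rfl, h | h⟩ | ⟨h1, h2⟩
  · simp [h]
  · simp at h
  · lift v to ℂ using h1
    rw [affCoord_coe, OnePoint.coe_eq_coe] at h2
    have : v ≠ 0 := fun h => hv (by rw [h])
    rw [h2, invCoord_coe]
    field_simp

lemma IsMulRel.eq_coeInv {x c : ℂ} {v : OnePoint ℂ} (h : IsMulRel x (coeInv c) v) :
    v = coeInv (c * x) := by
  rcases h with ⟨rfl, h | h⟩ | ⟨h1, h2⟩
  · simp [h]
  · rw [coeInv_eq_infty_iff] at h
    simp [h]
  · lift v to ℂ using h1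
    have hc : c ≠ 0 := by
      rintro rfl
      simp at h2
    rw [coeInv_of_ne_zero hc, affCoord_coe, OnePoint.coe_eq_coe] at h2
    have hx : x ≠ 0 := by
      rintro rfl
      rw [zero_mul, inv_eq_zero] at h2
      exact hc h2
    rw [coeInv_of_ne_zero (mul_ne_zero hc hx), mul_inv, h2, OnePoint.coe_eq_coe]
    field_simp

lemma isClosed_isMulRel :
    IsClosed {z : ℂ × OnePoint ℂ × OnePoint ℂ | IsMulRel z.1 z.2.1 z.2.2} := by
  rw [← isOpen_compl_iff, isOpen_iff_mem_nhds]
  rintro ⟨x, u, v⟩ hz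
  have hu : Continuous fun z : ℂ × OnePoint ℂ × OnePoint ℂ => z.2.1 := by fun_prop
  have hv : Continuous fun z : ℂ × OnePoint ℂ × OnePoint ℂ => z.2.2 := by fun_prop
  by_cases hv1 : v = infty
  · -- where `u ≠ infty` and `v ≠ 0` the relation reads `u * v⁻¹ = x`
    have hu1 : u ≠ infty := fun h => hz (Or.inl ⟨hv1, Or.inr h⟩)
    have hx : x ≠ 0 := fun h => hz (Or.inl ⟨hv1, Or.inl h⟩)
    have hv0 : v ≠ (0 : ℂ) := by rw [hv1]; simp
    have c1 : ContinuousAt (fun z : ℂ × OnePoint ℂ × OnePoint ℂ =>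
        invCoord z.2.2 * affCoord z.2.1) (x, u, v) :=
      (ContinuousAt.comp (x := (x, u, v)) (g := invCoord) (continuousAt_invCoord hv0)
        (f := fun z : ℂ × OnePoint ℂ × OnePoint ℂ => z.2.2) hv.continuousAt).mul
      (ContinuousAt.comp (x := (x, u, v)) (g := affCoord) (continuousAt_affCoord hu1)
        (f := fun z : ℂ × OnePoint ℂ × OnePoint ℂ => z.2.1) hu.continuousAt)
    have c2 := continuousAt_fst (p := (x, u, v))
    have hne := (c2.ne_iff_eventually_ne c1).1 (by simpa [hv1] using hx)
    filter_upwards [hne, hu.continuousAt.eventually_ne hu1, hv.continuousAt.eventually_ne hv0]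
      with z h1 h2 h3 h4
    have h4 : IsMulRel z.1 z.2.1 z.2.2 := h4
    rw [← coe_affCoord h2] at h4
    exact h1 (h4.eq_mul h3)
  · have c1 : ContinuousAt (fun z : ℂ × OnePoint ℂ × OnePoint ℂ =>
        ((z.1 * affCoord z.2.2 : ℂ) : OnePoint ℂ)) (x, u, v) :=
      OnePoint.continuous_coe.continuousAt.comp
        (f := fun z : ℂ × OnePoint ℂ × OnePoint ℂ => z.1 * affCoord z.2.2)
        (continuousAt_fst.mul (ContinuousAt.comp (x := (x, u, v)) (g := affCoord)
          (continuousAt_affCoord hv1) (f := fun z : ℂ × OnePoint ℂ × OnePoint ℂ => z.2.2)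
          hv.continuousAt))
    have hne := (hu.continuousAt.ne_iff_eventually_ne c1).1 fun h => hz (Or.inr ⟨hv1, h⟩)
    filter_upwards [hne, hv.continuousAt.eventually_ne hv1] with z h1 h2 h3
    rcases h3 with ⟨h3, -⟩ | ⟨-, h3⟩
    · exact h2 h3
    · exact h1 h3

/-- The monomial expression of the coordinate `x` in the `i`-th chart of the `t`-fold blow-up. -/
noncomputable def chartX (t i : ℕ) (v : ℂ × ℂ) : ℂ := if i < t then v.1 * v.2 else v.1

/-- The expression of the blow-up map `(x, y)` in its `i`-th chart. -/
noncomputable def chartXY (t i : ℕ) (v : ℂ × ℂ) : ℂ × ℂ :=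
  (chartX t i v, v.2 * chartX t i v ^ i)

/-- The expression of `y / x ^ k` in the `i`-th chart; the value for `k > t` is
irrelevant and set to `∞`. -/
noncomputable def chartW (t i : ℕ) (v : ℂ × ℂ) (k : ℕ) : OnePoint ℂ :=
  if k ≤ i then ((v.2 * chartX t i v ^ (i - k) : ℂ) : OnePoint ℂ)
  else if k ≤ t then coeInv (v.1 * chartX t i v ^ (k - (i + 1))) else infty

lemma contDiff_chartX (t i : ℕ) : ContDiff ℂ ω (chartX t i) := by
  unfold chartX
  split_ifs <;> fun_prop

lemma contDiff_chartXY (t i : ℕ) : ContDiff ℂ ω (chartXY t i) := by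
  have := contDiff_chartX t i
  unfold chartXY
  fun_prop

lemma continuous_chartW (t i k : ℕ) : Continuous fun v => chartW t i v k := by
  have h := (contDiff_chartX t i).continuous
  unfold chartW
  split_ifs
  · exact OnePoint.continuous_coe.comp (by fun_prop)
  · exact continuous_coeInv.comp (by fun_prop)
  · exact continuous_const

lemma chartW_of_le {t i k : ℕ} (hk : k ≤ i) (v : ℂ × ℂ) :
    chartW t i v k = ((v.2 * chartX t i v ^ (i - k) : ℂ) : OnePoint ℂ) := if_pos hk

lemma chartW_of_lt {t i k : ℕ} (hi : i < k) (hk : k ≤ t) (v : ℂ × ℂ) :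
    chartW t i v k = coeInv (v.1 * chartX t i v ^ (k - (i + 1))) := by
  rw [chartW, if_neg (by omega), if_pos hk]

lemma isMulRel_chartW {t i : ℕ} (hi : i ≤ t) (v : ℂ × ℂ) {k : ℕ} (hk : k < t) :
    IsMulRel (chartX t i v) (chartW t i v k) (chartW t i v (k + 1)) := by
  rcases lt_trichotomy k i with h | h | h
  · rw [chartW_of_le h.le, chartW_of_le h]
    have : v.2 * chartX t i v ^ (i - k) = chartX t i v * (v.2 * chartX t i v ^ (i - (k + 1))) := by
      rw [show i - k = i - (k + 1) + 1 by omega]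
      ring
    rw [this]
    exact isMulRel_coe _ _
  · subst h
    rw [chartW_of_le le_rfl, chartW_of_lt (Nat.lt_succ_self k) hk]
    simpa [chartX, hk] using isMulRel_coe_coeInv v.1 v.2
  · rw [chartW_of_lt h hk.le, chartW_of_lt (h.trans (Nat.lt_succ_self k)) hk]
    have : v.1 * chartX t i v ^ (k + 1 - (i + 1)) =
        v.1 * chartX t i v ^ (k - (i + 1)) * chartX t i v := by
      rw [show k + 1 - (i + 1) = k - (i + 1) + 1 by omega]
      ring
    rw [this]
    exact isMulRel_coeInv _ _

lemma chartW_zero (t i : ℕ) (v : ℂ × ℂ) : chartW t i v 0 = ((chartXY t i v).2 : ℂ) := by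
  simp [chartW, chartXY]

lemma chartW_of_gt {t i k : ℕ} (hi : i ≤ t) (hk : t < k) (v : ℂ × ℂ) : chartW t i v k = infty := by
  rw [chartW, if_neg (by omega), if_neg (by omega)]

lemma chartW_self (t i : ℕ) (v : ℂ × ℂ) : chartW t i v i = (v.2 : ℂ) := by
  simp [chartW]

lemma chartW_succ {t i : ℕ} (hi : i < t) (v : ℂ × ℂ) : chartW t i v (i + 1) = coeInv v.1 := by
  rw [chartW, if_neg (by omega), if_pos (by omega)]
  simp

lemma contDiffAt_affCoord_chartW {t i k : ℕ} {v : ℂ × ℂ} (h : chartW t i v k ≠ infty) :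
    ContDiffAt ℂ ω (fun v => affCoord (chartW t i v k)) v := by
  have hX := (contDiff_chartX t i).contDiffAt (x := v)
  unfold chartW at h ⊢
  split_ifs at h ⊢ with h1 h2
  · simp only [affCoord_coe]
    fun_prop
  · simp only [affCoord_coeInv]
    rw [Ne, coeInv_eq_infty_iff] at h
    exact ContDiffAt.inv (by fun_prop) h
  · exact absurd rfl h

lemma contDiffAt_invCoord_chartW {t i k : ℕ} {v : ℂ × ℂ} (h : chartW t i v k ≠ (0 : ℂ)) :
    ContDiffAt ℂ ω (fun v => invCoord (chartW t i v k)) v := by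
  have hX := (contDiff_chartX t i).contDiffAt (x := v)
  unfold chartW at h ⊢
  split_ifs at h ⊢ with h1 h2
  · simp only [invCoord_coe]
    exact ContDiffAt.inv (by fun_prop) (by simpa using h)
  · simp only [invCoord_coeInv]
    fun_prop
  · exact contDiffAt_const

/-! ### The iterated blow-up -/

section

variable {U : Type u} [TopologicalSpace U] [ChartedSpace (ℂ × ℂ) U]

variable (U) in
/-- A holomorphic coordinate system `(x, y)` on a whole surface, with the origin in its image. -/
structure GlobalChart where
  /-- the coordinate map -/
  toChart : OpenPartialHomeomorph U (ℂ × ℂ)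
  isHolChart : IsHolChart toChart
  source_eq : toChart.source = Set.univ
  zero_mem : (0 : ℂ × ℂ) ∈ toChart.target

variable (c : GlobalChart U) (t : ℕ)

/-- The surface obtained from `U` by blowing up the origin and then `t - 1` times the point of the
last exceptional curve that lies on the strict transform of `{y = 0}`. It is realised as the closed
set of the pairs `(q, w)` with `w 0 = y` and `w k = x * w (k + 1)` for `k < t`, so that the point
`w k` of the projective line stands for `y / x ^ k`; the components with `k > t` are not used and
set to `∞`. -/
def Tower : Type u :=
  {P : U × (ℕ → OnePoint ℂ) // P.2 0 = ((c.toChart P.1).2 : ℂ) ∧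
    (∀ k < t, IsMulRel (c.toChart P.1).1 (P.2 k) (P.2 (k + 1))) ∧ ∀ k, t < k → P.2 k = infty}

noncomputable instance : TopologicalSpace (Tower c t) := instTopologicalSpaceSubtype

instance [T2Space U] : T2Space (Tower c t) :=
  inferInstanceAs (T2Space {_P : U × (ℕ → OnePoint ℂ) // _})

namespace Tower

variable {c t}

/-- The blow-up map to `U`. -/
def proj (P : Tower c t) : U := P.1.1

/-- The pullback of the first coordinate. -/
noncomputable def x (P : Tower c t) : ℂ := (c.toChart P.proj).1

/-- The pullback of the second coordinate. -/
noncomputable def y (P : Tower c t) : ℂ := (c.toChart P.proj).2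

/-- The function `y / x ^ k` with values in the projective line. -/
def w (P : Tower c t) (k : ℕ) : OnePoint ℂ := P.1.2 k

lemma w_zero (P : Tower c t) : P.w 0 = (P.y : ℂ) := P.2.1

lemma isMulRel (P : Tower c t) {k : ℕ} (hk : k < t) : IsMulRel P.x (P.w k) (P.w (k + 1)) :=
  P.2.2.1 k hk

lemma w_of_gt (P : Tower c t) {k : ℕ} (hk : t < k) : P.w k = infty := P.2.2.2 k hk

lemma continuous_proj : Continuous (proj : Tower c t → U) :=
  continuous_fst.comp continuous_subtype_val

lemma continuous_w (k : ℕ) : Continuous fun P : Tower c t => P.w k :=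
  (continuous_apply k).comp (continuous_snd.comp continuous_subtype_val)

lemma continuous_coord : Continuous fun P : Tower c t => c.toChart P.proj := by
  have h : Continuous c.toChart := by
    rw [← continuousOn_univ, ← c.source_eq]
    exact c.toChart.continuousOn
  exact h.comp continuous_proj

lemma continuous_x : Continuous (x : Tower c t → ℂ) := continuous_fst.comp continuous_coord

@[ext] lemma ext {P Q : Tower c t} (h1 : P.proj = Q.proj) (h2 : ∀ k, P.w k = Q.w k) : P = Q :=
  Subtype.ext (Prod.ext h1 (funext h2))

lemma proj_mem_source (P : Tower c t) : P.proj ∈ c.toChart.source := by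
  rw [c.source_eq]
  trivial

/-- The blow-up map is proper: the surface is a closed subset of a product with a compact factor. -/
lemma isProperMap_proj : IsProperMap (proj : Tower c t → U) := by
  have h : Continuous c.toChart := by
    rw [← continuousOn_univ, ← c.source_eq]
    exact c.toChart.continuousOn
  have hcl : IsClosed {P : U × (ℕ → OnePoint ℂ) | P.2 0 = ((c.toChart P.1).2 : ℂ) ∧
      (∀ k < t, IsMulRel (c.toChart P.1).1 (P.2 k) (P.2 (k + 1))) ∧
      ∀ k, t < k → P.2 k = infty} := by
    have heq : {P : U × (ℕ → OnePoint ℂ) | P.2 0 = ((c.toChart P.1).2 : ℂ) ∧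
        (∀ k < t, IsMulRel (c.toChart P.1).1 (P.2 k) (P.2 (k + 1))) ∧
        ∀ k, t < k → P.2 k = infty} =
        {P : U × (ℕ → OnePoint ℂ) | P.2 0 = ((c.toChart P.1).2 : ℂ)} ∩
        ((⋂ (k : ℕ) (_ : k < t),
          {P : U × (ℕ → OnePoint ℂ) | IsMulRel (c.toChart P.1).1 (P.2 k) (P.2 (k + 1))}) ∩
        ⋂ (k : ℕ) (_ : t < k), {P : U × (ℕ → OnePoint ℂ) | P.2 k = infty}) := by
      ext P
      simp
    rw [heq]
    refine IsClosed.inter ?_ (IsClosed.inter ?_ ?_)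
    · exact isClosed_eq (by fun_prop) (OnePoint.continuous_coe.comp (by fun_prop))
    · refine isClosed_iInter fun k => isClosed_iInter fun _ => ?_
      exact isClosed_isMulRel.preimage (f := fun P : U × (ℕ → OnePoint ℂ) =>
        ((c.toChart P.1).1, P.2 k, P.2 (k + 1))) (by fun_prop)
    · refine isClosed_iInter fun k => isClosed_iInter fun _ => ?_
      exact isClosed_eq (by fun_prop) continuous_const
  exact isProperMap_fst_of_compactSpace.comp hcl.isClosedEmbedding_subtypeVal.isProperMap

/-- The point with the coordinates `v` in the `i`-th chart. -/
noncomputable def mk {i : ℕ} (hi : i ≤ t) (v : ℂ × ℂ) (hv : chartXY t i v ∈ c.toChart.target) :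
    Tower c t :=
  ⟨(c.toChart.symm (chartXY t i v), chartW t i v), by
    simp only [c.toChart.right_inv hv]
    exact ⟨chartW_zero t i v, fun k hk => isMulRel_chartW hi v hk,
      fun k hk => chartW_of_gt hi hk v⟩⟩

lemma coord_mk {i : ℕ} (hi : i ≤ t) (v : ℂ × ℂ) (hv : chartXY t i v ∈ c.toChart.target) :
    c.toChart (mk hi v hv).proj = chartXY t i v := c.toChart.right_inv hv

lemma x_mk {i : ℕ} (hi : i ≤ t) (v : ℂ × ℂ) (hv : chartXY t i v ∈ c.toChart.target) :
    (mk hi v hv).x = chartX t i v := by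
  rw [x, coord_mk]
  rfl

lemma w_mk {i : ℕ} (hi : i ≤ t) (v : ℂ × ℂ) (hv : chartXY t i v ∈ c.toChart.target) (k : ℕ) :
    (mk hi v hv).w k = chartW t i v k := rfl

/-- The coordinates of the `i`-th chart: `(x ^ (i + 1) / y, y / x ^ i)` for `i < t` and
`(x, y / x ^ t)` for `i = t`. -/
noncomputable def chartFun (i : ℕ) (P : Tower c t) : ℂ × ℂ :=
  (if i < t then invCoord (P.w (i + 1)) else P.x, affCoord (P.w i))

/-- The domain of the `i`-th chart. -/
def chartSource (c : GlobalChart U) (t i : ℕ) : Set (Tower c t) :=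
  {P | P.w i ≠ infty ∧ (i < t → P.w (i + 1) ≠ (0 : ℂ))}

lemma chartX_chartFun {i : ℕ} {P : Tower c t} (hP : P ∈ chartSource c t i) :
    chartX t i (chartFun i P) = P.x := by
  by_cases h : i < t
  · have h1 := P.isMulRel h
    rw [← coe_affCoord hP.1] at h1
    simp only [chartX, chartFun, if_pos h]
    exact (h1.eq_mul (hP.2 h)).symm
  · simp only [chartX, chartFun, if_neg h]

lemma chartW_chartFun {i : ℕ} (hi : i ≤ t) {P : Tower c t} (hP : P ∈ chartSource c t i) (k : ℕ) :
    chartW t i (chartFun i P) k = P.w k := by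
  have hX := chartX_chartFun hP
  rcases le_or_gt k i with hk | hk
  · rw [chartW_of_le hk, hX]
    have hdown : ∀ n ≤ i, ((((chartFun i P).2 * P.x ^ n : ℂ)) : OnePoint ℂ) = P.w (i - n) := by
      intro n
      induction n with
      | zero =>
        intro _
        simpa [chartFun] using coe_affCoord hP.1
      | succ n ih =>
        intro hn
        have h1 := P.isMulRel (k := i - (n + 1)) (by omega)
        rw [show i - (n + 1) + 1 = i - n by omega, ← ih (by omega)] at h1
        rw [h1.eq_coe]
        congr 1
        ring
    rw [hdown _ (by omega), show i - (i - k) = k by omega]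
  rcases le_or_gt k t with hkt | hkt
  · rw [chartW_of_lt hk hkt, hX]
    have hup : ∀ n, i + 1 + n ≤ t →
        coeInv ((chartFun i P).1 * P.x ^ n) = P.w (i + 1 + n) := by
      intro n
      induction n with
      | zero =>
        intro h
        have h : i < t := by omega
        simp only [chartFun, if_pos h, pow_zero, mul_one, add_zero]
        exact coeInv_invCoord (hP.2 h)
      | succ n ih =>
        intro hn
        have h1 := P.isMulRel (k := i + 1 + n) (by omega)
        rw [← ih (by omega)] at h1
        rw [← add_assoc, h1.eq_coeInv, pow_succ, mul_assoc]
    rw [hup _ (by omega), show i + 1 + (k - (i + 1)) = k by omega]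
  · rw [chartW_of_gt hi hkt, P.w_of_gt hkt]

lemma chartXY_chartFun {i : ℕ} (hi : i ≤ t) {P : Tower c t} (hP : P ∈ chartSource c t i) :
    chartXY t i (chartFun i P) = c.toChart P.proj := by
  refine Prod.ext (chartX_chartFun hP) ?_
  have h := chartW_chartFun hi hP 0
  rw [chartW_zero, P.w_zero, OnePoint.coe_eq_coe] at h
  exact h

lemma chartFun_mk {i : ℕ} (hi : i ≤ t) (v : ℂ × ℂ) (hv : chartXY t i v ∈ c.toChart.target) :
    chartFun i (mk hi v hv) = v := by
  refine Prod.ext ?_ ?_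
  · by_cases h : i < t
    · simp only [chartFun, if_pos h, w_mk, chartW_succ h, invCoord_coeInv]
    · simp only [chartFun, if_neg h, x_mk, chartX]
  · simp only [chartFun, w_mk, chartW_self, affCoord_coe]

lemma mk_mem_chartSource {i : ℕ} (hi : i ≤ t) (v : ℂ × ℂ)
    (hv : chartXY t i v ∈ c.toChart.target) : mk hi v hv ∈ chartSource c t i := by
  refine ⟨?_, fun h => ?_⟩
  · rw [w_mk, chartW_self]
    simp
  · rw [w_mk, chartW_succ h]
    exact coeInv_ne_zero _

lemma zero_mem_target (i : ℕ) : chartXY t i 0 ∈ c.toChart.target := by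
  have : chartXY t i 0 = 0 := by simp [chartXY, chartX]
  rw [this]
  exact c.zero_mem

open Classical in
/-- The `i`-th chart of the blown-up surface. -/
noncomputable def chart (c : GlobalChart U) {t i : ℕ} (hi : i ≤ t) :
    OpenPartialHomeomorph (Tower c t) (ℂ × ℂ) where
  toFun := chartFun i
  invFun v := if hv : chartXY t i v ∈ c.toChart.target then mk hi v hv
    else mk hi 0 (zero_mem_target i)
  source := chartSource c t i
  target := chartXY t i ⁻¹' c.toChart.target
  map_source' P hP := by
    rw [Set.mem_preimage, chartXY_chartFun hi hP]
    exact c.toChart.map_source P.proj_mem_source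
  map_target' v hv := by
    have hv : chartXY t i v ∈ c.toChart.target := hv
    rw [dif_pos hv]
    exact mk_mem_chartSource hi v hv
  left_inv' P hP := by
    have hv : chartXY t i (chartFun i P) ∈ c.toChart.target := by
      rw [chartXY_chartFun hi hP]
      exact c.toChart.map_source P.proj_mem_source
    rw [dif_pos hv]
    refine ext (c.toChart.injOn (proj_mem_source _) P.proj_mem_source ?_) fun k => ?_
    · rw [coord_mk, chartXY_chartFun hi hP]
    · rw [w_mk, chartW_chartFun hi hP]
  right_inv' v hv := by
    have hv : chartXY t i v ∈ c.toChart.target := hv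
    rw [dif_pos hv]
    exact chartFun_mk hi v hv
  open_source := by
    have h1 : IsOpen {P : Tower c t | P.w i ≠ infty} :=
      isOpen_ne_fun (continuous_w i) continuous_const
    have h2 : IsOpen {P : Tower c t | i < t → P.w (i + 1) ≠ (0 : ℂ)} := by
      by_cases h : i < t
      · simpa [h] using isOpen_ne_fun (continuous_w (c := c) (t := t) (i + 1)) continuous_const
      · simp [h]
    exact h1.inter h2
  open_target := c.toChart.open_target.preimage (contDiff_chartXY t i).continuous
  continuousOn_toFun := by
    intro P hP
    refine ContinuousAt.continuousWithinAt (ContinuousAt.prodMk ?_ ?_)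
    · by_cases h : i < t
      · simp only [if_pos h]
        exact ContinuousAt.comp (g := invCoord) (f := fun P : Tower c t => P.w (i + 1))
          (continuousAt_invCoord (hP.2 h)) (continuous_w _).continuousAt
      · simp only [if_neg h]
        exact continuous_x.continuousAt
    · exact ContinuousAt.comp (g := affCoord) (f := fun P : Tower c t => P.w i)
        (continuousAt_affCoord hP.1) (continuous_w _).continuousAt
  continuousOn_invFun := by
    have hind : Topology.IsInducing (fun P : Tower c t => P.1) := ⟨rfl⟩
    rw [hind.continuousOn_iff]
    have h1 : ContinuousOn (fun v => (c.toChart.symm (chartXY t i v), chartW t i v))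
        (chartXY t i ⁻¹' c.toChart.target) := by
      refine ContinuousOn.prodMk ?_ ?_
      · exact c.toChart.continuousOn_symm.comp (contDiff_chartXY t i).continuous.continuousOn
          fun v hv => hv
      · exact (continuous_pi fun k => continuous_chartW t i k).continuousOn
    refine h1.congr fun v hv => ?_
    have hv : chartXY t i v ∈ c.toChart.target := hv
    simp only [Function.comp, dif_pos hv]
    rfl

lemma mem_chart_source_iff {i : ℕ} (hi : i ≤ t) {P : Tower c t} : P ∈ (chart c hi).source ↔
    P.w i ≠ infty ∧ (i < t → P.w (i + 1) ≠ (0 : ℂ)) := Iff.rfl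

lemma mem_chart_target_iff {i : ℕ} (hi : i ≤ t) {v : ℂ × ℂ} :
    v ∈ (chart c hi).target ↔ chartXY t i v ∈ c.toChart.target := Iff.rfl

lemma chart_apply {i : ℕ} (hi : i ≤ t) (P : Tower c t) : chart c hi P = chartFun i P := rfl

lemma chart_symm_apply {i : ℕ} (hi : i ≤ t) {v : ℂ × ℂ} (hv : v ∈ (chart c hi).target) :
    (chart c hi).symm v = mk hi v ((mem_chart_target_iff hi).1 hv) :=
  dif_pos ((mem_chart_target_iff hi).1 hv)

lemma coord_chart_symm {i : ℕ} (hi : i ≤ t) {v : ℂ × ℂ} (hv : v ∈ (chart c hi).target) :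
    c.toChart ((chart c hi).symm v).proj = chartXY t i v := by
  rw [chart_symm_apply hi hv, coord_mk]

lemma w_chart_symm {i : ℕ} (hi : i ≤ t) {v : ℂ × ℂ} (hv : v ∈ (chart c hi).target) (k : ℕ) :
    ((chart c hi).symm v).w k = chartW t i v k := by
  rw [chart_symm_apply hi hv, w_mk]

lemma x_chart_symm {i : ℕ} (hi : i ≤ t) {v : ℂ × ℂ} (hv : v ∈ (chart c hi).target) :
    ((chart c hi).symm v).x = chartX t i v := by
  rw [chart_symm_apply hi hv, x_mk]

open Classical in
/-- The largest `i ≤ t` for which `y / x ^ i` is finite at `P`. -/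
noncomputable def index (P : Tower c t) : ℕ := Nat.findGreatest (fun i => P.w i ≠ infty) t

lemma index_le (P : Tower c t) : P.index ≤ t := by
  classical
  exact Nat.findGreatest_le t

lemma w_index_ne (P : Tower c t) : P.w P.index ≠ infty := by
  classical
  refine Nat.findGreatest_spec (P := fun i => P.w i ≠ infty) (Nat.zero_le t) ?_
  rw [w_zero]
  simp

lemma w_of_index_lt (P : Tower c t) {k : ℕ} (hk : P.index < k) : P.w k = infty := by
  classical
  by_contra h
  rcases le_or_gt k t with hkt | hkt
  · exact Nat.findGreatest_is_greatest (P := fun i => P.w i ≠ infty) hk hkt h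
  · exact h (P.w_of_gt hkt)

lemma mem_chart_index_source (P : Tower c t) : P ∈ (chart c P.index_le).source := by
  refine ⟨P.w_index_ne, fun _ => ?_⟩
  rw [P.w_of_index_lt (Nat.lt_succ_self _)]
  simp

noncomputable instance : ChartedSpace (ℂ × ℂ) (Tower c t) where
  atlas := {e | ∃ (i : ℕ) (hi : i ≤ t), e = chart c hi}
  chartAt P := chart c P.index_le
  mem_chart_source P := P.mem_chart_index_source
  chart_mem_atlas P := ⟨_, P.index_le, rfl⟩

instance : IsManifold 𝓘(ℂ, ℂ × ℂ) ω (Tower c t) := by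
  refine isManifold_of_contDiffOn _ _ _ ?_
  rintro e e' ⟨i, hi, rfl⟩ ⟨j, hj, rfl⟩
  intro v hv
  simp only [modelWithCornersSelf_coe_symm, Set.preimage_id, modelWithCornersSelf_coe,
    Set.range_id, Set.inter_univ, Function.comp_id, Function.id_comp] at hv ⊢
  rw [OpenPartialHomeomorph.trans_source, Set.mem_inter_iff, OpenPartialHomeomorph.symm_source,
    Set.mem_preimage] at hv
  obtain ⟨hv, hv'⟩ := hv
  rw [mem_chart_source_iff, w_chart_symm hi hv, w_chart_symm hi hv] at hv'
  have hev : (fun v => (if j < t then invCoord (chartW t i v (j + 1)) else chartX t i v,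
      affCoord (chartW t i v j))) =ᶠ[𝓝 v] ((chart c hi).symm.trans (chart c hj)) := by
    filter_upwards [(chart c hi).open_target.mem_nhds hv] with v' hv'
    rw [OpenPartialHomeomorph.trans_apply, chart_apply, chartFun, w_chart_symm hi hv',
      w_chart_symm hi hv', x_chart_symm hi hv']
  refine ContDiffAt.contDiffWithinAt (ContDiffAt.congr_of_eventuallyEq ?_ hev.symm)
  refine ContDiffAt.prodMk ?_ (contDiffAt_affCoord_chartW hv'.1)
  split_ifs with h
  · exact contDiffAt_invCoord_chartW (hv'.2 h)
  · exact (contDiff_chartX t i).contDiffAt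

lemma isHolChart_chart {i : ℕ} (hi : i ≤ t) : IsHolChart (chart c hi) := by
  have h : chart c hi ∈ IsManifold.maximalAtlas 𝓘(ℂ, ℂ × ℂ) ω (Tower c t) :=
    IsManifold.subset_maximalAtlas ⟨i, hi, rfl⟩
  exact ⟨contMDiffOn_of_mem_maximalAtlas h, contMDiffOn_symm_of_mem_maximalAtlas h⟩

lemma contMDiff_coord : ContMDiff 𝓘(ℂ, ℂ × ℂ) 𝓘(ℂ, ℂ × ℂ) ω
    fun P : Tower c t => c.toChart P.proj := by
  intro P
  have h1 : ContMDiffAt 𝓘(ℂ, ℂ × ℂ) 𝓘(ℂ, ℂ × ℂ) ω (chartXY t P.index ∘ chart c P.index_le) P :=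
    ContMDiffAt.comp P (contDiff_chartXY t P.index).contDiffAt.contMDiffAt
      ((isHolChart_chart P.index_le).contMDiffAt P.mem_chart_index_source)
  refine h1.congr_of_eventuallyEq ?_
  filter_upwards [(chart c P.index_le).open_source.mem_nhds P.mem_chart_index_source] with Q hQ
  exact (chartXY_chartFun P.index_le hQ).symm

lemma contMDiff_proj : ContMDiff 𝓘(ℂ, ℂ × ℂ) 𝓘(ℂ, ℂ × ℂ) ω (proj : Tower c t → U) := by
  intro P
  have h1 : ContMDiffAt 𝓘(ℂ, ℂ × ℂ) 𝓘(ℂ, ℂ × ℂ) ω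
      (c.toChart.symm ∘ fun P : Tower c t => c.toChart P.proj) P :=
    ContMDiffAt.comp P (c.isHolChart.contMDiffAt_symm (c.toChart.map_source P.proj_mem_source))
      (contMDiff_coord P)
  refine h1.congr_of_eventuallyEq (Filter.Eventually.of_forall fun Q => ?_)
  exact (c.toChart.left_inv Q.proj_mem_source).symm

end Tower

end

/-! ### The exceptional curves -/

section

variable {X : Type u} [TopologicalSpace X] [ChartedSpace (ℂ × ℂ) X]
variable {Y : Type u} [TopologicalSpace Y] [ChartedSpace (ℂ × ℂ) Y]

/-- A map whose local expression in holomorphic charts is the identity is a local isomorphism. -/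
lemma IsHolChart.isLocalDiffeomorphAt_of_eq {Φ : OpenPartialHomeomorph X (ℂ × ℂ)}
    (hΦ : IsHolChart Φ) {Ψ : OpenPartialHomeomorph Y (ℂ × ℂ)} (hΨ : IsHolChart Ψ) {f : Y → X}
    {y : Y} (hy : y ∈ Ψ.source) (h : ∀ x ∈ Ψ.source, f x ∈ Φ.source ∧ Φ (f x) = Ψ x) :
    IsLocalDiffeomorphAt 𝓘(ℂ, ℂ × ℂ) 𝓘(ℂ, ℂ × ℂ) ω f y := by
  let P : PartialDiffeomorph 𝓘(ℂ, ℂ × ℂ) 𝓘(ℂ, ℂ × ℂ) Y (ℂ × ℂ) ω :=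
    ⟨Ψ.toPartialEquiv, Ψ.open_source, Ψ.open_target, hΨ.1, hΨ.2⟩
  let Q : PartialDiffeomorph 𝓘(ℂ, ℂ × ℂ) 𝓘(ℂ, ℂ × ℂ) X (ℂ × ℂ) ω :=
    ⟨Φ.toPartialEquiv, Φ.open_source, Φ.open_target, hΦ.1, hΦ.2⟩
  refine ⟨P.trans Q.symm, ?_, ?_⟩
  · refine ⟨hy, ?_⟩
    change Ψ y ∈ Φ.target
    rw [← (h y hy).2]
    exact Φ.map_source (h y hy).1
  · rintro x ⟨hx, -⟩
    have hx : x ∈ Ψ.source := hx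
    change f x = Φ.symm (Ψ x)
    rw [← (h x hx).2, Φ.left_inv (h x hx).1]

/-- Coordinates adapted to a graph through a given point. -/
lemma IsHolChart.isLocalDiffeomorphAt_shear {Φ : OpenPartialHomeomorph X (ℂ × ℂ)}
    (hΦ : IsHolChart Φ) {q : X} (hq : q ∈ Φ.source) {g : ℂ → ℂ} (hg : AnalyticAt ℂ g (Φ q).1) :
    IsLocalDiffeomorphAt 𝓘(ℂ, ℂ × ℂ) 𝓘(ℂ, ℂ × ℂ) ω
      (fun x => ((Φ x).1 - (Φ q).1, (Φ x).2 - g (Φ x).1)) q := by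
  have ha : AnalyticAt ℂ (fun v : ℂ × ℂ => v.2 - g v.1) (Φ q) :=
    analyticAt_snd.sub (hg.comp analyticAt_fst)
  obtain ⟨Φ', hΦ', hq', -, he⟩ := exists_isHolChart hΦ hq
    (G := fun v => (v.1 - (Φ q).1, v.2 - g v.1))
    ((analyticAt_fst.sub analyticAt_const).prod ha) (by
      rw [det_fderiv_prodMk (differentiableAt_fst.sub_const _) ha.differentiableAt,
        (hasFDerivAt_snd_sub_comp_fst hg).fderiv, fderiv_sub_const, fderiv_fst]
      simp)
  have := hΦ'.isLocalDiffeomorphAt hq'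
  rwa [show (Φ' : X → ℂ × ℂ) = fun x => ((Φ x).1 - (Φ q).1, (Φ x).2 - g (Φ x).1) from
    funext he] at this

/-- A coordinate line of a holomorphic chart is a smooth curve. -/
lemma IsHolChart.isSmoothCurveAt [IsManifold 𝓘(ℂ, ℂ × ℂ) ω X]
    {Φ : OpenPartialHomeomorph X (ℂ × ℂ)} (hΦ : IsHolChart Φ) {q : X} (hq : q ∈ Φ.source)
    {ℓ : (ℂ × ℂ) →L[ℂ] ℂ} (hℓ : ℓ ≠ 0) {E : Set X} (h0 : ℓ (Φ q) = 0)
    (hE : ∀ᶠ x in 𝓝 q, x ∈ E ↔ ℓ (Φ x) = 0) : IsSmoothCurveAt E q := by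
  have hh : HolomorphicAt (fun x => ℓ (Φ x)) q := hΦ.holomorphicAt_comp hq (ℓ.analyticAt _)
  refine ⟨fun x => ℓ (Φ x), hh, h0, ?_, hE⟩
  rw [mfderiv_eq_fderiv_chartAt hh]
  have hc := isHolChart_chartAt q
  have hqc := mem_chart_source (ℂ × ℂ) q
  have h1 := hc.analyticAt_comp_symm hΦ hqc hq
  have h2 := hc.det_fderiv_comp_symm_ne_zero hΦ hqc hq
  have h3 : fderiv ℂ ((fun x => ℓ (Φ x)) ∘ (chartAt (ℂ × ℂ) q).symm) (chartAt (ℂ × ℂ) q q) =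
      ℓ.comp (fderiv ℂ (Φ ∘ (chartAt (ℂ × ℂ) q).symm) (chartAt (ℂ × ℂ) q q)) :=
    (ℓ.hasFDerivAt.comp _ h1.differentiableAt.hasFDerivAt).fderiv
  rw [h3]
  intro h4
  apply hℓ
  set L := (fderiv ℂ (Φ ∘ (chartAt (ℂ × ℂ) q).symm) (chartAt (ℂ × ℂ) q
    q)).toContinuousLinearEquivOfDetNeZero h2 with hL
  refine ContinuousLinearMap.ext fun v => ?_
  have h5 : ℓ ((fderiv ℂ (Φ ∘ (chartAt (ℂ × ℂ) q).symm) (chartAt (ℂ × ℂ) q q)) (L.symm v)) = 0 :=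
    DFunLike.congr_fun h4 (L.symm v)
  have h6 : (fderiv ℂ (Φ ∘ (chartAt (ℂ × ℂ) q).symm) (chartAt (ℂ × ℂ) q q)) (L.symm v) = v :=
    L.apply_symm_apply v
  rwa [h6] at h5

end

lemma det_fderiv_chartXY_self (t : ℕ) (v : ℂ × ℂ) :
    (fderiv ℂ (chartXY t t) v).det = v.1 ^ t := by
  have h : chartXY t t = fun v => (v.1, v.2 * v.1 ^ t) := by
    funext v
    simp [chartXY, chartX]
  have h2 : HasFDerivAt (fun v : ℂ × ℂ => v.2 * v.1 ^ t) (v.2 • ((t * v.1 ^ (t - 1)) •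
      ContinuousLinearMap.fst ℂ ℂ ℂ) + v.1 ^ t • ContinuousLinearMap.snd ℂ ℂ ℂ) v := by
    have h3 : HasFDerivAt (fun v : ℂ × ℂ => v.1 ^ t)
        ((t * v.1 ^ (t - 1)) • ContinuousLinearMap.fst ℂ ℂ ℂ) v := by
      simpa using (hasFDerivAt_fst (𝕜 := ℂ) (p := v)).pow t
    exact hasFDerivAt_snd.mul h3
  rw [h, det_fderiv_prodMk differentiableAt_fst h2.differentiableAt, h2.fderiv, fderiv_fst]
  simp

lemma det_fderiv_chartXY_zero {t : ℕ} (ht : 0 < t) (v : ℂ × ℂ) :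
    (fderiv ℂ (chartXY t 0) v).det = v.2 := by
  have h : chartXY t 0 = fun v => (v.1 * v.2, v.2) := by
    funext v
    simp [chartXY, chartX, ht]
  have h2 : HasFDerivAt (fun v : ℂ × ℂ => v.1 * v.2) (v.1 • ContinuousLinearMap.snd ℂ ℂ ℂ +
      v.2 • ContinuousLinearMap.fst ℂ ℂ ℂ) v := hasFDerivAt_fst.mul hasFDerivAt_snd
  rw [h, det_fderiv_prodMk h2.differentiableAt differentiableAt_snd, h2.fderiv, fderiv_snd]
  simp

section

variable {U : Type u} [TopologicalSpace U] [ChartedSpace (ℂ × ℂ) U] {c : GlobalChart U} {t : ℕ}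

namespace Tower

lemma chartXY_chart {i : ℕ} (hi : i ≤ t) {P : Tower c t} (hP : P ∈ (chart c hi).source) :
    chartXY t i (chart c hi P) = (P.x, P.y) := chartXY_chartFun hi hP

lemma w_eq_chartW {i : ℕ} (hi : i ≤ t) {P : Tower c t} (hP : P ∈ (chart c hi).source) (k : ℕ) :
    P.w k = chartW t i (chart c hi P) k := (chartW_chartFun hi hP k).symm

lemma chartX_chart {i : ℕ} (hi : i ≤ t) {P : Tower c t} (hP : P ∈ (chart c hi).source) :
    chartX t i (chart c hi P) = P.x := chartX_chartFun hP

lemma chart_self_fst (P : Tower c t) : (chart c le_rfl P).1 = P.x := by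
  rw [chart_apply, chartFun, if_neg (lt_irrefl t)]

lemma chart_self_snd (P : Tower c t) : (chart c le_rfl P).2 = affCoord (P.w t) := rfl

lemma mem_chart_self_source_iff {P : Tower c t} :
    P ∈ (chart c (le_refl t)).source ↔ P.w t ≠ infty := by
  simp [mem_chart_source_iff]

/-- At a point where `y / x ^ i` is finite and `y / x ^ (i + 1)` is not, the first
coordinate of the `i`-th chart vanishes. -/
lemma chart_index_fst (P : Tower c t) (h : P.index < t) : (chart c P.index_le P).1 = 0 := by
  rw [chart_apply, chartFun, if_pos h, P.w_of_index_lt (Nat.lt_succ_self _), invCoord_infty]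

lemma x_eq_zero_of_index_lt (P : Tower c t) (h : P.index < t) : P.x = 0 := by
  rw [← chartX_chart P.index_le P.mem_chart_index_source, chartX, if_pos h, P.chart_index_fst h,
    zero_mul]

lemma mem_chart_self_source_of_x_ne {P : Tower c t} (h : P.x ≠ 0) :
    P ∈ (chart c (le_refl t)).source := by
  have h1 : P.index = t := by
    by_contra hne
    exact h (P.x_eq_zero_of_index_lt (lt_of_le_of_ne P.index_le hne))
  rw [mem_chart_self_source_iff]
  have := P.w_index_ne
  rwa [h1] at this

lemma mem_chart_zero_source_of_y_ne (ht : 0 < t) {P : Tower c t} (h : P.y ≠ 0) :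
    P ∈ (chart c (Nat.zero_le t)).source := by
  rw [mem_chart_source_iff, P.w_zero]
  refine ⟨by simp, fun _ h1 => h ?_⟩
  have h2 := P.isMulRel ht
  rw [h1] at h2
  have h3 := h2.eq_coe
  rw [P.w_zero, OnePoint.coe_eq_coe, mul_zero] at h3
  exact h3

variable (c t) in
/-- The `m`-th exceptional curve (`1 ≤ m ≤ t`), a projective line with the coordinate `w m`. -/
def excCurve (m : ℕ) : Set (Tower c t) :=
  {P | P.x = 0 ∧ (∀ k < m, P.w k = (0 : ℂ)) ∧ ∀ k, m < k → P.w k = infty}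

lemma mem_excCurve_iff {i : ℕ} (hi : i ≤ t) {P : Tower c t} (hP : P ∈ (chart c hi).source) {m : ℕ}
    (hm : m ≤ t) : P ∈ excCurve c t m ↔
      (m = i ∧ (chart c hi P).1 = 0) ∨ (m = i + 1 ∧ (chart c hi P).2 = 0) := by
  have hw := w_eq_chartW hi hP
  have hX := chartX_chart hi hP
  set v := chart c hi P
  constructor
  · rintro ⟨hx, h1, h2⟩
    rcases lt_trichotomy m i with h | h | h
    · exact absurd (h2 i h) hP.1
    · subst h
      refine Or.inl ⟨rfl, ?_⟩
      rcases hi.lt_or_eq with hit | hit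
      · have := h2 (m + 1) (Nat.lt_succ_self m)
        rwa [hw, chartW_succ hit, coeInv_eq_infty_iff] at this
      · rw [← hX, chartX, if_neg (by omega)] at hx
        exact hx
    · rcases Nat.lt_or_eq_of_le (Nat.succ_le_of_lt h) with h' | h'
      · exact absurd (h1 (i + 1) h') (hP.2 (by omega))
      · refine Or.inr ⟨h'.symm, ?_⟩
        have := h1 i h
        rwa [hw, chartW_self, OnePoint.coe_eq_coe] at this
  · rintro (⟨rfl, h⟩ | ⟨rfl, h⟩)
    · have hx : P.x = 0 := by
        rw [← hX, chartX]
        split_ifs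
        · rw [h, zero_mul]
        · exact h
      refine ⟨hx, fun k hk => ?_, fun k hk => ?_⟩
      · rw [hw, chartW_of_le hk.le, hX, hx, zero_pow (by omega), mul_zero]
      · rcases le_or_gt k t with hkt | hkt
        · rw [hw, chartW_of_lt hk hkt, h, zero_mul, coeInv_zero]
        · exact P.w_of_gt hkt
    · have hx : P.x = 0 := by rw [← hX, chartX, if_pos (by omega), h, mul_zero]
      refine ⟨hx, fun k hk => ?_, fun k hk => ?_⟩
      · rw [hw, chartW_of_le (by omega), h, zero_mul]
      · rcases le_or_gt k t with hkt | hkt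
        · rw [hw, chartW_of_lt (by omega) hkt, hX, hx, zero_pow (by omega), mul_zero, coeInv_zero]
        · exact P.w_of_gt hkt

/-- The fibre over the origin is the union of the exceptional curves. -/
lemma exists_mem_excCurve_iff (ht : 0 < t) {P : Tower c t} :
    (∃ m, 1 ≤ m ∧ m ≤ t ∧ P ∈ excCurve c t m) ↔ P.x = 0 ∧ P.y = 0 := by
  constructor
  · rintro ⟨m, hm, -, hx, h, -⟩
    have := h 0 hm
    rw [P.w_zero, OnePoint.coe_eq_coe] at this
    exact ⟨hx, this⟩
  · rintro ⟨hx, hy⟩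
    have hP := P.mem_chart_index_source
    have hle := P.index_le
    have hXY := chartXY_chart hle hP
    rw [hx, hy, chartXY, Prod.mk.injEq] at hXY
    by_cases h0 : (chart c P.index_le P).2 = 0 ∧ P.index < t
    · exact ⟨P.index + 1, by omega, h0.2, (mem_excCurve_iff _ hP h0.2).2 (Or.inr ⟨rfl, h0.1⟩)⟩
    · have h1 : (chart c P.index_le P).1 = 0 := by
        rcases hle.lt_or_eq with h | h
        · exact P.chart_index_fst h
        · have := hXY.1
          rwa [chartX, if_neg (by omega)] at this
      refine ⟨P.index, ?_, hle, (mem_excCurve_iff _ hP hle).2 (Or.inl ⟨rfl, h1⟩)⟩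
      by_contra hi
      have hi : P.index = 0 := by omega
      apply h0
      refine ⟨?_, by omega⟩
      have := hXY.2
      have hpow : ∀ z : ℂ, z ^ P.index = 1 := fun z => by rw [hi, pow_zero]
      rwa [hpow, mul_one] at this

/-- The parametrisation of the `m`-th exceptional curve by the projective line. -/
noncomputable def excPoint (c : GlobalChart U) {t m : ℕ} (hm : 1 ≤ m ∧ m ≤ t) (s : OnePoint ℂ) :
    Tower c t :=
  ⟨(c.toChart.symm 0, fun k => if k < m then ((0 : ℂ) : OnePoint ℂ) else
    if k = m then s else infty), by
    rw [c.toChart.right_inv c.zero_mem]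
    refine ⟨if_pos hm.1, fun k hk => ?_, fun k hk => ?_⟩
    · rcases lt_or_ge m (k + 1) with h | h
      · exact Or.inl ⟨by simp only [if_neg (by omega : ¬ k + 1 < m),
          if_neg (by omega : ¬ k + 1 = m)], Or.inl rfl⟩
      · simp only [if_pos (by omega : k < m), Prod.fst_zero]
        by_cases h' : (if k + 1 < m then ((0 : ℂ) : OnePoint ℂ) else
            if k + 1 = m then s else infty) = infty
        · exact Or.inl ⟨h', Or.inl rfl⟩
        · exact Or.inr ⟨h', by rw [zero_mul]⟩
    · simp only [if_neg (by omega : ¬ k < m), if_neg (by omega : ¬ k = m)]⟩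

lemma coord_excPoint {m : ℕ} (hm : 1 ≤ m ∧ m ≤ t) (s : OnePoint ℂ) :
    c.toChart (excPoint c hm s).proj = 0 := c.toChart.right_inv c.zero_mem

lemma w_excPoint {m : ℕ} (hm : 1 ≤ m ∧ m ≤ t) (s : OnePoint ℂ) (k : ℕ) :
    (excPoint c hm s).w k = if k < m then ((0 : ℂ) : OnePoint ℂ) else
      if k = m then s else infty := rfl

lemma w_excPoint_self {m : ℕ} (hm : 1 ≤ m ∧ m ≤ t) (s : OnePoint ℂ) :
    (excPoint c hm s).w m = s := by
  simp [w_excPoint]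

lemma excPoint_mem {m : ℕ} (hm : 1 ≤ m ∧ m ≤ t) (s : OnePoint ℂ) :
    excPoint c hm s ∈ excCurve c t m := by
  refine ⟨?_, fun k hk => ?_, fun k hk => ?_⟩
  · rw [x, coord_excPoint]
    rfl
  · rw [w_excPoint, if_pos hk]
  · rw [w_excPoint, if_neg (by omega), if_neg (by omega)]

lemma excPoint_w {m : ℕ} (hm : 1 ≤ m ∧ m ≤ t) {P : Tower c t} (hP : P ∈ excCurve c t m) :
    excPoint c hm (P.w m) = P := by
  have hfib := (exists_mem_excCurve_iff (by omega)).1 ⟨m, hm.1, hm.2, hP⟩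
  refine ext (c.toChart.injOn (proj_mem_source _) P.proj_mem_source ?_) fun k => ?_
  · rw [coord_excPoint]
    exact (Prod.ext hfib.1 hfib.2).symm
  · rw [w_excPoint]
    split_ifs with h1 h2
    · exact (hP.2.1 k h1).symm
    · rw [h2]
    · exact (hP.2.2 k (by omega)).symm

lemma continuous_excPoint {m : ℕ} (hm : 1 ≤ m ∧ m ≤ t) : Continuous (excPoint c hm) := by
  have hind : Topology.IsInducing (fun P : Tower c t => P.1) := ⟨rfl⟩
  rw [hind.continuous_iff]
  refine continuous_const.prodMk (continuous_pi fun k => ?_)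
  split_ifs
  · exact continuous_const
  · exact continuous_id
  · exact continuous_const

lemma range_excPoint {m : ℕ} (hm : 1 ≤ m ∧ m ≤ t) : Set.range (excPoint c hm) = excCurve c t m :=
  Set.Subset.antisymm (Set.range_subset_iff.2 (excPoint_mem hm))
    fun P hP => ⟨P.w m, excPoint_w hm hP⟩

lemma isClosed_excCurve [T2Space U] {m : ℕ} (hm : 1 ≤ m ∧ m ≤ t) : IsClosed (excCurve c t m) := by
  rw [← range_excPoint hm]
  exact (isCompact_range (continuous_excPoint hm)).isClosed

lemma isConnected_excCurve {m : ℕ} (hm : 1 ≤ m ∧ m ≤ t) : IsConnected (excCurve c t m) := by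
  rw [← range_excPoint hm]
  exact isConnected_range (continuous_excPoint hm)

/-- The exceptional locus of the blow-up map is the fibre over the origin. -/
lemma mem_excLocus_proj_iff (ht : 0 < t) {P : Tower c t} :
    P ∈ excLocus (proj : Tower c t → U) ↔ P.x = 0 ∧ P.y = 0 := by
  constructor
  · intro hP
    by_contra hne
    apply hP
    -- away from the fibre the monomial map `chartXY` has nonzero Jacobian determinant
    obtain ⟨i, hi, hPi, hdet⟩ : ∃ (i : ℕ) (hi : i ≤ t), P ∈ (chart c hi).source ∧
        (fderiv ℂ (chartXY t i) (chart c hi P)).det ≠ 0 := by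
      by_cases hx : P.x = 0
      · have hy : P.y ≠ 0 := fun h => hne ⟨hx, h⟩
        have hP0 := mem_chart_zero_source_of_y_ne ht hy
        refine ⟨0, Nat.zero_le t, hP0, ?_⟩
        rw [det_fderiv_chartXY_zero ht]
        have := congrArg Prod.snd (chartXY_chart (Nat.zero_le t) hP0)
        simp only [chartXY, pow_zero, mul_one] at this
        rwa [this]
      · refine ⟨t, le_rfl, mem_chart_self_source_of_x_ne hx, ?_⟩
        rw [det_fderiv_chartXY_self, chart_self_fst]
        exact pow_ne_zero t hx
    obtain ⟨Ψ, hΨ, hPΨ, hs, he⟩ := exists_isHolChart (isHolChart_chart hi) hPi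
      ((contDiff_chartXY t i).contDiffAt.analyticAt) hdet
    refine c.isHolChart.isLocalDiffeomorphAt_of_eq hΨ hPΨ fun Q hQ => ⟨Q.proj_mem_source, ?_⟩
    rw [he, chartXY_chart hi (hs hQ)]
    rfl
  · intro hfib hdiff
    obtain ⟨m, hm1, hm2, hP⟩ := (exists_mem_excCurve_iff ht).2 hfib
    obtain ⟨Θ, hPΘ, heq⟩ := hdiff
    -- the curve through `P` is contracted, so the map is not locally injective
    have hcont := (continuous_excPoint (c := c) ⟨hm1, hm2⟩).tendsto (P.w m)
    rw [excPoint_w ⟨hm1, hm2⟩ hP] at hcont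
    have hev : ∀ᶠ s in 𝓝[≠] (P.w m), excPoint c ⟨hm1, hm2⟩ s ∈ Θ.source :=
      (hcont.eventually (Θ.open_source.mem_nhds hPΘ)).filter_mono nhdsWithin_le_nhds
    obtain ⟨s, hs, hsne⟩ := (hev.and self_mem_nhdsWithin).exists
    apply hsne
    have h1 : (excPoint c ⟨hm1, hm2⟩ s).proj = P.proj := by
      refine c.toChart.injOn (proj_mem_source _) P.proj_mem_source ?_
      rw [coord_excPoint]
      exact (Prod.ext hfib.1 hfib.2).symm
    have h2 : excPoint c ⟨hm1, hm2⟩ s = P := by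
      refine Θ.injOn hs hPΘ ?_
      have e1 := heq hs
      have e2 := heq hPΘ
      rw [h1] at e1
      exact e1.symm.trans e2
    rw [← h2, w_excPoint_self]
    rfl

lemma isModification_proj (ht : 0 < t) : IsModification (proj : Tower c t → U) := by
  set A : Set U := {q | c.toChart q = 0} with hA
  have hsrc : ∀ q : U, q ∈ c.toChart.source := fun q => by rw [c.source_eq]; trivial
  have hfib : ∀ P : Tower c t, P.proj ∈ A ↔ P.x = 0 ∧ P.y = 0 := fun P => Prod.ext_iff
  refine ⟨contMDiff_proj, isProperMap_proj, A, ?_, ?_, ?_, ⟨fun P hP => hP, ?_, ?_⟩, ?_⟩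
  · intro q
    refine ⟨2, ![fun x => (c.toChart x).1, fun x => (c.toChart x).2], ?_, ?_⟩
    · rw [Fin.forall_fin_two]
      exact ⟨c.isHolChart.holomorphicAt_comp (hsrc q) analyticAt_fst,
        c.isHolChart.holomorphicAt_comp (hsrc q) analyticAt_snd⟩
    · refine Filter.Eventually.of_forall fun x => ?_
      rw [Fin.forall_fin_two]
      exact Prod.ext_iff
  · intro q
    rw [mem_closure_iff_frequently]
    have h1 := frequently_fst_ne_zero (c.toChart q)
    have h2 : ∀ᶠ v in 𝓝 (c.toChart q), v ∈ c.toChart.target :=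
      c.toChart.open_target.mem_nhds (c.toChart.map_source (hsrc q))
    refine (c.isHolChart.tendsto_symm (hsrc q)).frequently ((h1.and_eventually h2).mono ?_)
    rintro v ⟨hv, hvt⟩ hvA
    apply hv
    have hvA : c.toChart (c.toChart.symm v) = 0 := hvA
    rw [c.toChart.right_inv hvt] at hvA
    rw [hvA]
    rfl
  · intro P
    rw [mem_closure_iff_frequently]
    have hP := P.mem_chart_index_source
    have hd : Dense (({0}ᶜ : Set ℂ) ×ˢ ({0}ᶜ : Set ℂ)) :=
      (dense_compl_singleton 0).prod (dense_compl_singleton 0)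
    have h1 := mem_closure_iff_frequently.1 (hd (chart c P.index_le P))
    have h2 : ∀ᶠ v in 𝓝 (chart c P.index_le P), v ∈ (chart c P.index_le).target :=
      (chart c P.index_le).open_target.mem_nhds ((chart c P.index_le).map_source hP)
    refine ((isHolChart_chart P.index_le).tendsto_symm hP).frequently
      ((h1.and_eventually h2).mono ?_)
    rintro v ⟨⟨hv1, hv2⟩, hvt⟩ hvA
    have h3 := ((hfib _).1 hvA).1
    rw [x_chart_symm _ hvt, chartX] at h3
    split_ifs at h3
    · rcases mul_eq_zero.1 h3 with h | h
      · exact hv1 h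
      · exact hv2 h
    · exact hv1 h3
  · intro P hP Q hQ hPQ
    have hPA : ¬ (P.x = 0 ∧ P.y = 0) := fun h => hP ((hfib P).2 h)
    have hx : P.x = Q.x := congrArg (fun q => (c.toChart q).1) hPQ
    have hy : P.y = Q.y := congrArg (fun q => (c.toChart q).2) hPQ
    by_cases hx0 : P.x = 0
    · have hy0 : P.y ≠ 0 := fun h => hPA ⟨hx0, h⟩
      have hP0 := mem_chart_zero_source_of_y_ne ht hy0
      have hQ0 := mem_chart_zero_source_of_y_ne ht (hy ▸ hy0)
      refine (chart c (Nat.zero_le t)).injOn hP0 hQ0 ?_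
      have e1 := chartXY_chart (Nat.zero_le t) hP0
      have e2 := chartXY_chart (Nat.zero_le t) hQ0
      rw [← hx, ← hy] at e2
      simp only [chartXY, chartX, if_pos ht, pow_zero, mul_one, Prod.mk.injEq] at e1 e2
      refine Prod.ext ?_ (e1.2.trans e2.2.symm)
      have h3 := e1.1.trans e2.1.symm
      rw [e1.2, e2.2] at h3
      exact mul_right_cancel₀ hy0 h3
    · have hP0 := mem_chart_self_source_of_x_ne hx0
      have hQ0 := mem_chart_self_source_of_x_ne (hx ▸ hx0)
      refine (chart c (le_refl t)).injOn hP0 hQ0 ?_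
      have e1 := chartXY_chart (le_refl t) hP0
      have e2 := chartXY_chart (le_refl t) hQ0
      rw [← hx, ← hy] at e2
      simp only [chartXY, chartX, if_neg (lt_irrefl t), Prod.mk.injEq] at e1 e2
      refine Prod.ext (e1.1.trans e2.1.symm) ?_
      have h3 := e1.2.trans e2.2.symm
      rw [e1.1, e2.1] at h3
      exact mul_right_cancel₀ (pow_ne_zero t hx0) h3
  · intro q hq
    have hqt := c.toChart.map_source (hsrc q)
    obtain ⟨i, hi, v, hv⟩ : ∃ (i : ℕ) (_ : i ≤ t) (v : ℂ × ℂ), chartXY t i v = c.toChart q := by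
      by_cases hx : (c.toChart q).1 = 0
      · refine ⟨0, Nat.zero_le t, (0, (c.toChart q).2), ?_⟩
        simp [chartXY, chartX, ht, Prod.ext_iff, hx]
      · refine ⟨t, le_rfl, ((c.toChart q).1, (c.toChart q).2 / (c.toChart q).1 ^ t), ?_⟩
        simp [chartXY, chartX, hx]
    have hvt : chartXY t i v ∈ c.toChart.target := by rwa [hv]
    have hpr : (mk hi v hvt).proj = q := by
      refine c.toChart.injOn (proj_mem_source _) (hsrc q) ?_
      rw [coord_mk, hv]
    exact ⟨mk hi v hvt, by rwa [Set.mem_preimage, hpr], hpr⟩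
  · rw [Set.disjoint_left]
    intro P hP hPA
    exact hPA ((hfib P).2 ((mem_excLocus_proj_iff ht).1 hP))

end Tower

end

/-! ### The log resolution -/

namespace Tower

section

variable {U : Type u} [TopologicalSpace U] [ChartedSpace (ℂ × ℂ) U] {c : GlobalChart U} {t : ℕ}
variable {κ : Type} {D : κ → Set U} {ε δ : ℝ} {u : κ → ℂ → ℂ}

variable (c t) in
/-- The strict transform of the graph `y = x ^ t * g x`. -/
def strictTransform (g : ℂ → ℂ) : Set (Tower c t) := {P | P.w t = (g P.x : ℂ)}

lemma mem_strictTransform_iff {g : ℂ → ℂ} {P : Tower c t} (hP : P ∈ (chart c (le_refl t)).source) :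
    P ∈ strictTransform c t g ↔
      (chart c (le_refl t) P).2 = g (chart c (le_refl t) P).1 := by
  rw [chart_self_fst, ← OnePoint.coe_eq_coe, chart_self_snd,
    coe_affCoord (mem_chart_self_source_iff.1 hP)]
  rfl

lemma mem_source_of_mem_strictTransform {g : ℂ → ℂ} {P : Tower c t}
    (hP : P ∈ strictTransform c t g) : P ∈ (chart c (le_refl t)).source := by
  have hP : P.w t = (g P.x : ℂ) := hP
  rw [mem_chart_self_source_iff, hP]
  simp

lemma x_mem_ball (hN : IsNormalForm D t c.toChart ε δ u) (P : Tower c t) :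
    P.x ∈ Metric.ball (0 : ℂ) ε := by
  have := c.toChart.map_source P.proj_mem_source
  rw [hN.target_eq] at this
  exact this.1

lemma graph_mem_target (hN : IsNormalForm D t c.toChart ε δ u) (k : κ) {s : ℂ}
    (hs : s ∈ Metric.ball (0 : ℂ) ε) : (s, u k s) ∈ (chart c (le_refl t)).target := by
  rw [mem_chart_target_iff, hN.target_eq]
  simp only [chartXY, chartX, if_neg (lt_irrefl t)]
  refine ⟨hs, ?_⟩
  rw [mul_comm]
  exact hN.mem_ball k s hs

lemma strictTransform_eq_image (hN : IsNormalForm D t c.toChart ε δ u) (k : κ) :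
    strictTransform c t (u k) =
      (fun s => (chart c (le_refl t)).symm (s, u k s)) '' Metric.ball (0 : ℂ) ε := by
  ext P
  constructor
  · intro hP
    have hs := mem_source_of_mem_strictTransform hP
    refine ⟨P.x, x_mem_ball hN P, ?_⟩
    have h1 := (mem_strictTransform_iff hs).1 hP
    rw [chart_self_fst] at h1
    dsimp only
    rw [← h1, ← P.chart_self_fst, (chart c (le_refl t)).left_inv hs]
  · rintro ⟨s, hs, rfl⟩
    have ht := graph_mem_target hN k hs
    rw [mem_strictTransform_iff ((chart c (le_refl t)).map_target ht),
      (chart c (le_refl t)).right_inv ht]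

lemma isConnected_strictTransform (hN : IsNormalForm D t c.toChart ε δ u) (k : κ) :
    IsConnected (strictTransform c t (u k)) := by
  rw [strictTransform_eq_image hN k]
  refine IsConnected.image ?_ _ ?_
  · exact (Metric.isConnected_ball hN.eps_pos)
  · exact (chart c (le_refl t)).continuousOn_symm.comp
      (continuousOn_id.prodMk (hN.analyticOnNhd k).continuousOn)
      fun s hs => graph_mem_target hN k hs

lemma isClosed_strictTransform (hN : IsNormalForm D t c.toChart ε δ u) (k : κ) :
    IsClosed (strictTransform c t (u k)) := by
  have h : Continuous fun P : Tower c t => u k P.x :=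
    (hN.analyticOnNhd k).continuousOn.comp_continuous continuous_x (x_mem_ball hN)
  exact isClosed_eq (continuous_w t) (OnePoint.continuous_coe.comp h)

/-- The total transform of the curves consists of the exceptional curves and the strict
transforms. -/
lemma excLocus_union_preimage_eq (ht : 0 < t) (hN : IsNormalForm D t c.toChart ε δ u) :
    excLocus (proj : Tower c t → U) ∪ proj ⁻¹' (⋃ k, D k) =
      (⋃ m : Fin t, excCurve c t (m + 1)) ∪ ⋃ k, strictTransform c t (u k) := by
  have hexc : ∀ P : Tower c t, P ∈ ⋃ m : Fin t, excCurve c t (m + 1) ↔ P.x = 0 ∧ P.y = 0 := by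
    intro P
    rw [← exists_mem_excCurve_iff ht, Set.mem_iUnion]
    constructor
    · rintro ⟨m, hm⟩
      exact ⟨m + 1, by omega, by omega, hm⟩
    · rintro ⟨m, h1, h2, hm⟩
      refine ⟨⟨m - 1, by omega⟩, ?_⟩
      rwa [show (m - 1 + 1) = m by omega]
  have hD : ∀ (P : Tower c t) k, P.proj ∈ D k ↔ P.y = P.x ^ t * u k P.x := fun P k =>
    hN.mem_iff k P.proj P.proj_mem_source
  have hchart : ∀ P : Tower c t, P ∈ (chart c (le_refl t)).source →
      (chart c (le_refl t) P).2 * P.x ^ t = P.y := by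
    intro P hP
    have := congrArg Prod.snd (chartXY_chart (le_refl t) hP)
    simpa only [chartXY, chartX, if_neg (lt_irrefl t), chart_self_fst] using this
  ext P
  rw [Set.mem_union, Set.mem_union, hexc, mem_excLocus_proj_iff ht]
  constructor
  · rintro (h | h)
    · exact Or.inl h
    · obtain ⟨k, hk⟩ := Set.mem_iUnion.1 (show P.proj ∈ ⋃ k, D k from h)
      rw [hD] at hk
      by_cases hx : P.x = 0
      · refine Or.inl ⟨hx, ?_⟩
        rw [hk, hx, zero_pow (by omega), zero_mul]
      · refine Or.inr (Set.mem_iUnion.2 ⟨k, ?_⟩)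
        have hs := mem_chart_self_source_of_x_ne hx
        rw [mem_strictTransform_iff hs, chart_self_fst]
        refine mul_right_cancel₀ (pow_ne_zero t hx) ?_
        rw [hchart P hs, hk, mul_comm]
  · rintro (h | h)
    · exact Or.inl h
    · obtain ⟨k, hk⟩ := Set.mem_iUnion.1 h
      refine Or.inr (Set.mem_iUnion.2 ⟨k, (hD P k).2 ?_⟩)
      have hs := mem_source_of_mem_strictTransform hk
      rw [mem_strictTransform_iff hs, chart_self_fst] at hk
      rw [← hchart P hs, hk, mul_comm]

/-- The components of the total transform: the exceptional curves and the strict transforms. -/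
def component (c : GlobalChart U) (t : ℕ) (u : κ → ℂ → ℂ) : Fin t ⊕ κ → Set (Tower c t) :=
  Sum.elim (fun m => excCurve c t (m + 1)) fun k => strictTransform c t (u k)

lemma injective_component (hN : IsNormalForm D t c.toChart ε δ u) :
    Function.Injective (component c t u) := by
  have hexc : ∀ m m' : Fin t, m < m' → excCurve c t (m + 1) ≠ excCurve c t (m' + 1) := by
    intro m m' hlt heq
    have h1 := excPoint_mem (c := c) (t := t) (m := m + 1) ⟨by omega, by omega⟩
      ((1 : ℂ) : OnePoint ℂ)
    rw [heq] at h1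
    have h2 := h1.2.1 (m + 1) (by omega)
    rw [w_excPoint_self, OnePoint.coe_eq_coe] at h2
    exact one_ne_zero h2
  have hmix : ∀ (m : Fin t) k, excCurve c t (m + 1) ≠ strictTransform c t (u k) := by
    intro m k heq
    -- a strict transform contains points with `x ≠ 0`
    obtain ⟨s, hs0, hs⟩ : ∃ s : ℂ, s ≠ 0 ∧ s ∈ Metric.ball (0 : ℂ) ε := by
      refine ⟨((ε / 2 : ℝ) : ℂ), by exact_mod_cast (half_pos hN.eps_pos).ne', ?_⟩
      rw [mem_ball_zero_iff, Complex.norm_real, Real.norm_of_nonneg (half_pos hN.eps_pos).le]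
      exact half_lt_self hN.eps_pos
    have h1 : (chart c (le_refl t)).symm (s, u k s) ∈ strictTransform c t (u k) := by
      rw [strictTransform_eq_image hN]
      exact ⟨s, hs, rfl⟩
    rw [← heq] at h1
    have h2 := h1.1
    rw [x_chart_symm _ (graph_mem_target hN k hs), chartX, if_neg (lt_irrefl t)] at h2
    exact hs0 h2
  have hstr : ∀ k k', k ≠ k' → strictTransform c t (u k) ≠ strictTransform c t (u k') := by
    intro k k' hne heq
    have h0 : (0 : ℂ) ∈ Metric.ball (0 : ℂ) ε := Metric.mem_ball_self hN.eps_pos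
    have ht := graph_mem_target hN k h0
    have h1 : (chart c (le_refl t)).symm (0, u k 0) ∈ strictTransform c t (u k) := by
      rw [strictTransform_eq_image hN]
      exact ⟨0, h0, rfl⟩
    rw [heq, mem_strictTransform_iff ((chart c (le_refl t)).map_target ht),
      (chart c (le_refl t)).right_inv ht] at h1
    exact hN.ne k k' hne 0 h0 h1
  rintro (m | k) (m' | k') h
  · rcases lt_trichotomy m m' with hlt | rfl | hlt
    · exact absurd h (hexc m m' hlt)
    · rfl
    · exact absurd h.symm (hexc m' m hlt)
  · exact absurd h (hmix m k')
  · exact absurd h.symm (hmix m' k)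
  · by_contra hne
    exact hstr k k' (fun h => hne (by rw [h])) h

/-- Near every point the components of the total transform are coordinate axes. -/
lemma exists_normalCrossing_coordinates (hN : IsNormalForm D t c.toChart ε δ u) (P : Tower c t) :
    ∃ (z : Tower c t → ℂ × ℂ) (e : Fin t ⊕ κ → Fin 2),
      IsLocalDiffeomorphAt 𝓘(ℂ, ℂ × ℂ) 𝓘(ℂ, ℂ × ℂ) ω z P ∧ z P = 0 ∧
      Set.InjOn e {i | P ∈ component c t u i} ∧
      ∀ i, P ∈ component c t u i → ∀ᶠ Q in 𝓝 P, Q ∈ component c t u i ↔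
        ![(z Q).1, (z Q).2] (e i) = 0 := by
  have hle := P.index_le
  have hP := P.mem_chart_index_source
  have hsrc := (chart c hle).open_source.mem_nhds hP
  set v := chart c hle P with hv
  by_cases hlt : P.index < t
  · -- no strict transform passes through `P`; the `i`-th and the `(i + 1)`-st exceptional
    -- curves are the axes of the `i`-th chart
    have hv1 : v.1 = 0 := P.chart_index_fst hlt
    have hstr : ∀ k, P ∉ strictTransform c t (u k) := by
      intro k hk
      have := mem_chart_self_source_iff.1 (mem_source_of_mem_strictTransform hk)
      exact this (P.w_of_index_lt hlt)
    refine ⟨fun Q => ((chart c hle Q).1 - v.1, (chart c hle Q).2 - v.2),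
      Sum.elim (fun m => if (m : ℕ) + 1 = P.index then 0 else 1) fun _ => 0,
      (isHolChart_chart hle).isLocalDiffeomorphAt_shear (g := fun _ => v.2) hP analyticAt_const,
      by simp [← hv], ?_, ?_⟩
    · rintro (m | k) hm (m' | k') hm' h
      · have h1 := (mem_excCurve_iff hle hP (by omega)).1 (show P ∈ excCurve c t (m + 1) from hm)
        have h2 := (mem_excCurve_iff hle hP (by omega)).1 (show P ∈ excCurve c t (m' + 1) from hm')
        simp only [Sum.elim_inl] at h
        congr 1
        apply Fin.ext
        split_ifs at h with h3 h4 h4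
        · omega
        · exact absurd h (by decide)
        · exact absurd h (by decide)
        · rcases h1 with h1 | h1 <;> rcases h2 with h2 | h2 <;> omega
      · exact absurd hm' (hstr k')
      · exact absurd hm (hstr k)
      · exact absurd hm (hstr k)
    · rintro (m | k) hm
      · have h1 := (mem_excCurve_iff hle hP (by omega)).1 (show P ∈ excCurve c t (m + 1) from hm)
        filter_upwards [hsrc] with Q hQ
        change Q ∈ excCurve c t (m + 1) ↔ _
        rw [mem_excCurve_iff hle hQ (by omega)]
        rcases h1 with ⟨h1, h2⟩ | ⟨h1, h2⟩
        · simp [h1, hv1]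
        · have h3 : (m : ℕ) + 1 ≠ P.index := by omega
          have h2 : v.2 = 0 := h2
          simp only [Sum.elim_inl, if_neg h3, h2, sub_zero, Matrix.cons_val_one,
            Matrix.cons_val_fin_one]
          constructor
          · rintro (⟨h, -⟩ | ⟨-, h⟩)
            · exact absurd h h3
            · exact h
          · exact fun h => Or.inr ⟨h1, h⟩
      · exact absurd hm (hstr k)
  · -- in the last chart the axes are the last exceptional curve `{x = 0}` and at
    -- most one of the disjoint graphs of the functions `u k`
    have hidx : P.index = t := by omega
    have hPt : P ∈ (chart c (le_refl t)).source := by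
      rw [mem_chart_self_source_iff]
      have := P.w_index_ne
      rwa [hidx] at this
    have hsrct := (chart c (le_refl t)).open_source.mem_nhds hPt
    have hx : (chart c (le_refl t) P).1 ∈ Metric.ball (0 : ℂ) ε := by
      rw [chart_self_fst]
      exact x_mem_ball hN P
    obtain ⟨g, hg, hgP, hgu⟩ : ∃ g : ℂ → ℂ, AnalyticAt ℂ g (chart c (le_refl t) P).1 ∧
        g (chart c (le_refl t) P).1 = (chart c (le_refl t) P).2 ∧
        ∀ k, P ∈ strictTransform c t (u k) → g = u k := by
      by_cases hex : ∃ k, P ∈ strictTransform c t (u k)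
      · obtain ⟨k, hk⟩ := hex
        refine ⟨u k, hN.analyticOnNhd k _ hx, ((mem_strictTransform_iff hPt).1 hk).symm, ?_⟩
        intro k' hk'
        by_contra hne
        refine hN.ne k k' (fun h => hne (by rw [h])) _ hx ?_
        rw [← (mem_strictTransform_iff hPt).1 hk, ← (mem_strictTransform_iff hPt).1 hk']
      · exact ⟨fun _ => (chart c (le_refl t) P).2, analyticAt_const, rfl,
          fun k hk => absurd ⟨k, hk⟩ hex⟩
    refine ⟨_, Sum.elim (fun _ => 0) fun _ => 1,
      (isHolChart_chart (le_refl t)).isLocalDiffeomorphAt_shear hPt hg, ?_, ?_, ?_⟩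
    · rw [hgP, sub_self, sub_self]
      rfl
    · rintro (m | k) hm (m' | k') hm' h
      · have h1 := (mem_excCurve_iff le_rfl hPt (by omega)).1
          (show P ∈ excCurve c t (m + 1) from hm)
        have h2 := (mem_excCurve_iff le_rfl hPt (by omega)).1
          (show P ∈ excCurve c t (m' + 1) from hm')
        congr 1
        apply Fin.ext
        omega
      · exact absurd h (by simp)
      · exact absurd h (by simp)
      · congr 1
        by_contra hne
        refine hN.ne k k' hne _ hx ?_
        rw [← (mem_strictTransform_iff hPt).1 hm, ← (mem_strictTransform_iff hPt).1 hm']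
    · rintro (m | k) hm
      · have h1 := (mem_excCurve_iff le_rfl hPt (by omega)).1
          (show P ∈ excCurve c t (m + 1) from hm)
        have h1 : (m : ℕ) + 1 = t ∧ (chart c (le_refl t) P).1 = 0 := by
          rcases h1 with h1 | h1
          · exact h1
          · omega
        filter_upwards [hsrct] with Q hQ
        change Q ∈ excCurve c t (m + 1) ↔ _
        rw [mem_excCurve_iff le_rfl hQ (by omega)]
        simp [h1.1, h1.2]
      · filter_upwards [hsrct] with Q hQ
        change Q ∈ strictTransform c t (u k) ↔ _
        rw [mem_strictTransform_iff hQ, hgu k hm]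
        simp [sub_eq_zero]

/-- The iterated blow-up separates the curves, and its total transform has normal crossings. -/
theorem isLogResolution_proj [T2Space U] [Finite κ] (ht : 0 < t)
    (hN : IsNormalForm D t c.toChart ε δ u) :
    IsLogResolution D (proj : Tower c t → U) := by
  refine ⟨isModification_proj ht, ULift.{u} (Fin t ⊕ κ), fun i => component c t u i.down,
    (injective_component hN).comp ULift.down_injective, locallyFinite_of_finite _, ?_, ?_, ?_⟩
  · rintro ⟨m | k⟩
    · exact ⟨isClosed_excCurve ⟨by omega, by omega⟩, isConnected_excCurve ⟨by omega, by omega⟩⟩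
    · exact ⟨isClosed_strictTransform hN k, isConnected_strictTransform hN k⟩
  · rw [excLocus_union_preimage_eq ht hN]
    ext P
    simp only [Set.mem_union, Set.mem_iUnion]
    constructor
    · rintro (⟨m, hm⟩ | ⟨k, hk⟩)
      · exact ⟨⟨Sum.inl m⟩, hm⟩
      · exact ⟨⟨Sum.inr k⟩, hk⟩
    · rintro ⟨⟨m | k⟩, h⟩
      · exact Or.inl ⟨m, h⟩
      · exact Or.inr ⟨k, h⟩
  · intro P
    obtain ⟨z, e, h1, h2, h3, h4⟩ := exists_normalCrossing_coordinates hN P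
    refine ⟨z, fun i => e i.down, h1, h2, ?_, fun i hi => h4 i.down hi⟩
    intro i hi j hj hij
    exact ULift.down_injective (h3 hi hj hij)

lemma isExceptionalDivisor_excCurve [T2Space U] (ht : 0 < t) :
    IsExceptionalDivisor (proj : Tower c t → U) (excCurve c t t) := by
  refine ⟨isClosed_excCurve ⟨ht, le_rfl⟩, isConnected_excCurve ⟨ht, le_rfl⟩, ?_, ?_⟩
  · intro P hP
    rw [mem_excLocus_proj_iff ht, ← exists_mem_excCurve_iff ht]
    exact ⟨t, ht, le_rfl, hP⟩
  · intro P hP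
    have hle := P.index_le
    have hPs := P.mem_chart_index_source
    have hsrc := (chart c hle).open_source.mem_nhds hPs
    rcases (mem_excCurve_iff hle hPs le_rfl).1 hP with ⟨h1, h2⟩ | ⟨h1, h2⟩
    · refine (isHolChart_chart hle).isSmoothCurveAt hPs (ℓ := ContinuousLinearMap.fst ℂ ℂ ℂ)
        (fun h => ?_) h2 ?_
      · simpa using DFunLike.congr_fun h ((1 : ℂ), (0 : ℂ))
      · filter_upwards [hsrc] with Q hQ
        rw [mem_excCurve_iff hle hQ le_rfl]
        simp only [h1.symm, true_and, ContinuousLinearMap.coe_fst']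
        constructor
        · rintro (h | h)
          · exact h
          · omega
        · exact Or.inl
    · refine (isHolChart_chart hle).isSmoothCurveAt hPs (ℓ := ContinuousLinearMap.snd ℂ ℂ ℂ)
        (fun h => ?_) h2 ?_
      · simpa using DFunLike.congr_fun h ((0 : ℂ), (1 : ℂ))
      · filter_upwards [hsrc] with Q hQ
        rw [mem_excCurve_iff hle hQ le_rfl]
        constructor
        · rintro (h | h)
          · omega
          · exact h.2
        · exact fun h => Or.inr ⟨h1, h⟩

/-- The discrepancy of the last exceptional curve is `t - t * ∑ b k`. In the coordinates
`(x, y / x ^ t)` this curve is `x = 0`, the Jacobian determinant of the blow-up map is `x ^ t`, and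
the equation of `D k` pulls back to `x ^ t * (y / x ^ t - u k x)`. -/
lemma hasDiscrepancy_excCurve [IsManifold 𝓘(ℂ, ℂ × ℂ) ω U] [Fintype κ]
    (ht : 0 < t) (hN : IsNormalForm D t c.toChart ε δ u) (b : κ → ℝ) :
    HasDiscrepancy D b (proj : Tower c t → U) (excCurve c t t) (t - ∑ k, b k * (t : ℝ)) := by
  -- the orders are computed at a point of the curve that lies on no strict transform
  obtain ⟨s, hs⟩ := (Set.finite_range fun k => u k 0).exists_notMem
  have hv : ((0 : ℂ), s) ∈ (chart c (le_refl t)).target := by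
    rw [mem_chart_target_iff, hN.target_eq]
    simp [chartXY, chartX, ht.ne', hN.eps_pos, hN.delta_pos]
  set Ψ := chart c (le_refl t) with hΨdef
  have hΨ : IsHolChart Ψ := isHolChart_chart _
  set P := Ψ.symm (0, s) with hPdef
  have hP : P ∈ Ψ.source := Ψ.map_target hv
  have hPv : Ψ P = (0, s) := Ψ.right_inv hv
  have hsrc := Ψ.open_source.mem_nhds hP
  have hE : ∀ᶠ Q in 𝓝 P, Q ∈ excCurve c t t ↔ (Ψ Q).1 = 0 := by
    filter_upwards [hsrc] with Q hQ
    rw [mem_excCurve_iff le_rfl hQ le_rfl]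
    simp [hΨdef]
  have hloc := hΨ.isLocalEquation_fst hP (by rw [hPv]) hE
  have hPE : P ∈ excCurve c t t := hE.self_of_nhds.2 (by rw [hPv])
  have hcP := P.proj_mem_source
  have hx : (c.toChart P.proj).1 ∈ Metric.ball (0 : ℂ) ε := x_mem_ball hN P
  refine ⟨P, hPE, t, fun k q => (c.toChart q).2 - (c.toChart q).1 ^ t * u k (c.toChart q).1,
    fun _ => t, ?_, fun k => ?_, fun k => ?_, rfl⟩
  · obtain ⟨κ', hκ, hκ0, hJ⟩ := jacobian_eq c.isHolChart hΨ (contMDiff_proj P) hcP hP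
    refine ⟨_, κ' ∘ Ψ, hloc, hΨ.holomorphicAt_comp hP hκ, ?_, fun h => ?_⟩
    · filter_upwards [(hΨ.tendsto hP).eventually hJ, (hΨ.tendsto hP).eventually
        (Ψ.open_target.eventually_mem (Ψ.map_source hP)).eventually_nhds, hsrc] with Q h1 h2 h3
      have h4 : c.toChart ∘ proj ∘ Ψ.symm =ᶠ[𝓝 (Ψ Q)] chartXY t t := by
        filter_upwards [h2] with v hv
        exact coord_chart_symm le_rfl hv
      rw [h4.fderiv_eq, det_fderiv_chartXY_self, Ψ.left_inv h3] at h1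
      rw [h1, Function.comp, mul_comm]
    · exact hκ0 (h.self_of_nhds hPE)
  · have hg : AnalyticAt ℂ (fun s => s ^ t * u k s) (c.toChart P.proj).1 :=
      (analyticAt_id.pow t).mul (hN.analyticOnNhd k _ hx)
    refine c.isHolChart.isLocalEquation_graph hcP hg ?_
    filter_upwards [c.toChart.open_source.mem_nhds hcP] with q hq using hN.mem_iff k q hq
  · have hu : AnalyticAt ℂ (fun v : ℂ × ℂ => v.2 - u k v.1) (Ψ P) := by
      refine analyticAt_snd.sub ((hN.analyticOnNhd k _ ?_).comp analyticAt_fst)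
      rw [hPv]
      exact Metric.mem_ball_self hN.eps_pos
    refine ⟨_, (fun v : ℂ × ℂ => v.2 - u k v.1) ∘ Ψ, hloc, hΨ.holomorphicAt_comp hP hu, ?_,
      fun h => ?_⟩
    · filter_upwards [hsrc] with Q hQ
      have h1 := chartXY_chart le_rfl hQ
      have h2 : c.toChart Q.proj = (Q.x, Q.y) := rfl
      rw [h2, ← h1]
      simp only [chartXY, chartX, if_neg (lt_irrefl t), Function.comp]
      ring
    · have h1 := h.self_of_nhds hPE
      rw [Function.comp, hPv] at h1
      exact hs ⟨k, (sub_eq_zero.1 h1).symm⟩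

end

end Tower

/-! ### The klt criterion -/

section

variable {X : Type u} [TopologicalSpace X] [ChartedSpace (ℂ × ℂ) X]

lemma IsHolChart.subtypeRestr {Φ : OpenPartialHomeomorph X (ℂ × ℂ)} (hΦ : IsHolChart Φ)
    {U : TopologicalSpace.Opens X} (hU : Nonempty U) : IsHolChart (Φ.subtypeRestr hU) := by
  constructor
  · intro q hq
    rw [Φ.subtypeRestr_source] at hq
    exact ((hΦ.contMDiffAt hq).comp q contMDiff_subtype_val.contMDiffAt).contMDiffWithinAt
  · intro v hv
    have hv' : v ∈ Φ.target := by
      rw [OpenPartialHomeomorph.subtypeRestr_def, OpenPartialHomeomorph.trans_target] at hv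
      exact hv.1
    refine (ChartedSpace.liftPropWithinAt_subtypeVal_comp_iff ..).1 ?_
    exact ((hΦ.contMDiffAt_symm hv').contMDiffWithinAt).congr
      (fun w hw => (Φ.subtypeRestr_symm_eqOn hU hw).symm) (Φ.subtypeRestr_symm_eqOn hU hv).symm

variable {ι : Type*} {D : ι → Set X} {t : ℕ} {Φ : OpenPartialHomeomorph X (ℂ × ℂ)}
  {ε δ : ℝ} {u : ι → ℂ → ℂ}

lemma IsNormalForm.fst_mem_ball (hN : IsNormalForm D t Φ ε δ u) {q : X} (hq : q ∈ Φ.source) :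
    (Φ q).1 ∈ Metric.ball (0 : ℂ) ε := by
  have := Φ.map_source hq
  rw [hN.target_eq] at this
  exact this.1

/-- If the sum of the coefficients is less than `1 + 1 / t`, then the pair is klt on every open
subset of the domain of a normal form. -/
lemma IsNormalForm.isKlt [IsManifold 𝓘(ℂ, ℂ × ℂ) ω X] [Fintype ι]
    (hN : IsNormalForm D t Φ ε δ u) {b : ι → ℝ} (hb : ∀ k, 0 < b k ∧ b k < 1) (ht : 1 ≤ t)
    (hsum : ∑ k, b k < 1 + 1 / (t : ℝ)) {U : TopologicalSpace.Opens X} [hU : Nonempty U]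
    (hUΦ : (U : Set X) ⊆ Φ.source) : IsKlt U (fun k => ((↑) : U → X) ⁻¹' D k) b := by
  refine ⟨hb, ?_⟩
  intro Y _ _ _ _ f hf E a hE ha
  exact neg_one_lt_of_hasDiscrepancy (fun k => (hb k).1) (fun k => (hb k).2) ht hsum
    (hN.isHolChart.subtypeRestr hU) (u := u)
    (fun k q hq => hN.analyticOnNhd k _ (hN.fst_mem_ball (hUΦ q.2)))
    (fun i k hik q hq => hN.ne i k hik _ (hN.fst_mem_ball (hUΦ q.2)))
    (fun k q hq => hN.mem_iff k q (hUΦ q.2)) hf.1.1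
    (fun y => by rw [Φ.subtypeRestr_source]; exact hUΦ (f y).2) hE.2.2.2 ha

/-- If the pair is klt on the domain of a normal form, then the sum of the coefficients is
less than `1 + 1 / t`: the last exceptional curve of the iterated blow-up has discrepancy
`t - t * ∑ b k`. -/
lemma IsNormalForm.sum_lt_of_isKlt {κ : Type} [Fintype κ] {D : κ → Set X} {u : κ → ℂ → ℂ}
    [T2Space X] [IsManifold 𝓘(ℂ, ℂ × ℂ) ω X]
    (hN : IsNormalForm D t Φ ε δ u) {b : κ → ℝ} (ht : 1 ≤ t)
    {U : TopologicalSpace.Opens X} (hUΦ : (U : Set X) = Φ.source)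
    (h : IsKlt U (fun k => ((↑) : U → X) ⁻¹' D k) b) : ∑ k, b k < 1 + 1 / (t : ℝ) := by
  have h0 : (0 : ℂ × ℂ) ∈ Φ.target := by
    rw [hN.target_eq]
    exact ⟨Metric.mem_ball_self hN.eps_pos, Metric.mem_ball_self hN.delta_pos⟩
  have hU : Nonempty U := ⟨⟨Φ.symm 0, by
    change Φ.symm 0 ∈ (U : Set X)
    rw [hUΦ]
    exact Φ.map_target h0⟩⟩
  have htarget : (Φ.subtypeRestr hU).target = Φ.target := by
    ext v
    rw [OpenPartialHomeomorph.subtypeRestr_def, OpenPartialHomeomorph.trans_target]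
    refine ⟨fun hv => hv.1, fun hv => ⟨hv, ?_⟩⟩
    simp only [TopologicalSpace.Opens.openPartialHomeomorphSubtypeCoe_target, Set.mem_preimage,
      hUΦ]
    exact Φ.map_target hv
  have hmem : ∀ q : U, (q : X) ∈ Φ.source := fun q => hUΦ ▸ q.2
  let c : GlobalChart U :=
    { toChart := Φ.subtypeRestr hU
      isHolChart := hN.isHolChart.subtypeRestr hU
      source_eq := by
        rw [Φ.subtypeRestr_source]
        exact Set.eq_univ_of_forall hmem
      zero_mem := htarget ▸ h0 }
  have hN' : IsNormalForm (fun k => ((↑) : U → X) ⁻¹' D k) t c.toChart ε δ u :=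
    { isHolChart := c.isHolChart
      eps_pos := hN.eps_pos
      delta_pos := hN.delta_pos
      target_eq := htarget.trans hN.target_eq
      analyticOnNhd := hN.analyticOnNhd
      mem_ball := hN.mem_ball
      ne := hN.ne
      mem_iff := fun k q _ => hN.mem_iff k q (hmem q) }
  have key := h.2 (Tower c t) Tower.proj (Tower.isLogResolution_proj ht hN') _ _
    (Tower.isExceptionalDivisor_excCurve ht) (Tower.hasDiscrepancy_excCurve ht hN' b)
  have ht' : (0 : ℝ) < t := by exact_mod_cast ht
  rw [← Finset.sum_mul] at key
  rw [← mul_lt_mul_iff_left₀ ht', add_mul, one_div, inv_mul_cancel₀ ht'.ne']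
  linarith

/-- A germ of pair whose components are smooth curve germs with pairwise contact order `t` is klt
if and only if the sum of the coefficients is less than `1 + 1 / t`. -/
theorem isKltGerm_iff_sum_lt {κ : Type} [Fintype κ] [Nonempty κ] [T2Space X]
    [IsManifold 𝓘(ℂ, ℂ × ℂ) ω X] {p : X} {D : κ → Set X} (hD : ∀ k, IsSmoothCurveAt (D k) p)
    (ht : 1 ≤ t) (hcontact : ∀ i j, i ≠ j → HasContactOrder (D i) (D j) p t) {b : κ → ℝ}
    (hb : ∀ k, 0 < b k ∧ b k < 1) : IsKltGerm p D b ↔ ∑ k, b k < 1 + 1 / (t : ℝ) := by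
  constructor
  · rintro ⟨V, hV, h⟩
    obtain ⟨Φ, ε, δ, u, hp, hΦV, -, hN⟩ := exists_isNormalForm hD ht hcontact hV
    exact hN.sum_lt_of_isKlt ht (U := ⟨Φ.source, Φ.open_source⟩) rfl (h _ hp hΦV)
  · intro hsum
    obtain ⟨Φ, ε, δ, u, hp, -, -, hN⟩ := exists_isNormalForm hD ht hcontact Filter.univ_mem
    refine ⟨Φ.source, Φ.open_source.mem_nhds hp, fun U hpU hU => ?_⟩
    have : Nonempty U := ⟨⟨p, hpU⟩⟩
    exact hN.isKlt hb ht hsum hU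

end

/-! ### The numerical classification -/

/-- The triples of integers `≥ 2` with sum of inverses greater than `1`. -/
lemma one_lt_sum_inv_iff {a b c : ℕ} (ha : 2 ≤ a) (hab : a ≤ b) (hbc : b ≤ c) :
    (1 : ℝ) < 1 / a + 1 / b + 1 / c ↔ a = 2 ∧ (b = 2 ∨ b = 3 ∧ c ≤ 5) := by
  have ha' : (0 : ℝ) < a := by exact_mod_cast (by omega : 0 < a)
  have hb' : (0 : ℝ) < b := by exact_mod_cast (by omega : 0 < b)
  have hc' : (0 : ℝ) < c := by exact_mod_cast (by omega : 0 < c)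
  have h : (1 : ℝ) < 1 / a + 1 / b + 1 / c ↔ a * b * c < b * c + a * c + a * b := by
    rw [div_add_div _ _ ha'.ne' hb'.ne', div_add_div _ _ (mul_pos ha' hb').ne' hc'.ne',
      lt_div_iff₀ (by positivity), ← @Nat.cast_lt ℝ]
    push_cast
    constructor <;> intro h <;> linarith
  rw [h]
  constructor
  · intro h
    have h2 : a = 2 := by
      by_contra hne
      have h1 : 3 * (b * c) ≤ a * (b * c) := Nat.mul_le_mul_right _ (by omega)
      have h3 : a * c ≤ b * c := Nat.mul_le_mul_right _ hab
      have h4 : a * b ≤ c * b := Nat.mul_le_mul_right _ (by omega)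
      nlinarith
    subst h2
    refine ⟨rfl, ?_⟩
    have h3 : b ≤ 3 := by
      by_contra hne
      have h1 : 4 * c ≤ b * c := Nat.mul_le_mul_right _ (by omega)
      nlinarith
    obtain rfl | rfl : b = 2 ∨ b = 3 := by omega
    · exact Or.inl rfl
    · exact Or.inr ⟨rfl, by omega⟩
  · rintro ⟨rfl, rfl | ⟨rfl, h⟩⟩ <;> omega

lemma sum_lt_iff_of_monotone {r : ℕ} (hr : 2 ≤ r) {t : ℕ} (ht : 1 ≤ t) {m : Fin r → ℕ}
    (hm : ∀ k, 2 ≤ m k) (hmono : Monotone m) :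
    ∑ k, (1 - 1 / (m k : ℝ)) < 1 + 1 / (t : ℝ) ↔
      (t = 1 ∧ r = 2) ∨
      (t = 1 ∧ ∃ c, 2 ≤ c ∧ List.ofFn m = [2, 2, c]) ∨
      (t = 1 ∧ ∃ c, 3 ≤ c ∧ c ≤ 5 ∧ List.ofFn m = [2, 3, c]) ∨
      (t = 2 ∧ ∃ c, 2 ≤ c ∧ List.ofFn m = [2, c]) ∨
      (t = 2 ∧ ∃ c, 3 ≤ c ∧ c ≤ 5 ∧ List.ofFn m = [3, c]) ∨
      (t = 3 ∧ ∃ c, 2 ≤ c ∧ c ≤ 5 ∧ List.ofFn m = [2, c]) ∨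
      ((t = 4 ∨ t = 5) ∧ ∃ c, 2 ≤ c ∧ c ≤ 3 ∧ List.ofFn m = [2, c]) ∨
      (6 ≤ t ∧ List.ofFn m = [2, 2]) := by
  have ht1 : 1 / (t : ℝ) ≤ 1 := by
    rw [div_le_one (by exact_mod_cast ht)]
    exact_mod_cast ht
  -- every coefficient is at least `1 / 2`
  have hge : (r : ℝ) * (1 / 2) ≤ ∑ k, (1 - 1 / (m k : ℝ)) := by
    have h : ∀ k ∈ Finset.univ, (1 / 2 : ℝ) ≤ 1 - 1 / (m k : ℝ) := by
      intro k _
      have h2 : 1 / (m k : ℝ) ≤ 1 / 2 :=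
        one_div_le_one_div_of_le two_pos (by exact_mod_cast hm k)
      linarith
    simpa using Finset.card_nsmul_le_sum _ _ _ h
  obtain rfl | rfl | h4 : r = 2 ∨ r = 3 ∨ 4 ≤ r := by omega
  · have h0 := hm 0
    have h01 : m 0 ≤ m 1 := hmono (by simp)
    have hlist : List.ofFn m = [m 0, m 1] := by simp [List.ofFn_succ]
    have hsum : ∑ k, (1 - 1 / (m k : ℝ)) = 2 - (1 / (m 0 : ℝ) + 1 / (m 1 : ℝ)) := by
      rw [Fin.sum_univ_two]
      ring
    rw [hsum, hlist]
    generalize m 0 = a at *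
    generalize m 1 = b at *
    have hiff : (2 - (1 / (a : ℝ) + 1 / (b : ℝ)) < 1 + 1 / (t : ℝ)) ↔
        (1 : ℝ) < 1 / a + 1 / b + 1 / t := by
      constructor <;> intro h <;> linarith
    have hex : ∀ x : ℕ, ∀ P : ℕ → Prop, (∃ c, P c ∧ [a, b] = [x, c]) ↔ a = x ∧ P b := by
      intro x P
      constructor
      · rintro ⟨c, hc, h⟩
        simp only [List.cons.injEq, and_true] at h
        exact ⟨h.1, h.2 ▸ hc⟩
      · rintro ⟨rfl, h⟩
        exact ⟨b, h, rfl⟩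
    have hno : ∀ c, [a, b] ≠ [2, 2, c] ∧ [a, b] ≠ [2, 3, c] := fun c => ⟨by simp, by simp⟩
    have hex2 : ∀ x l n : ℕ, (∃ c, l ≤ c ∧ c ≤ n ∧ [a, b] = [x, c]) ↔ a = x ∧ l ≤ b ∧ b ≤ n := by
      intro x l n
      simpa only [and_assoc] using hex x fun c => l ≤ c ∧ c ≤ n
    simp only [hex, hex2, hno, and_false, exists_false, false_or]
    simp only [List.cons.injEq, and_true]
    rcases Nat.lt_or_ge t 2 with h | h
    · obtain rfl : t = 1 := by omega
      have : 0 < 1 / (a : ℝ) + 1 / (b : ℝ) := by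
        have : (0 : ℝ) < a := by exact_mod_cast (by omega : 0 < a)
        positivity
      simp only [true_or, iff_true, Nat.cast_one]
      linarith
    -- the condition is symmetric in the three numbers `a`, `b` and `t`
    rw [hiff]
    rcases le_total t a with h1 | h1
    · rw [show 1 / (a : ℝ) + 1 / b + 1 / t = 1 / t + 1 / a + 1 / b by ring,
        one_lt_sum_inv_iff h h1 h01]
      omega
    rcases le_total t b with h2 | h2
    · rw [show 1 / (a : ℝ) + 1 / b + 1 / t = 1 / a + 1 / t + 1 / b by ring,
        one_lt_sum_inv_iff h0 h1 h2]
      omega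
    · rw [one_lt_sum_inv_iff h0 h01 h2]
      omega
  · have h0 := hm 0
    have h01 : m 0 ≤ m 1 := hmono (by decide)
    have h12 : m 1 ≤ m 2 := hmono (by decide)
    have hlist : List.ofFn m = [m 0, m 1, m 2] := by simp [List.ofFn_succ]
    have hsum : ∑ k, (1 - 1 / (m k : ℝ)) =
        3 - (1 / (m 0 : ℝ) + 1 / (m 1 : ℝ) + 1 / (m 2 : ℝ)) := by
      rw [Fin.sum_univ_three]
      ring
    rcases Nat.lt_or_ge t 2 with h | h
    · obtain rfl : t = 1 := by omega
      have hiff : (∑ k, (1 - 1 / (m k : ℝ)) < 1 + 1 / ((1 : ℕ) : ℝ)) ↔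
          (1 : ℝ) < 1 / m 0 + 1 / m 1 + 1 / m 2 := by
        rw [hsum, Nat.cast_one]
        constructor <;> intro h <;> linarith
      rw [hiff, one_lt_sum_inv_iff h0 h01 h12, hlist]
      constructor
      · rintro ⟨h2, h3 | ⟨h3, h5⟩⟩
        · exact Or.inr (Or.inl ⟨rfl, m 2, by omega, by rw [h2, h3]⟩)
        · exact Or.inr (Or.inr (Or.inl ⟨rfl, m 2, by omega, h5, by rw [h2, h3]⟩))
      · rintro (⟨-, h⟩ | ⟨-, c, hc, h⟩ | ⟨-, c, hc, hc5, h⟩ | ⟨h, -⟩ | ⟨h, -⟩ | ⟨h, -⟩ | ⟨h, -⟩ |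
          ⟨h, -⟩)
        · omega
        · simp only [List.cons.injEq, and_true] at h
          omega
        · simp only [List.cons.injEq, and_true] at h
          omega
        all_goals omega
    · have ht2 : 1 / (t : ℝ) ≤ 1 / 2 := one_div_le_one_div_of_le two_pos (by exact_mod_cast h)
      rw [hlist]
      refine iff_of_false ?_ ?_
      · push_cast at hge
        linarith
      · simp
        omega
  · have hlen : ∀ L : List ℕ, L.length < 4 → List.ofFn m ≠ L := by
      rintro L hL rfl
      rw [List.length_ofFn] at hL
      omega
    refine iff_of_false ?_ ?_
    · have : (4 : ℝ) ≤ r := by exact_mod_cast h4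
      linarith
    · simp [hlen]
      omega

end SurfacePair


theorem mainTheorem10 {X : Type u} [TopologicalSpace X] [T2Space X] [ChartedSpace (ℂ × ℂ) X]
    [IsManifold 𝓘(ℂ, ℂ × ℂ) ω X] (p : X)
    {r : ℕ} (hr : 2 ≤ r) (D : Fin r → Set X)
    (hD : ∀ k, SurfacePair.IsSmoothCurveAt (D k) p)
    (t : ℕ) (ht : 1 ≤ t)
    (hcontact : ∀ i j, i ≠ j → SurfacePair.HasContactOrder (D i) (D j) p t)
    (m : Fin r → ℕ) (hm : ∀ k, 2 ≤ m k) :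
    (SurfacePair.IsKltGerm p D (fun k => 1 - 1 / (m k : ℝ)) ↔
      ∑ k, (1 - 1 / (m k : ℝ)) < 1 + 1 / (t : ℝ)) ∧
    (Monotone m →
      (SurfacePair.IsKltGerm p D (fun k => 1 - 1 / (m k : ℝ)) ↔
        (t = 1 ∧ r = 2) ∨
        (t = 1 ∧ ∃ c, 2 ≤ c ∧ List.ofFn m = [2, 2, c]) ∨
        (t = 1 ∧ ∃ c, 3 ≤ c ∧ c ≤ 5 ∧ List.ofFn m = [2, 3, c]) ∨
        (t = 2 ∧ ∃ c, 2 ≤ c ∧ List.ofFn m = [2, c]) ∨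
        (t = 2 ∧ ∃ c, 3 ≤ c ∧ c ≤ 5 ∧ List.ofFn m = [3, c]) ∨
        (t = 3 ∧ ∃ c, 2 ≤ c ∧ c ≤ 5 ∧ List.ofFn m = [2, c]) ∨
        ((t = 4 ∨ t = 5) ∧ ∃ c, 2 ≤ c ∧ c ≤ 3 ∧ List.ofFn m = [2, c]) ∨
        (6 ≤ t ∧ List.ofFn m = [2, 2]))) := by
  have : Nonempty (Fin r) := ⟨⟨0, by omega⟩⟩
  have hb : ∀ k, 0 < 1 - 1 / (m k : ℝ) ∧ 1 - 1 / (m k : ℝ) < 1 := by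
    intro k
    have h2 : (2 : ℝ) ≤ m k := by exact_mod_cast hm k
    have h1 : 1 / (m k : ℝ) ≤ 1 / 2 := one_div_le_one_div_of_le two_pos h2
    have h0 : 0 < 1 / (m k : ℝ) := by positivity
    constructor <;> linarith
  have key := SurfacePair.isKltGerm_iff_sum_lt hD ht hcontact hb
  exact ⟨key, fun hmono => key.trans (SurfacePair.sum_lt_iff_of_monotone hr ht hm hmono)⟩
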